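/- Let $\mathbb{T}=\mathbb{R}/2\pi\mathbb{Z}$. For $u(x)=\sum_{n\in\mathbb{Z}}u_n e^{inx}$ on $\mathbb{T}$ and $s>0$ let $(D^{s}u)(x)=\sum_{n\in\mathbb{Z}}|n|^{s}u_ne^{inx}$, and let $H^s_{\rm per}$ be the space of real-valued $u\in L^2(\mathbb{T})$ with $\sum_n(1+n^2)^s|u_n|^2<\infty$. For $\alpha>0$ and $c\in\mathbb{R}$ put $$\mathcal{B}_c(u)=\frac12\int_{-\pi}^{\pi}\left[(D^{\alpha/2}u)^2+c\,u^2\right]dx,\qquad u\in H^{\alpha/2}_{\rm per}.$$ Fix $\alpha>\frac12$ and $m_0:=(2\pi)^{-1/4}$. For every $m\in[-m_0,m_0]$ and every $c\in(-1,\infty)$ the variational problem $$r_{c,m}:=\inf_{u\in H^{\alpha/2}_{\rm per}}\left\{\mathcal{B}_c(u):\ \int_{-\pi}^{\pi}u^4\,dx=1,\ \ \frac1{2\pi}\int_{-\pi}^{\pi}u\,dx=m\right\}$$ has a ground state, i.e. a minimiser $\chi\in H^{\alpha/2}_{\rm per}$. If $m\in(-m_0,m_0)$, then for every ground state $\chi$: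 1. if $\alpha\le 2$, then $\chi$ has a single-lobe profile, that is, $\chi$ agrees almost everywhere with a continuous function on $\mathbb{T}$ that has exactly one point of local maximum and exactly one point of local minimum; 2. there exist $C>0$ and $b\in\mathbb{R}$ such that $\psi=C\chi$ belongs to $H^{\alpha}_{\rm per}$ and satisfies the stationary equation $$D^{\alpha}\psi+c\,\psi+b=2\psi^3\quad\text{almost everywhere on }\mathbb{T}.$$ -/

import Mathlib

noncomputable section

namespace FracMKdV

open MeasureTheory

instance fact_two_pi_pos : Fact (0 < 2 * Real.pi) := ⟨Real.two_pi_pos⟩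

/-- The circle of length `2π`; its measure `volume` has total mass `2π`, so that integrals over it
are the integrals over `[-π, π]`. -/
abbrev Torus : Type := AddCircle (2 * Real.pi)

/-- The Fourier coefficient `(1 / 2π) ∫ u(x) e^{-inx} dx` of a real function on the circle. -/
def coeff (u : Torus → ℝ) (n : ℤ) : ℂ := fourierCoeff (fun x => (u x : ℂ)) n

/-- `u` belongs to the real periodic Sobolev space of order `s ≥ 0`. -/
def MemSobolev (s : ℝ) (u : Torus → ℝ) : Prop :=
  MemLp u 2 volume ∧ Summable fun n : ℤ => (1 + (n : ℝ) ^ 2) ^ s * ‖coeff u n‖ ^ 2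

/-- The Fourier series `∑ |n|^s u_n e^{inx}`, summed in `L²`; it converges for `u` in the Sobolev
space of order `s`, for `s > 0`. -/
def fracSeries (s : ℝ) (u : Torus → ℝ) :
    Lp ℂ 2 (AddCircle.haarAddCircle : Measure Torus) :=
  ∑' n : ℤ, ((|(n : ℝ)| ^ s : ℝ) * coeff u n : ℂ) • fourierLp 2 n

/-- The fractional operator `D^s` on real functions. The multiplier is real and even, so the sum of
the Fourier series is real almost everywhere, and its real part is the sum itself. -/
def fracD (s : ℝ) (u : Torus → ℝ) (x : Torus) : ℝ := (fracSeries s u x).re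

/-- `B_c(u) = (1/2) ∫ [(D^{α/2} u)² + c u²] dx`. -/
def energyB (α c : ℝ) (u : Torus → ℝ) : ℝ :=
  (1 / 2) * ∫ x : Torus, ((fracD (α / 2) u x) ^ 2 + c * (u x) ^ 2)

/-- The functions in the Sobolev space of order `α/2` with `∫ u⁴ = 1` and mean value `m`. -/
def Admissible (α m : ℝ) : Set (Torus → ℝ) :=
  {u | MemSobolev (α / 2) u ∧ ∫ x : Torus, (u x) ^ 4 = 1 ∧
    1 / (2 * Real.pi) * ∫ x : Torus, u x = m}

/-- `χ` is a minimiser of `B_c` under the two constraints. -/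
def IsGroundState (α c m : ℝ) (χ : Torus → ℝ) : Prop :=
  χ ∈ Admissible α m ∧ IsMinOn (energyB α c) (Admissible α m) χ

/-- Single-lobe profile: up to a null set, `u` is a continuous function on the circle with exactly
one point of local maximum and exactly one point of local minimum. -/
def SingleLobe (u : Torus → ℝ) : Prop :=
  ∃ v : Torus → ℝ, Continuous v ∧ u =ᵐ[volume] v ∧
    (∃! x, IsLocalMax v x) ∧ (∃! x, IsLocalMin v x)

/-- `ψ` is a strong solution of `D^α ψ + c ψ + b = 2 ψ³` in the Sobolev space of order `α`. -/
def SolvesStationary (α c b : ℝ) (ψ : Torus → ℝ) : Prop :=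
  MemSobolev α ψ ∧ ∀ᵐ x : Torus, fracD α ψ x + c * ψ x + b = 2 * (ψ x) ^ 3

end FracMKdV

end

/-!
Ground states of the fractional modified Korteweg–de Vries functional on the circle.

Everything is expressed through Fourier coefficients `a n = coeff u n`: for `u` in the Sobolev space
of order `α/2`, `energyB α c u = π ∑ |n|^α ‖a n‖² + (c/2) ∫ u²`.

*Existence* (`exists_isGroundState`). For `c > -1` the energy controls the Sobolev norm of the part
of `u` with mean zero. For `α > 1/2` a weighted Cauchy–Schwarz estimate of the convolution square
of the coefficients bounds `∫ u⁴` by that norm, uniformly in the tail of the coefficients. A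
minimizing sequence thus has a subsequence with convergent coefficients whose limit keeps `∫ u⁴ = 1`
and does not increase the energy. The condition `|m| ≤ (2π)^(-1/4)` makes the constraints
compatible.

*Multipliers* (`IsGroundState.exists_multipliers`). A ground state also minimises
the energy under the relaxed constraint `∫ u⁴ ≥ 1`, by scaling the part of mean zero. By convexity,
`∫ (χ + tφ)⁴ ≥ 1 + 4t ∫ χ³φ` for every `t`, so directions `φ` of mean zero with `∫ χ³φ ≥ 0` are
admissible for the relaxed problem, and the derivative of the energy is nonnegative along them.
This gives the Euler–Lagrange equation, with a multiplier `μ > 0` because `2π m⁴ < 1`, and `C = √(μ/2)` normalises the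
cubic term.

*Regularity* (`IsGroundState.regularity`). The equation expresses the coefficients of `χ` through
those of `χ³ = χ² χ`, with `χ² ∈ L²`, and convolution with a square summable sequence loses little
more than half a derivative; a finite iteration reaches the Sobolev space of order `α`, which
consists of functions with absolutely summable coefficients.

*Single lobe* (`IsGroundState.singleLobe`). For `0 < α < 2` the symbol `|n|^α` is a positive
superposition of the symbols `n² / (l² + n²)`, and each of these is a multiple of the Dirichlet form
`∬ K(x - y) (u x - u y)²` with a kernel `K(x) = cosh (l (π - ‖x‖))` decreasing in `‖x‖`; the case
`α = 2` is a limit. Hence the polarization of `u` at a reflection, which places the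
larger of `u x` and `u (-x)` in a fixed half circle, does not increase the fractional form, and for
`α < 2` it decreases it strictly unless `u` or its reflection dominates on the half circle. So a
ground state is ordered by every reflection (`ReflectionOrdered`); a perturbation of the same
argument by an odd bump, together with the Euler–Lagrange equation, shows that local symmetry about
a point is global (`ReflectionRigid`). For `α = 2` there is no strict inequality, but the
polarization is again a ground state, hence differentiable, which forces `u` and its reflection to
have the same slope wherever they meet inside the half circle; uniqueness for the linear equation of
their difference then makes them equal, and both properties follow. By connectedness of the line of
centres, a function ordered by every reflection is symmetric and monotone about some centre, and
rigidity excludes plateaus: there is one local maximum and one local minimum.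
-/

noncomputable section

namespace FracMKdV

open MeasureTheory AddCircle Filter Topology ComplexConjugate
open scoped ENNReal

/-! ### Fourier coefficients of real functions on the circle -/

lemma memLp_ofReal {u : Torus → ℝ} {p : ENNReal} (hu : MemLp u p volume) :
    MemLp (fun x => (u x : ℂ)) p (haarAddCircle : Measure Torus) :=
  hu.ofReal.haarAddCircle

lemma ae_haar_iff {p : Torus → Prop} :
    (∀ᵐ x ∂(haarAddCircle : Measure Torus), p x) ↔ ∀ᵐ x : Torus, p x := by
  rw [volume_eq_smul_haarAddCircle, Measure.ae_ennreal_smul_measure_iff]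
  simpa using Real.pi_pos

lemma integral_haar (f : Torus → ℝ) :
    ∫ x, f x ∂(haarAddCircle : Measure Torus) = (2 * Real.pi)⁻¹ * ∫ x, f x := by
  rw [integral_haarAddCircle, smul_eq_mul]

/-- Parseval's identity for the inner product of two square integrable functions. -/
lemma hasSum_conj_fourierCoeff_mul {f g : Torus → ℂ}
    (hf : MemLp f 2 (haarAddCircle : Measure Torus))
    (hg : MemLp g 2 (haarAddCircle : Measure Torus)) :
    HasSum (fun n => conj (fourierCoeff f n) * fourierCoeff g n)
      (∫ x, conj (f x) * g x ∂(haarAddCircle : Measure Torus)) := by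
  have h := fourierBasis.hasSum_inner_mul_inner (hf.toLp f) (hg.toLp g)
  have e : ∀ n, inner ℂ (hf.toLp f) (fourierBasis n) * inner ℂ (fourierBasis n) (hg.toLp g)
      = conj (fourierCoeff f n) * fourierCoeff g n := by
    intro n
    rw [← inner_conj_symm, ← HilbertBasis.repr_apply_apply, ← HilbertBasis.repr_apply_apply,
      fourierBasis_repr, fourierBasis_repr, fourierCoeff_congr_ae hf.coeFn_toLp,
      fourierCoeff_congr_ae hg.coeFn_toLp]
  simp_rw [e] at h
  have e2 : inner ℂ (hf.toLp f) (hg.toLp g)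
      = ∫ x, conj (f x) * g x ∂(haarAddCircle : Measure Torus) := by
    rw [L2.inner_def]
    refine integral_congr_ae ?_
    filter_upwards [hf.coeFn_toLp, hg.coeFn_toLp] with x h1 h2
    rw [h1, h2, RCLike.inner_apply, mul_comm]
  rw [e2] at h
  exact h

lemma coeff_neg_index (u : Torus → ℝ) (n : ℤ) : coeff u (-n) = conj (coeff u n) := by
  unfold coeff fourierCoeff
  rw [← integral_conj]
  congr 1; ext x
  rw [smul_eq_mul, smul_eq_mul, map_mul, Complex.conj_ofReal, ← fourier_neg]

lemma coeff_congr {u v : Torus → ℝ} (h : u =ᵐ[volume] v) : coeff u = coeff v := by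
  unfold coeff
  apply fourierCoeff_congr_ae
  rw [EventuallyEq, ae_haar_iff]
  filter_upwards [h] with x hx
  rw [hx]

lemma integrable_ofReal {u : Torus → ℝ} (hu : Integrable u volume) :
    Integrable (fun x => (u x : ℂ)) (haarAddCircle : Measure Torus) := by
  rw [← memLp_one_iff_integrable] at hu ⊢
  exact memLp_ofReal hu

lemma coeff_add {u v : Torus → ℝ} (hu : Integrable u volume) (hv : Integrable v volume) (n : ℤ) :
    coeff (fun x => u x + v x) n = coeff u n + coeff v n := by
  unfold coeff
  have := congrFun (fourierCoeff.add (integrable_ofReal hu) (integrable_ofReal hv)) n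
  rw [Pi.add_apply] at this
  rw [← this]
  congr 1; ext x; simp

lemma coeff_const_mul (u : Torus → ℝ) (t : ℝ) (n : ℤ) :
    coeff (fun x => t * u x) n = t * coeff u n := by
  unfold coeff
  rw [← fourierCoeff.const_mul]
  congr 1; ext x; simp

lemma coeff_sub {u v : Torus → ℝ} (hu : Integrable u volume) (hv : Integrable v volume) (n : ℤ) :
    coeff (fun x => u x - v x) n = coeff u n - coeff v n := by
  have := coeff_add hu (hv.const_mul (-1)) n
  rw [coeff_const_mul] at this
  simpa [sub_eq_add_neg] using this

lemma coeff_zero (u : Torus → ℝ) : coeff u 0 = ((1 / (2 * Real.pi) * ∫ x, u x : ℝ) : ℂ) := by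
  unfold coeff fourierCoeff
  simp only [neg_zero, fourier_zero, one_smul]
  have := integral_ofReal (𝕜 := ℂ) (f := u) (μ := (haarAddCircle : Measure Torus))
  rw [integral_haar, ← one_div] at this
  exact this

lemma coeff_const (t : ℝ) (n : ℤ) : coeff (fun _ => t) n = if n = 0 then (t : ℂ) else 0 := by
  have : coeff (fun _ => t) n = t * fourierCoeff (fourier 0 : Torus → ℂ) n := by
    rw [← fourierCoeff.const_mul]
    unfold coeff
    congr 1; ext x; rw [fourier_zero, mul_one]
  rw [this]
  have h2 := congrFun (fourierCoeff_fourier (T := 2 * Real.pi) 0) n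
  rw [h2]
  by_cases h : n = 0
  · simp [h]
  · simp [h]

lemma coeff_comp_add_right (u : Torus → ℝ) (e : Torus) (n : ℤ) :
    coeff (fun x => u (x + e)) n = fourier n e * coeff u n := by
  unfold coeff fourierCoeff
  rw [← integral_const_mul,
    ← integral_add_right_eq_self (fun t => fourier n e * (fourier (-n) t • ((u t : ℝ) : ℂ))) e]
  congr 1; ext x
  rw [smul_eq_mul, smul_eq_mul, ← mul_assoc]
  congr 1
  have h1 : fourier (-n) (x + e) = fourier (-n) x * fourier (-n) e := by
    simp only [fourier_apply, smul_add, toCircle_add, Circle.coe_mul]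
  rw [h1, mul_left_comm, ← fourier_add]
  simp

lemma coeff_comp_neg (u : Torus → ℝ) (n : ℤ) :
    coeff (fun x => u (-x)) n = coeff u (-n) := by
  unfold coeff fourierCoeff
  rw [← integral_neg_eq_self]
  congr 1; ext x
  simp

lemma norm_coeff_comp_add_right (u : Torus → ℝ) (e : Torus) (n : ℤ) :
    ‖coeff (fun x => u (x + e)) n‖ = ‖coeff u n‖ := by
  rw [coeff_comp_add_right, norm_mul, fourier_apply, Circle.norm_coe, one_mul]

lemma hasSum_coeff_mul {u v : Torus → ℝ} (hu : MemLp u 2 volume) (hv : MemLp v 2 volume) :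
    HasSum (fun n => (conj (coeff u n) * coeff v n).re)
      ((2 * Real.pi)⁻¹ * ∫ x, u x * v x) := by
  have h := Complex.hasSum_re (hasSum_conj_fourierCoeff_mul (memLp_ofReal hu) (memLp_ofReal hv))
  have e : (∫ x, conj (u x : ℂ) * (v x : ℂ) ∂(haarAddCircle : Measure Torus)).re
      = (2 * Real.pi)⁻¹ * ∫ x, u x * v x := by
    rw [← integral_haar]
    simp_rw [Complex.conj_ofReal, ← Complex.ofReal_mul]
    have := integral_ofReal (𝕜 := ℂ) (f := fun x => u x * v x)
      (μ := (haarAddCircle : Measure Torus))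
    exact (congrArg Complex.re this).trans (Complex.ofReal_re _)
  rw [e] at h
  exact h

lemma hasSum_norm_coeff_sq {u : Torus → ℝ} (hu : MemLp u 2 volume) :
    HasSum (fun n => ‖coeff u n‖ ^ 2) ((2 * Real.pi)⁻¹ * ∫ x, (u x) ^ 2) := by
  convert hasSum_coeff_mul hu hu using 1
  · ext n
    rw [mul_comm, Complex.mul_conj, Complex.ofReal_re, Complex.normSq_eq_norm_sq]
  · simp_rw [sq]

/-- The coefficients of a product of square integrable functions are the convolution of the
coefficients. -/
lemma hasSum_coeff_mul_conv {u v : Torus → ℝ} (hu : MemLp u 2 volume) (hv : MemLp v 2 volume)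
    (k : ℤ) : HasSum (fun n => coeff u (k - n) * coeff v n) (coeff (fun x => u x * v x) k) := by
  have hf : MemLp (fun x => fourier k x * (u x : ℂ)) 2 (haarAddCircle : Measure Torus) := by
    refine (memLp_ofReal hu).of_le (((fourier k).continuous.aestronglyMeasurable).mul
      (memLp_ofReal hu).1) (Eventually.of_forall fun x => ?_)
    rw [norm_mul, fourier_apply, Circle.norm_coe, one_mul]
  convert hasSum_conj_fourierCoeff_mul hf (memLp_ofReal hv) using 1
  · ext n
    congr 1
    have : fourierCoeff (fun x => fourier k x * (u x : ℂ)) n = coeff u (n - k) := by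
      unfold coeff fourierCoeff
      congr 1; ext x
      rw [smul_eq_mul, smul_eq_mul, ← mul_assoc, ← fourier_add]
      congr 2; ring_nf
    rw [this, ← coeff_neg_index, neg_sub]
  · unfold coeff fourierCoeff
    congr 1; ext x
    rw [smul_eq_mul, map_mul, ← fourier_neg, Complex.conj_ofReal]
    push_cast; ring

lemma ae_eq_of_coeff_eq {u v : Torus → ℝ} (hu : MemLp u 2 volume) (hv : MemLp v 2 volume)
    (h : ∀ n, coeff u n = coeff v n) : u =ᵐ[volume] v := by
  have hsub : MemLp (fun x => u x - v x) 2 volume := hu.sub hv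
  have h0 := hasSum_norm_coeff_sq hsub
  have h1 : ∀ n, coeff (fun x => u x - v x) n = 0 := fun n => by
    rw [coeff_sub (hu.integrable (by norm_num)) (hv.integrable (by norm_num)), h, sub_self]
  simp only [h1, norm_zero, ne_eq, OfNat.ofNat_ne_zero, not_false_eq_true, zero_pow] at h0
  have h2 := h0.unique hasSum_zero
  have h3 : ∫ x, (u x - v x) ^ 2 = 0 := by
    rcases mul_eq_zero.1 h2 with h | h
    · have := Real.pi_pos
      simp at h
    · exact h
  rw [integral_eq_zero_iff_of_nonneg (fun x => sq_nonneg _) hsub.integrable_sq] at h3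
  filter_upwards [h3] with x hx
  simpa [sub_eq_zero] using hx

/-- Riesz–Fischer for real functions: a square summable sequence with the conjugation symmetry is
the sequence of Fourier coefficients of a real square integrable function, and the `L²` sum of the
series has vanishing imaginary part. -/
lemma coeff_re_tsum {a : ℤ → ℂ} (ha : Summable fun n => ‖a n‖ ^ 2)
    (hconj : ∀ n, a (-n) = conj (a n)) :
    MemLp (fun x => ((∑' n : ℤ, a n • fourierLp 2 n :
      Lp ℂ 2 (haarAddCircle : Measure Torus)) x).re) 2 volume ∧
    ∀ n, coeff (fun x => ((∑' n : ℤ, a n • fourierLp 2 n :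
      Lp ℂ 2 (haarAddCircle : Measure Torus)) x).re) n = a n := by
  have hmem : Memℓp a 2 := by
    rw [memℓp_gen_iff (by norm_num)]
    simpa using ha
  set b : lp (fun _ : ℤ => ℂ) 2 := ⟨a, hmem⟩
  set F : Lp ℂ 2 (haarAddCircle : Measure Torus) := ∑' n : ℤ, a n • fourierLp 2 n with hF
  have hFb : F = fourierBasis.repr.symm b := by
    have := (fourierBasis (T := 2 * Real.pi)).hasSum_repr_symm b
    rw [coe_fourierBasis] at this
    exact this.tsum_eq
  have hco : ∀ n, fourierCoeff F n = a n := by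
    intro n
    rw [← fourierBasis_repr, hFb, LinearIsometryEquiv.apply_symm_apply]
  have hFm : MemLp (fun x => F x) 2 (haarAddCircle : Measure Torus) := Lp.memLp F
  have hre : MemLp (fun x => (F x).re) 2 volume := by
    have := hFm.of_haarAddCircle
    exact this.re
  refine ⟨hre, fun n => ?_⟩
  have hint : Integrable (fun x => F x) (haarAddCircle : Measure Torus) :=
    hFm.integrable (by norm_num)
  have h1 : fourierCoeff (fun x => conj (F x)) n = a n := by
    have : fourierCoeff (fun x => conj (F x)) n = conj (fourierCoeff F (-n)) := by
      unfold fourierCoeff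
      rw [← integral_conj]
      congr 1; ext x
      rw [smul_eq_mul, smul_eq_mul, map_mul, ← fourier_neg, neg_neg]
    rw [this, hco, hconj, Complex.conj_conj]
  have hint2 : Integrable (fun x => conj (F x)) (haarAddCircle : Measure Torus) := by
    have := hint.norm
    exact (integrable_norm_iff (Complex.continuous_conj.comp_aestronglyMeasurable hint.1)).1
      (by simpa using this)
  have h2 := congrFun (fourierCoeff.add hint hint2) n
  rw [Pi.add_apply, h1, hco] at h2
  have h3 := fourierCoeff.const_mul ((fun x => F x) + fun x => conj (F x)) (1 / 2) n
  rw [h2] at h3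
  have h4 : coeff (fun x => (F x).re) n
      = fourierCoeff (fun x => (1 / 2 : ℂ) * ((fun x => F x) + fun x => conj (F x)) x) n := by
    unfold coeff
    congr 1; ext x
    rw [Pi.add_apply, Complex.add_conj]
    push_cast; ring
  rw [h4, h3]; ring

lemma memLp_of_continuous {v : Torus → ℝ} (hv : Continuous v) (p : ENNReal) :
    MemLp v p volume := by
  obtain ⟨M, hM⟩ := isCompact_univ.exists_bound_of_continuousOn hv.continuousOn
  exact MemLp.of_bound hv.aestronglyMeasurable M (Eventually.of_forall fun x => hM x trivial)

/-! ### Sobolev spaces and the energy in terms of coefficients -/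

lemma rpow_abs_two_mul (n : ℤ) (s : ℝ) : |(n : ℝ)| ^ (2 * s) = ((n : ℝ) ^ 2) ^ s := by
  rw [Real.rpow_mul (abs_nonneg _), Real.rpow_two, sq_abs]

lemma rpow_abs_le_weight (n : ℤ) {s : ℝ} (hs : 0 ≤ s) :
    |(n : ℝ)| ^ (2 * s) ≤ (1 + (n : ℝ) ^ 2) ^ s := by
  rw [rpow_abs_two_mul]
  exact Real.rpow_le_rpow (sq_nonneg _) (by linarith) hs

lemma weight_le (n : ℤ) {s : ℝ} (hs : 0 ≤ s) :
    (1 + (n : ℝ) ^ 2) ^ s ≤ 2 ^ s * (1 + |(n : ℝ)| ^ (2 * s)) := by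
  rw [rpow_abs_two_mul]
  rcases le_total ((n : ℝ) ^ 2) 1 with h | h
  · calc (1 + (n : ℝ) ^ 2) ^ s ≤ 2 ^ s := Real.rpow_le_rpow (by positivity) (by linarith) hs
      _ ≤ 2 ^ s * (1 + ((n : ℝ) ^ 2) ^ s) := by
        apply le_mul_of_one_le_right (by positivity)
        linarith [Real.rpow_nonneg (sq_nonneg (n : ℝ)) s]
  · calc (1 + (n : ℝ) ^ 2) ^ s ≤ (2 * (n : ℝ) ^ 2) ^ s :=
          Real.rpow_le_rpow (by positivity) (by linarith) hs
      _ = 2 ^ s * ((n : ℝ) ^ 2) ^ s := Real.mul_rpow (by norm_num) (sq_nonneg _)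
      _ ≤ 2 ^ s * (1 + ((n : ℝ) ^ 2) ^ s) := by gcongr; linarith

lemma memSobolev_iff {s : ℝ} (hs : 0 ≤ s) (u : Torus → ℝ) :
    MemSobolev s u ↔ MemLp u 2 volume ∧
      Summable fun n : ℤ => |(n : ℝ)| ^ (2 * s) * ‖coeff u n‖ ^ 2 := by
  refine and_congr_right fun hu => ⟨fun h => ?_, fun h => ?_⟩
  · refine h.of_nonneg_of_le (fun n => by positivity) fun n => ?_
    gcongr
    exact rpow_abs_le_weight n hs
  · refine (((hasSum_norm_coeff_sq hu).summable.add h).mul_left (2 ^ s)).of_nonneg_of_le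
      (fun n => by positivity) fun n => ?_
    calc _ ≤ (2 ^ s * (1 + |(n : ℝ)| ^ (2 * s))) * ‖coeff u n‖ ^ 2 := by
          gcongr; exact weight_le n hs
      _ = _ := by ring

/-- The quadratic form `∑ |n|^α |u_n|²`. -/
def quadForm (α : ℝ) (u : Torus → ℝ) : ℝ := ∑' n : ℤ, |(n : ℝ)| ^ α * ‖coeff u n‖ ^ 2

/-- The bilinear form `∑ |n|^α Re(conj u_n v_n)` of which `quadForm` is the diagonal. -/
def bilinForm (α : ℝ) (u v : Torus → ℝ) : ℝ :=
  ∑' n : ℤ, |(n : ℝ)| ^ α * (conj (coeff u n) * coeff v n).re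

lemma MemSobolev.summable_quad {α : ℝ} (hα : 0 ≤ α) {u : Torus → ℝ} (hu : MemSobolev (α / 2) u) :
    Summable fun n : ℤ => |(n : ℝ)| ^ α * ‖coeff u n‖ ^ 2 := by
  have := ((memSobolev_iff (by positivity) u).1 hu).2
  rwa [mul_div_cancel₀ α two_ne_zero] at this

lemma memSobolev_of_summable {α : ℝ} (hα : 0 ≤ α) {u : Torus → ℝ} (hu : MemLp u 2 volume)
    (h : Summable fun n : ℤ => |(n : ℝ)| ^ α * ‖coeff u n‖ ^ 2) : MemSobolev (α / 2) u := by
  rw [memSobolev_iff (by positivity), mul_div_cancel₀ α two_ne_zero]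
  exact ⟨hu, h⟩

lemma MemSobolev.integrable {s : ℝ} {u : Torus → ℝ} (hu : MemSobolev s u) : Integrable u volume :=
  hu.1.integrable (by norm_num)

lemma MemSobolev.congr {s : ℝ} {u v : Torus → ℝ} (hu : MemSobolev s u) (h : u =ᵐ[volume] v) :
    MemSobolev s v :=
  ⟨(memLp_congr_ae h).1 hu.1, by rw [← coeff_congr h]; exact hu.2⟩

lemma fracD_spec {s : ℝ} (hs : 0 ≤ s) {u : Torus → ℝ} (hu : MemSobolev s u) :
    MemLp (fracD s u) 2 volume ∧ ∀ n, coeff (fracD s u) n = (|(n : ℝ)| ^ s : ℝ) * coeff u n := by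
  have h := ((memSobolev_iff hs u).1 hu).2
  refine coeff_re_tsum (a := fun n => ((|(n : ℝ)| ^ s : ℝ) * coeff u n : ℂ)) ?_ fun n => ?_
  · refine h.congr fun n => ?_
    rw [norm_mul, mul_pow, Complex.norm_real, Real.norm_of_nonneg (by positivity), mul_comm 2 s,
      Real.rpow_mul (abs_nonneg _), Real.rpow_two]
  · rw [coeff_neg_index, map_mul, Complex.conj_ofReal]
    push_cast
    rw [abs_neg]

lemma energyB_eq {α : ℝ} (hα : 0 ≤ α) (c : ℝ) {u : Torus → ℝ} (hu : MemSobolev (α / 2) u) :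
    energyB α c u = Real.pi * quadForm α u + c / 2 * ∫ x, (u x) ^ 2 := by
  obtain ⟨h1, h2⟩ := fracD_spec (by positivity) hu
  have h3 := (hasSum_norm_coeff_sq h1).tsum_eq
  have h4 : (∑' n : ℤ, ‖coeff (fracD (α / 2) u) n‖ ^ 2) = quadForm α u := by
    unfold quadForm
    congr 1; ext n
    rw [h2, norm_mul, mul_pow, Complex.norm_real, Real.norm_of_nonneg (by positivity),
      ← Real.rpow_two, ← Real.rpow_mul (abs_nonneg _), div_mul_cancel₀ α two_ne_zero]
  rw [h4] at h3
  unfold energyB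
  rw [integral_add h1.integrable_sq (hu.1.integrable_sq.const_mul c), integral_const_mul, h3]
  have := Real.pi_pos
  field_simp

lemma summable_bilin {α : ℝ} (hα : 0 ≤ α) {u v : Torus → ℝ} (hu : MemSobolev (α / 2) u)
    (hv : MemSobolev (α / 2) v) :
    Summable fun n : ℤ => |(n : ℝ)| ^ α * (conj (coeff u n) * coeff v n).re := by
  refine ((hu.summable_quad hα).add (hv.summable_quad hα)).of_norm_bounded fun n => ?_
  rw [norm_mul, Real.norm_of_nonneg (by positivity), ← mul_add]
  gcongr
  calc ‖(conj (coeff u n) * coeff v n).re‖ ≤ ‖conj (coeff u n) * coeff v n‖ :=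
        Complex.abs_re_le_norm _
    _ = ‖coeff u n‖ * ‖coeff v n‖ := by rw [norm_mul, RCLike.norm_conj]
    _ ≤ _ := by
      have h1 := two_mul_le_add_sq (‖coeff u n‖) (‖coeff v n‖)
      have h2 := mul_nonneg (norm_nonneg (coeff u n)) (norm_nonneg (coeff v n))
      linarith

lemma norm_add_mul_sq (z w : ℂ) (t : ℝ) :
    ‖z + t * w‖ ^ 2 = ‖z‖ ^ 2 + 2 * t * (conj z * w).re + t ^ 2 * ‖w‖ ^ 2 := by
  simp only [← Complex.normSq_eq_norm_sq, Complex.normSq_apply]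
  simp
  ring

lemma coeff_add_const_mul {u v : Torus → ℝ} (hu : Integrable u volume) (hv : Integrable v volume)
    (t : ℝ) (n : ℤ) : coeff (fun x => u x + t * v x) n = coeff u n + t * coeff v n := by
  rw [coeff_add hu (hv.const_mul t), coeff_const_mul]

lemma hasSum_quad_add_mul {α : ℝ} (hα : 0 ≤ α) {u v : Torus → ℝ} (hu : MemSobolev (α / 2) u)
    (hv : MemSobolev (α / 2) v) (t : ℝ) :
    HasSum (fun n : ℤ => |(n : ℝ)| ^ α * ‖coeff (fun x => u x + t * v x) n‖ ^ 2)
      (quadForm α u + 2 * t * bilinForm α u v + t ^ 2 * quadForm α v) := by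
  have h := (((hu.summable_quad hα).hasSum).add
    ((summable_bilin hα hu hv).hasSum.mul_left (2 * t))).add
      ((hv.summable_quad hα).hasSum.mul_left (t ^ 2))
  refine h.congr_fun fun n => ?_
  rw [coeff_add_const_mul hu.integrable hv.integrable, norm_add_mul_sq]
  ring

lemma MemSobolev.add_mul {α : ℝ} (hα : 0 ≤ α) {u v : Torus → ℝ} (hu : MemSobolev (α / 2) u)
    (hv : MemSobolev (α / 2) v) (t : ℝ) : MemSobolev (α / 2) (fun x => u x + t * v x) :=
  memSobolev_of_summable hα (hu.1.add (hv.1.const_mul t)) (hasSum_quad_add_mul hα hu hv t).summable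

lemma quadForm_add_mul {α : ℝ} (hα : 0 ≤ α) {u v : Torus → ℝ} (hu : MemSobolev (α / 2) u)
    (hv : MemSobolev (α / 2) v) (t : ℝ) :
    quadForm α (fun x => u x + t * v x)
      = quadForm α u + 2 * t * bilinForm α u v + t ^ 2 * quadForm α v :=
  (hasSum_quad_add_mul hα hu hv t).tsum_eq

lemma memSobolev_const {α : ℝ} (hα : 0 < α) (t : ℝ) : MemSobolev (α / 2) (fun _ => t) := by
  refine memSobolev_of_summable hα.le (memLp_const t) (summable_of_ne_finset_zero (s := {0}) ?_)
  intro n hn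
  rw [coeff_const, if_neg (by simpa using hn)]
  simp

lemma bilinForm_const_right {α : ℝ} (hα : 0 < α) (u : Torus → ℝ) (t : ℝ) :
    bilinForm α u (fun _ => t) = 0 := by
  unfold bilinForm
  rw [← tsum_zero (α := ℝ) (β := ℤ)]
  congr 1; ext n
  by_cases hn : n = 0
  · simp [hn, Real.zero_rpow hα.ne']
  · simp [coeff_const, hn]

lemma bilinForm_comm (α : ℝ) (u v : Torus → ℝ) : bilinForm α u v = bilinForm α v u := by
  unfold bilinForm
  congr 1; ext n
  congr 1
  simp; ring

lemma bilinForm_add_right {α : ℝ} (hα : 0 ≤ α) {u v w : Torus → ℝ} (hu : MemSobolev (α / 2) u)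
    (hv : MemSobolev (α / 2) v) (hw : MemSobolev (α / 2) w) (t : ℝ) :
    bilinForm α u (fun x => v x + t * w x) = bilinForm α u v + t * bilinForm α u w := by
  unfold bilinForm
  rw [← tsum_mul_left, ← (summable_bilin hα hu hv).tsum_add ((summable_bilin hα hu hw).mul_left t)]
  congr 1; ext n
  rw [coeff_add_const_mul hv.integrable hw.integrable]
  simp; ring

lemma bilinForm_self (α : ℝ) (u : Torus → ℝ) : bilinForm α u u = quadForm α u := by
  unfold bilinForm quadForm
  congr 1; ext n
  rw [mul_comm (conj _), Complex.mul_conj, Complex.ofReal_re, Complex.normSq_eq_norm_sq]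

/-! ### Convolution estimates for weighted sequences -/

/-- The Sobolev weight `(1 + n²)^σ`, as an extended nonnegative number. -/
def weight (σ : ℝ) (n : ℤ) : ℝ≥0∞ := ENNReal.ofReal ((1 + (n : ℝ) ^ 2) ^ σ)

lemma weight_mul (σ τ : ℝ) (n : ℤ) : weight σ n * weight τ n = weight (σ + τ) n := by
  unfold weight
  rw [← ENNReal.ofReal_mul (by positivity), ← Real.rpow_add (by positivity)]

lemma weight_zero (n : ℤ) : weight 0 n = 1 := by simp [weight]

lemma weight_anti {σ τ : ℝ} (h : σ ≤ τ) (n : ℤ) : weight σ n ≤ weight τ n :=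
  ENNReal.ofReal_le_ofReal (Real.rpow_le_rpow_of_exponent_le (by nlinarith [sq_nonneg (n : ℝ)]) h)

lemma summable_weight {τ : ℝ} (hτ : 1 / 2 < τ) :
    Summable fun n : ℤ => (1 + (n : ℝ) ^ 2) ^ (-τ) := by
  have h := Real.summable_abs_int_rpow (b := 2 * τ) (by linarith)
  refine h.of_norm_bounded_eventually ?_
  filter_upwards [(Set.finite_singleton (0 : ℤ)).compl_mem_cofinite] with n hn
  have hn' : (n : ℝ) ≠ 0 := by simpa using hn
  rw [Real.norm_of_nonneg (by positivity), show -(2 * τ) = 2 * -τ by ring, rpow_abs_two_mul]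
  exact Real.rpow_le_rpow_of_nonpos (by positivity) (by linarith) (by linarith)

lemma tsum_weight_ne_top {τ : ℝ} (hτ : 1 / 2 < τ) : ∑' n, weight (-τ) n ≠ ⊤ :=
  (summable_weight hτ).tsum_ofReal_ne_top

lemma weight_mul_weight_le {σ τ : ℝ} (hσ : 0 ≤ σ) (hτ : 0 ≤ τ) (i j : ℤ) :
    weight (-σ) i * weight (-τ) j ≤ weight (-(σ + τ)) i + weight (-(σ + τ)) j := by
  rcases le_total ((i : ℝ) ^ 2) ((j : ℝ) ^ 2) with h | h
  · refine le_trans ?_ le_self_add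
    rw [neg_add, ← weight_mul]
    gcongr
    exact ENNReal.ofReal_le_ofReal (Real.rpow_le_rpow_of_nonpos (by positivity) (by linarith)
      (by linarith))
  · refine le_trans ?_ le_add_self
    rw [neg_add, ← weight_mul]
    gcongr
    exact ENNReal.ofReal_le_ofReal (Real.rpow_le_rpow_of_nonpos (by positivity) (by linarith)
      (by linarith))

lemma tsum_weight_mul_weight_le {σ τ : ℝ} (hσ : 0 ≤ σ) (hτ : 0 ≤ τ) (k : ℤ) :
    ∑' i, weight (-σ) (k - i) * weight (-τ) i ≤ 2 * ∑' i, weight (-(σ + τ)) i := by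
  calc ∑' i, weight (-σ) (k - i) * weight (-τ) i
      ≤ ∑' i, (weight (-(σ + τ)) (k - i) + weight (-(σ + τ)) i) :=
        ENNReal.tsum_le_tsum fun i => weight_mul_weight_le hσ hτ _ _
    _ = _ := by
        have h := (Equiv.subLeft k).tsum_eq (weight (-(σ + τ)))
        simp only [Equiv.subLeft_apply] at h
        rw [ENNReal.tsum_add, h, two_mul]

/-- The Cauchy–Schwarz inequality for series in `[0, ∞]`. -/
lemma sq_tsum_mul_le (f g : ℤ → ℝ≥0∞) :
    (∑' i, f i * g i) ^ 2 ≤ (∑' i, f i ^ 2) * ∑' i, g i ^ 2 := by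
  have h := ENNReal.lintegral_mul_le_Lp_mul_Lq (Measure.count : Measure ℤ)
    Real.HolderConjugate.two_two (f := f) (g := g) (measurable_of_countable f).aemeasurable
    (measurable_of_countable g).aemeasurable
  simp only [lintegral_count, Pi.mul_apply, ENNReal.rpow_two] at h
  calc _ ≤ _ := pow_le_pow_left' h 2
    _ = _ := by
      rw [mul_pow, ← ENNReal.rpow_natCast, ← ENNReal.rpow_natCast, ← ENNReal.rpow_mul,
        ← ENNReal.rpow_mul]
      norm_num

lemma tsum_conv (f g : ℤ → ℝ≥0∞) :
    ∑' k, ∑' i, f (k - i) * g i = (∑' i, f i) * ∑' i, g i := by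
  rw [ENNReal.tsum_comm, ← ENNReal.tsum_mul_left]
  congr 1; ext i
  have h := (Equiv.subRight i).tsum_eq f
  simp only [Equiv.subRight_apply] at h
  rw [ENNReal.tsum_mul_right, h]

lemma weight_ne_top (σ : ℝ) (n : ℤ) : weight σ n ≠ ⊤ := ENNReal.ofReal_ne_top

/-- The convolution square of a sequence in the weighted space of order `σ` is square summable if
`σ > 1/4`, when the constant on the right is finite. -/
lemma tsum_conv_self_sq_le {σ : ℝ} (hσ : 0 ≤ σ) (a : ℤ → ℝ≥0∞) :
    ∑' k, (∑' i, a (k - i) * a i) ^ 2 ≤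
      2 * (∑' i, weight (-(2 * σ)) i) * (∑' i, weight σ i * a i ^ 2) ^ 2 := by
  have key : ∀ k, (∑' i, a (k - i) * a i) ^ 2 ≤
      2 * (∑' i, weight (-(2 * σ)) i) *
        ∑' i, (weight σ (k - i) * a (k - i) ^ 2) * (weight σ i * a i ^ 2) := by
    intro k
    have e : ∀ i, a (k - i) * a i = (weight (-σ / 2) (k - i) * weight (-σ / 2) i) *
        ((weight (σ / 2) (k - i) * a (k - i)) * (weight (σ / 2) i * a i)) := by
      intro i
      calc a (k - i) * a i = (weight (-σ / 2 + σ / 2) (k - i) * a (k - i)) *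
            (weight (-σ / 2 + σ / 2) i * a i) := by
            rw [show -σ / 2 + σ / 2 = 0 by ring, weight_zero, weight_zero, one_mul, one_mul]
        _ = _ := by rw [← weight_mul, ← weight_mul]; ring
    simp_rw [e]
    refine (sq_tsum_mul_le _ _).trans ?_
    have w2 : ∀ τ n, weight (τ / 2) n ^ 2 = weight τ n := fun τ n => by
      rw [sq, weight_mul, add_halves]
    simp_rw [mul_pow, w2]
    gcongr
    rw [two_mul σ]
    exact tsum_weight_mul_weight_le hσ hσ k
  refine (ENNReal.tsum_le_tsum key).trans_eq ?_
  rw [ENNReal.tsum_mul_left, tsum_conv (fun i => weight σ i * a i ^ 2), ← sq]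

/-- Multiplication by a square summable sequence, under convolution, maps the weighted space of
order `σ` to the weighted space of order `-τ` when `σ + τ > 1/2`, when the constant is finite. -/
lemma tsum_weight_conv_sq_le {σ τ : ℝ} (hσ : 0 ≤ σ) (hτ : 0 ≤ τ) (V a : ℤ → ℝ≥0∞) :
    ∑' k, weight (-τ) k * (∑' i, V (k - i) * a i) ^ 2 ≤
      2 * (∑' i, weight (-(τ + σ)) i) * (∑' i, V i ^ 2) * ∑' i, weight σ i * a i ^ 2 := by
  set X := ∑' i, weight σ i * a i ^ 2 with hX
  have w2 : ∀ τ n, weight (τ / 2) n ^ 2 = weight τ n := fun τ n => by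
    rw [sq, weight_mul, add_halves]
  have key : ∀ k, (∑' i, V (k - i) * a i) ^ 2 ≤ (∑' i, V (k - i) ^ 2 * weight (-σ) i) * X := by
    intro k
    have e : ∀ i, V (k - i) * a i = (V (k - i) * weight (-σ / 2) i) * (weight (σ / 2) i * a i) := by
      intro i
      calc V (k - i) * a i = V (k - i) * (weight (-σ / 2 + σ / 2) i * a i) := by
            rw [show -σ / 2 + σ / 2 = 0 by ring, weight_zero, one_mul]
        _ = _ := by rw [← weight_mul]; ring
    simp_rw [e]
    refine (sq_tsum_mul_le _ _).trans ?_
    simp_rw [mul_pow, w2]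
    rfl
  calc _ ≤ ∑' k, weight (-τ) k * ((∑' i, V (k - i) ^ 2 * weight (-σ) i) * X) := by gcongr; exact key _
    _ = (∑' k, ∑' i, weight (-τ) k * (V (k - i) ^ 2 * weight (-σ) i)) * X := by
      rw [← ENNReal.tsum_mul_right]
      congr 1; ext k
      rw [← mul_assoc, ENNReal.tsum_mul_left]
    _ ≤ (2 * (∑' i, weight (-(τ + σ)) i) * (∑' i, V i ^ 2)) * X := by
      gcongr
      calc ∑' k, ∑' i, weight (-τ) k * (V (k - i) ^ 2 * weight (-σ) i)
          = ∑' k, ∑' i, weight (-τ) k * (V i ^ 2 * weight (-σ) (k - i)) := by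
            congr 1; ext k
            rw [← (Equiv.subLeft k).tsum_eq]
            simp
        _ = ∑' i, V i ^ 2 * ∑' k, weight (-τ) k * weight (-σ) (k - i) := by
            rw [ENNReal.tsum_comm]
            congr 1; ext i
            rw [← ENNReal.tsum_mul_left]
            congr 1; ext k; ring
        _ ≤ ∑' i, V i ^ 2 * (2 * ∑' i, weight (-(τ + σ)) i) := by
            gcongr with i
            rw [← (Equiv.addRight i).tsum_eq]
            have := tsum_weight_mul_weight_le hτ hσ (i)
            rw [← (Equiv.neg ℤ).tsum_eq] at this
            refine le_trans (le_of_eq ?_) this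
            congr 1; ext k
            simp [weight, add_comm]
        _ = _ := by rw [ENNReal.tsum_mul_right]; ring

/-- The square of the norm in the Sobolev space of order `σ`, with values in `[0, ∞]`. -/
def sobolevSq (σ : ℝ) (u : Torus → ℝ) : ℝ≥0∞ := ∑' n, weight σ n * ‖coeff u n‖ₑ ^ 2

lemma weight_mul_enorm_sq (σ : ℝ) (n : ℤ) (z : ℂ) :
    weight σ n * ‖z‖ₑ ^ 2 = ENNReal.ofReal ((1 + (n : ℝ) ^ 2) ^ σ * ‖z‖ ^ 2) := by
  rw [ENNReal.ofReal_mul (by positivity), ENNReal.ofReal_pow (norm_nonneg _), ofReal_norm]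
  rfl

lemma memSobolev_iff_sobolevSq {σ : ℝ} {u : Torus → ℝ} (hu : MemLp u 2 volume) :
    MemSobolev σ u ↔ sobolevSq σ u ≠ ⊤ := by
  unfold sobolevSq
  simp_rw [weight_mul_enorm_sq]
  refine ⟨fun h => h.2.tsum_ofReal_ne_top, fun h => ⟨hu, ?_⟩⟩
  have := ENNReal.summable_toReal h
  refine this.congr fun n => ?_
  rw [ENNReal.toReal_ofReal (by positivity)]

lemma lintegral_enorm_sq {u : Torus → ℝ} (hu : MemLp u 2 volume) :
    ∫⁻ x, ‖u x‖ₑ ^ 2 = ENNReal.ofReal (2 * Real.pi) * ∑' n, ‖coeff u n‖ₑ ^ 2 := by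
  have h := hasSum_norm_coeff_sq hu
  have e1 : ∀ n, ‖coeff u n‖ₑ ^ 2 = ENNReal.ofReal (‖coeff u n‖ ^ 2) := fun n => by
    rw [ENNReal.ofReal_pow (norm_nonneg _), ofReal_norm]
  simp_rw [e1]
  rw [← ENNReal.ofReal_tsum_of_nonneg (fun n => by positivity) h.summable, h.tsum_eq,
    ← ENNReal.ofReal_mul Real.two_pi_pos.le, mul_inv_cancel_left₀ Real.two_pi_pos.ne',
    ofReal_integral_eq_lintegral_ofReal hu.integrable_sq (Eventually.of_forall fun x => sq_nonneg _)]
  congr 1; ext x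
  rw [← sq_abs, ENNReal.ofReal_pow (abs_nonneg _), ← Real.norm_eq_abs, ofReal_norm]

lemma enorm_coeff_mul_le {u v : Torus → ℝ} (hu : MemLp u 2 volume) (hv : MemLp v 2 volume)
    (k : ℤ) : ‖coeff (fun x => u x * v x) k‖ₑ ≤ ∑' n, ‖coeff u (k - n)‖ₑ * ‖coeff v n‖ₑ := by
  rw [← (hasSum_coeff_mul_conv hu hv k).tsum_eq]
  refine (enorm_tsum_le_tsum_enorm ..).trans_eq ?_
  simp_rw [enorm_mul]

/-! ### The embedding into `L⁴` -/

/-- The Sobolev inequality for functions already known to be in `L⁴`. -/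
lemma lintegral_enorm_pow_four_le_of_memLp {σ : ℝ} (hσ : 0 ≤ σ) {u : Torus → ℝ}
    (hu : MemLp u 2 volume) (hu2 : MemLp (fun x => u x * u x) 2 volume) :
    ∫⁻ x, ‖u x‖ₑ ^ 4 ≤ ENNReal.ofReal (2 * Real.pi) *
      (2 * (∑' i, weight (-(2 * σ)) i) * sobolevSq σ u ^ 2) := by
  have e : ∀ x, ‖u x‖ₑ ^ 4 = ‖u x * u x‖ₑ ^ 2 := fun x => by rw [enorm_mul]; ring
  simp_rw [e]
  rw [lintegral_enorm_sq hu2]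
  gcongr
  refine le_trans ?_ (tsum_conv_self_sq_le hσ fun i => ‖coeff u i‖ₑ)
  gcongr
  exact enorm_coeff_mul_le hu hu _

/-- The partial sums of the Fourier series, as real functions. -/
lemma exists_truncation (u : Torus → ℝ) (N : ℕ) :
    ∃ p : Torus → ℝ, MemLp p 2 volume ∧ MemLp (fun x => p x * p x) 2 volume ∧
      ∀ n, coeff p n = if |n| ≤ N then coeff u n else 0 := by
  set b : ℤ → ℂ := fun n => if |n| ≤ N then coeff u n else 0 with hb
  have hsupp : ∀ n ∉ Finset.Icc (-(N : ℤ)) N, b n = 0 := by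
    intro n hn
    rw [Finset.mem_Icc, ← abs_le] at hn
    simp [hb, hn]
  have hconj : ∀ n, b (-n) = conj (b n) := by
    intro n
    simp only [hb, abs_neg, coeff_neg_index]
    split_ifs <;> simp
  obtain ⟨h1, h2⟩ := coeff_re_tsum (a := b) (summable_of_ne_finset_zero
    (s := Finset.Icc (-(N : ℤ)) N) fun n hn => by rw [hsupp n hn]; simp) hconj
  set g : C(Torus, ℂ) := ∑ n ∈ Finset.Icc (-(N : ℤ)) N, b n • fourier n with hg
  have hsum : (∑' n : ℤ, b n • fourierLp 2 n : Lp ℂ 2 (haarAddCircle : Measure Torus))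
      = ContinuousMap.toLp 2 haarAddCircle ℂ g := by
    rw [tsum_eq_sum (s := Finset.Icc (-(N : ℤ)) N) fun n hn => by rw [hsupp n hn, zero_smul], hg,
      map_sum]
    simp_rw [map_smul]
  have hae : (fun x => ((∑' n : ℤ, b n • fourierLp 2 n :
      Lp ℂ 2 (haarAddCircle : Measure Torus)) x).re) =ᵐ[volume] fun x => (g x).re := by
    rw [EventuallyEq, ← ae_haar_iff, hsum]
    filter_upwards [ContinuousMap.coeFn_toLp (p := 2) (𝕜 := ℂ) haarAddCircle g] with x hx
    rw [hx]
  have hcont : Continuous fun x => (g x).re := Complex.continuous_re.comp g.continuous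
  exact ⟨fun x => (g x).re, memLp_of_continuous hcont 2, memLp_of_continuous (hcont.mul hcont) 2,
    fun n => by rw [← coeff_congr hae, h2]⟩

/-- The Sobolev inequality `‖u‖₄ ≤ A ‖u‖_{H^σ}`, finite for `σ > 1/4`. -/
theorem lintegral_enorm_pow_four_le {σ : ℝ} (hσ : 0 ≤ σ) {u : Torus → ℝ} (hu : MemLp u 2 volume) :
    ∫⁻ x, ‖u x‖ₑ ^ 4 ≤ ENNReal.ofReal (2 * Real.pi) *
      (2 * (∑' i, weight (-(2 * σ)) i) * sobolevSq σ u ^ 2) := by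
  -- truncate the series and pass to the limit with Fatou's lemma
  choose p hp1 hp2 hp3 using exists_truncation u
  have hle : ∀ N, sobolevSq σ (p N) ≤ sobolevSq σ u := by
    intro N
    unfold sobolevSq
    gcongr with n
    rw [hp3]
    split_ifs <;> simp
  have hlim : Tendsto (fun N => eLpNorm (p N - u) 2 volume) atTop (𝓝 0) := by
    have hsq : ∀ N, eLpNorm (p N - u) 2 volume ^ 2
        = ENNReal.ofReal (2 * Real.pi * ∑' n, if |n| ≤ (N : ℤ) then 0 else ‖coeff u n‖ ^ 2) := by
      intro N
      have hm : MemLp (fun x => p N x - u x) 2 volume := (hp1 N).sub hu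
      have h1 := lintegral_enorm_sq hm
      have h2 : eLpNorm (p N - u) 2 volume ^ 2 = ∫⁻ x, ‖p N x - u x‖ₑ ^ 2 := by
        rw [eLpNorm_eq_lintegral_rpow_enorm_toReal (by norm_num) (by norm_num),
          ← ENNReal.rpow_natCast, ← ENNReal.rpow_mul]
        norm_num
      rw [h2, h1, ENNReal.ofReal_mul Real.two_pi_pos.le, ENNReal.ofReal_tsum_of_nonneg]
      · congr 2; ext n
        rw [coeff_sub ((hp1 N).integrable (by norm_num)) (hu.integrable (by norm_num)), hp3]
        split_ifs
        · simp
        · rw [zero_sub, enorm_neg, ENNReal.ofReal_pow (norm_nonneg _), ofReal_norm]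
      · intro n; split_ifs <;> positivity
      · refine (hasSum_norm_coeff_sq hu).summable.of_nonneg_of_le (fun n => ?_) fun n => ?_
        · split_ifs <;> positivity
        · split_ifs
          · positivity
          · exact le_rfl
    have h0 : Tendsto (fun N : ℕ => ∑' n : ℤ, if |n| ≤ (N : ℤ) then 0 else ‖coeff u n‖ ^ 2) atTop
        (𝓝 (∑' _ : ℤ, (0 : ℝ))) := by
      refine tendsto_tsum_of_dominated_convergence (hasSum_norm_coeff_sq hu).summable
        (fun n => ?_) (Eventually.of_forall fun N n => ?_)
      · refine tendsto_const_nhds.congr' ?_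
        filter_upwards [eventually_ge_atTop n.natAbs] with N hN
        rw [if_pos (by rw [Int.abs_eq_natAbs]; omega)]
      · split_ifs <;> simp
    have h1 : Tendsto (fun N => eLpNorm (p N - u) 2 volume ^ 2) atTop (𝓝 0) := by
      simp_rw [hsq]
      rw [tsum_zero] at h0
      simpa using ENNReal.tendsto_ofReal (h0.const_mul (2 * Real.pi))
    have h2 := h1.ennrpow_const (1 / 2)
    refine (h2.congr fun N => ?_).trans (by simp)
    rw [← ENNReal.rpow_natCast, ← ENNReal.rpow_mul]
    norm_num
  obtain ⟨ns, -, hns⟩ := (tendstoInMeasure_of_tendsto_eLpNorm (by norm_num)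
    (fun N => (hp1 N).1) hu.1 hlim).exists_seq_tendsto_ae
  calc ∫⁻ x, ‖u x‖ₑ ^ 4 = ∫⁻ x, liminf (fun i => ‖p (ns i) x‖ₑ ^ 4) atTop := by
        refine lintegral_congr_ae ?_
        filter_upwards [hns] with x hx
        exact (((ENNReal.continuous_pow 4).comp continuous_enorm).tendsto _ |>.comp hx).liminf_eq.symm
    _ ≤ liminf (fun i => ∫⁻ x, ‖p (ns i) x‖ₑ ^ 4) atTop :=
        lintegral_liminf_le' fun i => (hp1 (ns i)).1.enorm.pow_const 4
    _ ≤ _ := by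
        refine (liminf_le_liminf (Eventually.of_forall fun i =>
          lintegral_enorm_pow_four_le_of_memLp hσ (hp1 (ns i)) (hp2 (ns i)))).trans ?_
        refine liminf_le_of_le (by isBoundedDefault) fun b hb => ?_
        obtain ⟨i, hi⟩ := hb.exists
        refine hi.trans ?_
        gcongr
        exact hle _

lemma MemSobolev.memLp_four {σ : ℝ} (hσ : 1 / 4 < σ) {u : Torus → ℝ} (hu : MemSobolev σ u) :
    MemLp u 4 volume := by
  refine ⟨hu.1.1, ?_⟩
  rw [eLpNorm_lt_top_iff_lintegral_rpow_enorm_lt_top (by norm_num) (by norm_num)]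
  have h := lintegral_enorm_pow_four_le (σ := σ) (by linarith) hu.1
  have h2 := (memSobolev_iff_sobolevSq hu.1).1 hu
  have h3 := tsum_weight_ne_top (τ := 2 * σ) (by linarith)
  have e : ∀ x, ‖u x‖ₑ ^ (ENNReal.toReal 4) = ‖u x‖ₑ ^ 4 := fun x => by
    rw [← ENNReal.rpow_natCast]; norm_num
  simp_rw [e]
  refine h.trans_lt ?_
  exact ENNReal.mul_lt_top ENNReal.ofReal_lt_top (ENNReal.mul_lt_top
    (ENNReal.mul_lt_top (by norm_num) h3.lt_top) (ENNReal.pow_lt_top h2.lt_top))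

lemma MemSobolev.mono {s t : ℝ} (hst : s ≤ t) {u : Torus → ℝ} (hu : MemSobolev t u) :
    MemSobolev s u := by
  rw [memSobolev_iff_sobolevSq hu.1]
  refine ne_top_of_le_ne_top ((memSobolev_iff_sobolevSq hu.1).1 hu) ?_
  unfold sobolevSq
  gcongr with n
  exact weight_anti hst n

/-! ### Coercivity and scaling about the mean -/

lemma integral_const_torus (t : ℝ) : ∫ _ : Torus, t = 2 * Real.pi * t := by
  rw [integral_const, Measure.real, AddCircle.measure_univ,
    ENNReal.toReal_ofReal Real.two_pi_pos.le, smul_eq_mul]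

lemma one_le_rpow_abs {α : ℝ} (hα : 0 ≤ α) {n : ℤ} (hn : n ≠ 0) : 1 ≤ |(n : ℝ)| ^ α := by
  apply Real.one_le_rpow _ hα
  exact_mod_cast Int.one_le_abs hn

lemma quadForm_nonneg (α : ℝ) (u : Torus → ℝ) : 0 ≤ quadForm α u :=
  tsum_nonneg fun n => by positivity

/-- Poincaré's inequality for functions of mean zero. -/
lemma integral_sq_le_quadForm {α : ℝ} (hα : 0 ≤ α) {η : Torus → ℝ} (hη : MemSobolev (α / 2) η)
    (h0 : ∫ x, η x = 0) : ∫ x, (η x) ^ 2 ≤ 2 * Real.pi * quadForm α η := by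
  have h := hasSum_norm_coeff_sq hη.1
  have h2 : (2 * Real.pi)⁻¹ * ∫ x, (η x) ^ 2 ≤ quadForm α η := by
    refine hasSum_le (fun n => ?_) h (hη.summable_quad hα).hasSum
    by_cases hn : n = 0
    · rw [hn, coeff_zero, h0]; simp
    · exact le_mul_of_one_le_left (by positivity) (one_le_rpow_abs hα hn)
  rwa [inv_mul_le_iff₀ Real.two_pi_pos] at h2

/-- The energy on functions of mean zero is coercive because `c > -1`. -/
lemma energy_coercive {α c : ℝ} (hα : 0 ≤ α) {η : Torus → ℝ}
    (hη : MemSobolev (α / 2) η) (h0 : ∫ x, η x = 0) :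
    min 1 (1 + c) * (Real.pi * quadForm α η) ≤
      Real.pi * quadForm α η + c / 2 * ∫ x, (η x) ^ 2 := by
  have h1 := integral_sq_le_quadForm hα hη h0
  have h2 := mul_nonneg Real.pi_pos.le (quadForm_nonneg α η)
  have h3 : 0 ≤ ∫ x, (η x) ^ 2 := integral_nonneg fun x => sq_nonneg _
  rcases le_total 0 c with h | h
  · rw [min_eq_left (by linarith)]
    nlinarith
  · rw [min_eq_right (by linarith)]
    nlinarith

lemma integral_sub_mean {m : ℝ} {u : Torus → ℝ} (hu : Integrable u volume)
    (hm : 1 / (2 * Real.pi) * ∫ x, u x = m) : ∫ x, (u x - m) = 0 := by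
  have := Real.pi_pos
  rw [integral_sub hu (integrable_const m), integral_const_torus, ← hm]
  field_simp
  ring

lemma MemSobolev.sub_const {α : ℝ} (hα : 0 < α) {u : Torus → ℝ} (hu : MemSobolev (α / 2) u)
    (m : ℝ) : MemSobolev (α / 2) (fun x => u x - m) := by
  have := hu.add_mul hα.le (memSobolev_const hα m) (-1)
  simpa [sub_eq_add_neg] using this

lemma MemSobolev.const_add_mul {α : ℝ} (hα : 0 < α) {η : Torus → ℝ} (hη : MemSobolev (α / 2) η)
    (m t : ℝ) : MemSobolev (α / 2) (fun x => m + t * η x) :=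
  (memSobolev_const hα m).add_mul hα.le hη t

lemma integral_const_add_mul {η : Torus → ℝ} (hη : Integrable η volume) (h0 : ∫ x, η x = 0)
    (m t : ℝ) : 1 / (2 * Real.pi) * ∫ x, (m + t * η x) = m := by
  have := Real.pi_pos
  rw [integral_add (integrable_const _) (hη.const_mul t), integral_const_mul, h0,
    integral_const_torus]
  field_simp
  ring

lemma integral_const_add_mul_sq {η : Torus → ℝ} (hη : MemLp η 2 volume) (h0 : ∫ x, η x = 0)
    (m t : ℝ) : ∫ x, (m + t * η x) ^ 2 = 2 * Real.pi * m ^ 2 + t ^ 2 * ∫ x, (η x) ^ 2 := by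
  have hi : Integrable η volume := hη.integrable (by norm_num)
  have e : ∀ x, (m + t * η x) ^ 2 = m ^ 2 + (2 * m * t * η x + t ^ 2 * (η x) ^ 2) :=
    fun x => by ring
  have h2 : Integrable (fun x => 2 * m * t * η x + t ^ 2 * (η x) ^ 2) volume :=
    (hi.const_mul _).add (hη.integrable_sq.const_mul _)
  simp_rw [e]
  rw [integral_add (integrable_const _) h2,
    integral_add (hi.const_mul _) (hη.integrable_sq.const_mul _), integral_const_mul,
    integral_const_mul, h0, integral_const_torus]
  ring

lemma energyB_const_add_mul {α : ℝ} (hα : 0 < α) (c : ℝ) {η : Torus → ℝ}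
    (hη : MemSobolev (α / 2) η) (h0 : ∫ x, η x = 0) (m t : ℝ) :
    energyB α c (fun x => m + t * η x) = c * Real.pi * m ^ 2 +
      t ^ 2 * (Real.pi * quadForm α η + c / 2 * ∫ x, (η x) ^ 2) := by
  rw [energyB_eq hα.le c (hη.const_add_mul hα m t), integral_const_add_mul_sq hη.1 h0,
    quadForm_add_mul hα.le (memSobolev_const hα m) hη, bilinForm_comm, bilinForm_const_right hα,
    ← bilinForm_self α (fun _ => m), bilinForm_const_right hα]
  ring

lemma energyB_eq_sub_mean {α : ℝ} (hα : 0 < α) (c : ℝ) {m : ℝ} {u : Torus → ℝ}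
    (hu : MemSobolev (α / 2) u) (hm : 1 / (2 * Real.pi) * ∫ x, u x = m) :
    energyB α c u = c * Real.pi * m ^ 2 +
      (Real.pi * quadForm α (fun x => u x - m) + c / 2 * ∫ x, (u x - m) ^ 2) := by
  have := energyB_const_add_mul hα c (hu.sub_const hα m) (integral_sub_mean hu.integrable hm) m 1
  simpa using this

lemma integrable_pow_four {u : Torus → ℝ} (hu : MemLp u 4 volume) :
    Integrable (fun x => (u x) ^ 4) volume := by
  have := hu.integrable_norm_pow (p := 4) (by norm_num)
  refine this.congr (Eventually.of_forall fun x => ?_)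
  simp only [Real.norm_eq_abs]
  exact (even_two_mul 2).pow_abs _

lemma memLp_four_const_add_mul {η : Torus → ℝ} (hη : MemLp η 4 volume) (m t : ℝ) :
    MemLp (fun x => m + t * η x) 4 volume := (memLp_const m).add (hη.const_mul t)

/-- Shrinking towards the mean restores the normalisation `∫ u⁴ = 1` when `∫ u⁴ ≥ 1`. -/
lemma exists_shrink {α : ℝ} (hα : 1 / 2 < α) {m : ℝ} (hm4 : 2 * Real.pi * m ^ 4 ≤ 1)
    {η : Torus → ℝ} (hη : MemSobolev (α / 2) η) (h0 : ∫ x, η x = 0)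
    (h1 : 1 ≤ ∫ x, (m + η x) ^ 4) :
    ∃ t ∈ Set.Icc (0 : ℝ) 1, (fun x => m + t * η x) ∈ Admissible α m := by
  have hη4 : MemLp η 4 volume := hη.memLp_four (by linarith)
  have hcont : ContinuousOn (fun t : ℝ => ∫ x, (m + t * η x) ^ 4) (Set.Icc 0 1) := by
    refine continuousOn_of_dominated (bound := fun x => (|m| + ‖η x‖) ^ 4)
      (fun t _ => (integrable_pow_four (memLp_four_const_add_mul hη4 m t)).1)
      (fun t ht => Eventually.of_forall fun x => ?_)
      (integrable_pow_four ((memLp_const |m|).add hη4.norm))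
      (Eventually.of_forall fun x => by fun_prop)
    rw [norm_pow]
    gcongr
    calc ‖m + t * η x‖ ≤ ‖m‖ + ‖t * η x‖ := norm_add_le _ _
      _ ≤ |m| + ‖η x‖ := by
        rw [norm_mul, Real.norm_eq_abs m]
        gcongr
        refine mul_le_of_le_one_left (norm_nonneg _) ?_
        rw [Real.norm_of_nonneg ht.1]; exact ht.2
  have hivt := intermediate_value_Icc (zero_le_one' ℝ) hcont
  have hmem : (1 : ℝ) ∈ Set.Icc (∫ x : Torus, (m + 0 * η x) ^ 4) (∫ x, (m + 1 * η x) ^ 4) := by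
    constructor
    · simp only [zero_mul, add_zero]
      rw [integral_const_torus]; exact hm4
    · simpa using h1
  obtain ⟨t, ht, h⟩ := hivt hmem
  exact ⟨t, ht, hη.const_add_mul (by linarith) m t, h, integral_const_add_mul hη.integrable h0 m t⟩

lemma two_pi_mul_pow_four_le {m : ℝ} (hm : |m| ≤ (2 * Real.pi) ^ (-(1 / 4) : ℝ)) :
    2 * Real.pi * m ^ 4 ≤ 1 := by
  have h1 : m ^ 4 ≤ (2 * Real.pi)⁻¹ := by
    calc m ^ 4 = |m| ^ 4 := ((even_two_mul 2).pow_abs m).symm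
      _ ≤ ((2 * Real.pi) ^ (-(1 / 4) : ℝ)) ^ 4 := by gcongr
      _ = (2 * Real.pi)⁻¹ := by
        rw [← Real.rpow_natCast, ← Real.rpow_mul Real.two_pi_pos.le, ← Real.rpow_neg_one]
        norm_num
  calc 2 * Real.pi * m ^ 4 ≤ 2 * Real.pi * (2 * Real.pi)⁻¹ := by gcongr
    _ = 1 := mul_inv_cancel₀ Real.two_pi_pos.ne'

lemma two_pi_mul_pow_four_lt {m : ℝ} (hm : |m| < (2 * Real.pi) ^ (-(1 / 4) : ℝ)) :
    2 * Real.pi * m ^ 4 < 1 := by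
  have h1 : m ^ 4 < (2 * Real.pi)⁻¹ := by
    calc m ^ 4 = |m| ^ 4 := ((even_two_mul 2).pow_abs m).symm
      _ < ((2 * Real.pi) ^ (-(1 / 4) : ℝ)) ^ 4 := by gcongr
      _ = (2 * Real.pi)⁻¹ := by
        rw [← Real.rpow_natCast, ← Real.rpow_mul Real.two_pi_pos.le, ← Real.rpow_neg_one]
        norm_num
  calc 2 * Real.pi * m ^ 4 < 2 * Real.pi * (2 * Real.pi)⁻¹ := by gcongr
    _ = 1 := mul_inv_cancel₀ Real.two_pi_pos.ne'

lemma exists_meanZero {α : ℝ} (hα : 0 ≤ α) :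
    ∃ η : Torus → ℝ, MemSobolev (α / 2) η ∧ ∫ x, η x = 0 ∧ 0 < ∫ x, (η x) ^ 2 := by
  set a : ℤ → ℂ := fun n => if |n| = 1 then 1 else 0 with ha
  have hsupp : ∀ n ∉ Finset.Icc (-1 : ℤ) 1, a n = 0 := by
    intro n hn
    rw [Finset.mem_Icc, ← abs_le] at hn
    simp only [ha]; rw [if_neg (by omega)]
  obtain ⟨h1, h2⟩ := coeff_re_tsum (a := a) (summable_of_ne_finset_zero
    (s := Finset.Icc (-1 : ℤ) 1) fun n hn => by rw [hsupp n hn]; simp) fun n => by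
      simp only [ha, abs_neg]; split_ifs <;> simp
  refine ⟨_, memSobolev_of_summable hα h1 (summable_of_ne_finset_zero
    (s := Finset.Icc (-1 : ℤ) 1) fun n hn => ?_), ?_, ?_⟩
  · rw [h2, hsupp n hn]; simp
  · have := h2 0
    rw [coeff_zero] at this
    have h3 : a 0 = 0 := by simp [ha]
    rw [h3, Complex.ofReal_eq_zero] at this
    have hpi := Real.pi_pos
    rcases mul_eq_zero.1 this with h | h
    · simp at h
    · exact h
  · have h3 := hasSum_norm_coeff_sq h1
    have h4 := le_hasSum h3 1 fun n _ => by positivity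
    rw [h2] at h4
    have h5 : a 1 = 1 := by simp [ha]
    rw [h5] at h4
    by_contra hcon
    push Not at hcon
    have := mul_nonpos_of_nonneg_of_nonpos (inv_nonneg.2 Real.two_pi_pos.le) hcon
    norm_num at h4
    norm_num at this
    linarith

lemma admissible_nonempty {α : ℝ} (hα : 1 / 2 < α) {m : ℝ} (hm4 : 2 * Real.pi * m ^ 4 ≤ 1) :
    (Admissible α m).Nonempty := by
  obtain ⟨η, h1, h2, h3⟩ := exists_meanZero (α := α) (by linarith)
  set A := ∫ x, (η x) ^ 2 with hA
  set t := Real.sqrt ((1 + 2 * Real.pi) / A) with ht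
  have ht2 : t ^ 2 * A = 1 + 2 * Real.pi := by
    rw [ht, Real.sq_sqrt (by have := Real.pi_pos; positivity), div_mul_cancel₀ _ h3.ne']
  have htη : MemSobolev (α / 2) (fun x => t * η x) := by
    simpa using h1.const_add_mul (by linarith) 0 t
  have ht0 : ∫ x, t * η x = 0 := by rw [integral_const_mul, h2, mul_zero]
  have h4 : MemLp (fun x => m + t * η x) 4 volume :=
    memLp_four_const_add_mul (h1.memLp_four (by linarith)) m t
  have h5 : MemLp (fun x => m + t * η x) 2 volume := (memLp_const m).add (h1.1.const_mul t)
  -- the pointwise inequality `y⁴ ≥ 2 y² - 1` bounds the fourth moment by the second one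
  have h6 : 1 ≤ ∫ x, (m + t * η x) ^ 4 := by
    calc (1 : ℝ) ≤ 2 * (2 * Real.pi * m ^ 2 + t ^ 2 * A) - 2 * Real.pi * 1 := by
          rw [ht2]; have := Real.pi_pos; nlinarith [mul_nonneg this.le (sq_nonneg m)]
      _ = ∫ x, (2 * (m + t * η x) ^ 2 - 1) := by
          rw [integral_sub (h5.integrable_sq.const_mul 2) (integrable_const _), integral_const_mul,
            integral_const_add_mul_sq h1.1 h2, integral_const_torus]
      _ ≤ ∫ x, (m + t * η x) ^ 4 := by
          refine integral_mono ((h5.integrable_sq.const_mul 2).sub (integrable_const _))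
            (integrable_pow_four h4) fun x => ?_
          show 2 * (m + t * η x) ^ 2 - 1 ≤ (m + t * η x) ^ 4
          nlinarith [sq_nonneg ((m + t * η x) ^ 2 - 1)]
  obtain ⟨s, -, hs⟩ := exists_shrink hα hm4 htη ht0 h6
  exact ⟨_, hs⟩

/-! ### Existence of ground states -/

lemma tendsto_weight_cofinite {τ : ℝ} (hτ : 0 < τ) :
    Tendsto (weight (-τ)) cofinite (𝓝 0) := by
  have h1 : Tendsto (fun n : ℤ => 1 + (n : ℝ) ^ 2) cofinite atTop := by
    have h0 : Tendsto (fun n : ℤ => |(n : ℝ)|) cofinite atTop := by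
      have := tendsto_norm_cocompact_atTop (E := ℝ)
      exact this.comp Int.tendsto_coe_cofinite
    refine tendsto_atTop_add_const_left _ _ ?_
    have := (tendsto_pow_atTop (α := ℝ) two_ne_zero).comp h0
    refine this.congr fun n => ?_
    simp
  have h2 := (tendsto_rpow_neg_atTop hτ).comp h1
  have h3 := ENNReal.tendsto_ofReal h2
  rw [ENNReal.ofReal_zero] at h3
  exact h3

/-- Compactness of the embedding of weighted spaces: a bounded sequence in the space of order `τ`
converging to zero in each coordinate converges to zero in the space of order `σ < τ`. -/
lemma tendsto_tsum_weight {σ τ : ℝ} (hστ : σ < τ) {x : ℕ → ℤ → ℝ≥0∞} {M : ℝ≥0∞} (hM : M ≠ ⊤)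
    (hx : ∀ n, Tendsto (fun k => x k n) atTop (𝓝 0)) (hb : ∀ k, ∑' n, weight τ n * x k n ≤ M) :
    Tendsto (fun k => ∑' n, weight σ n * x k n) atTop (𝓝 0) := by
  rw [ENNReal.tendsto_nhds_zero]
  intro ε hε
  have hε2 : ε / 2 ≠ 0 := by simpa using hε.ne'
  obtain ⟨δ, hδ, hδM⟩ := ENNReal.exists_nnreal_pos_mul_lt hM hε2
  have hev := (ENNReal.tendsto_nhds_zero.1 (tendsto_weight_cofinite (sub_pos.2 hστ))) δ
    (by exact_mod_cast hδ)
  rw [eventually_cofinite] at hev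
  set F := hev.toFinset with hF
  have hFsum : Tendsto (fun k => ∑ n ∈ F, weight σ n * x k n) atTop (𝓝 0) := by
    have : Tendsto (fun k => ∑ n ∈ F, weight σ n * x k n) atTop (𝓝 (∑ n ∈ F, weight σ n * 0)) :=
      tendsto_finsetSum _ fun n _ =>
        ENNReal.Tendsto.const_mul (hx n) (Or.inr (weight_ne_top σ n))
    simpa using this
  have hev2 := (ENNReal.tendsto_nhds_zero.1 hFsum) (ε / 2) (pos_iff_ne_zero.2 hε2)
  filter_upwards [hev2] with k hk
  have hsplit : ∀ n, weight σ n * x k n ≤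
      (if n ∈ F then weight σ n * x k n else 0) + δ * (weight τ n * x k n) := by
    intro n
    by_cases hn : n ∈ F
    · rw [if_pos hn]; exact le_self_add
    · rw [if_neg hn, zero_add, ← mul_assoc]
      gcongr
      have h1 : weight (-(τ - σ)) n ≤ δ := by
        by_contra hcon
        exact hn (by rw [hF, Set.Finite.mem_toFinset]; exact hcon)
      calc weight σ n = weight (-(τ - σ)) n * weight τ n := by rw [weight_mul]; congr 1; ring
        _ ≤ _ := by gcongr
  calc ∑' n, weight σ n * x k n
      ≤ ∑' n, ((if n ∈ F then weight σ n * x k n else 0) + δ * (weight τ n * x k n)) :=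
        ENNReal.tsum_le_tsum hsplit
    _ = (∑ n ∈ F, weight σ n * x k n) + δ * ∑' n, weight τ n * x k n := by
        rw [ENNReal.tsum_add, ENNReal.tsum_mul_left,
          tsum_eq_sum (s := F) fun n hn => by rw [if_neg hn]]
        congr 1
        exact Finset.sum_congr rfl fun n hn => by rw [if_pos hn]
    _ ≤ ε / 2 + ε / 2 := by
        gcongr
        calc (δ : ℝ≥0∞) * ∑' n, weight τ n * x k n ≤ δ * M := by gcongr; exact hb k
          _ ≤ _ := by rw [mul_comm] at *; exact hδM.le
    _ = ε := ENNReal.add_halves ε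

lemma eLpNorm_four_pow (u : Torus → ℝ) : eLpNorm u 4 volume ^ 4 = ∫⁻ x, ‖u x‖ₑ ^ 4 := by
  rw [eLpNorm_eq_lintegral_rpow_enorm_toReal (by norm_num) (by norm_num), ← ENNReal.rpow_natCast,
    ← ENNReal.rpow_mul]
  norm_num

lemma integral_pow_four_eq_one_iff {u : Torus → ℝ} (hu : MemLp u 4 volume) :
    ∫ x, (u x) ^ 4 = 1 ↔ eLpNorm u 4 volume = 1 := by
  have h1 : eLpNorm u 4 volume ^ 4 = ENNReal.ofReal (∫ x, (u x) ^ 4) := by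
    rw [eLpNorm_four_pow, ofReal_integral_eq_lintegral_ofReal (integrable_pow_four hu)
      (Eventually.of_forall fun x => (even_two_mul 2).pow_nonneg _)]
    congr 1; ext x
    rw [← (show Even 4 by decide).pow_abs, ENNReal.ofReal_pow (abs_nonneg _), ← Real.norm_eq_abs,
      ofReal_norm]
  have h2 : eLpNorm u 4 volume = 1 ↔ eLpNorm u 4 volume ^ 4 = 1 :=
    ((ENNReal.pow_right_strictMono (n := 4) (by norm_num)).injective.eq_iff' (one_pow 4)).symm
  rw [h2, h1, ENNReal.ofReal_eq_one]

lemma sobolevSq_le {α : ℝ} (hα : 0 ≤ α) {u : Torus → ℝ} (hu : MemSobolev (α / 2) u) :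
    sobolevSq (α / 2) u ≤
      ENNReal.ofReal (2 ^ (α / 2) * (‖coeff u 0‖ ^ 2 + 2 * quadForm α u)) := by
  have hs := hu.summable_quad hα
  unfold sobolevSq
  simp_rw [weight_mul_enorm_sq]
  rw [← ENNReal.ofReal_tsum_of_nonneg (fun n => by positivity) hu.2]
  apply ENNReal.ofReal_le_ofReal
  have h1 : HasSum (fun n : ℤ => 2 ^ (α / 2) * ((if n = 0 then ‖coeff u 0‖ ^ 2 else 0) +
      2 * (|(n : ℝ)| ^ α * ‖coeff u n‖ ^ 2)))
      (2 ^ (α / 2) * (‖coeff u 0‖ ^ 2 + 2 * quadForm α u)) :=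
    ((hasSum_ite_eq 0 _).add (hs.hasSum.mul_left 2)).mul_left _
  refine hasSum_le (fun n => ?_) hu.2.hasSum h1
  have h2 := weight_le n (s := α / 2) (by positivity)
  rw [mul_div_cancel₀ α two_ne_zero] at h2
  calc _ ≤ 2 ^ (α / 2) * (1 + |(n : ℝ)| ^ α) * ‖coeff u n‖ ^ 2 := by gcongr
    _ ≤ _ := by
      rw [mul_assoc]
      gcongr
      split_ifs with hn
      · subst hn
        have := Real.rpow_nonneg (abs_nonneg ((0 : ℤ) : ℝ)) α
        nlinarith [mul_nonneg this (sq_nonneg ‖coeff u 0‖)]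
      · have := one_le_rpow_abs hα hn
        nlinarith [mul_nonneg (sub_nonneg.2 this) (sq_nonneg ‖coeff u n‖)]

lemma hasSum_energyB {α : ℝ} (hα : 0 ≤ α) (c : ℝ) {u : Torus → ℝ} (hu : MemSobolev (α / 2) u) :
    HasSum (fun n : ℤ => Real.pi * ((|(n : ℝ)| ^ α + c) * ‖coeff u n‖ ^ 2)) (energyB α c u) := by
  have h := (((hu.summable_quad hα).hasSum).add ((hasSum_norm_coeff_sq hu.1).mul_left c)).mul_left
    Real.pi
  have e : energyB α c u = Real.pi * ((∑' n : ℤ, |(n : ℝ)| ^ α * ‖coeff u n‖ ^ 2) +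
      c * ((2 * Real.pi)⁻¹ * ∫ x, (u x) ^ 2)) := by
    rw [energyB_eq hα c hu, quadForm]
    have := Real.pi_pos
    field_simp
  rw [e]
  refine h.congr_fun fun n => ?_
  ring

lemma quadForm_sub_const {α : ℝ} (hα : 0 < α) {u : Torus → ℝ} (hu : MemSobolev (α / 2) u)
    (m : ℝ) : quadForm α (fun x => u x - m) = quadForm α u := by
  have := quadForm_add_mul hα.le hu (memSobolev_const hα m) (-1)
  rw [bilinForm_const_right hα, ← bilinForm_self α (fun _ => m), bilinForm_const_right hα] at this
  simpa [sub_eq_add_neg] using this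

/-- The variational problem has a minimiser. -/
theorem exists_isGroundState {α c m : ℝ} (hα : 1 / 2 < α) (hc : -1 < c)
    (hm4 : 2 * Real.pi * m ^ 4 ≤ 1) : ∃ χ, IsGroundState α c m χ := by
  have hα0 : 0 < α := by linarith
  have hκ : 0 < min 1 (1 + c) := lt_min one_pos (by linarith)
  have hlow : ∀ u ∈ Admissible α m, c * Real.pi * m ^ 2 +
      min 1 (1 + c) * (Real.pi * quadForm α u) ≤ energyB α c u := by
    intro u hu
    rw [energyB_eq_sub_mean hα0 c hu.1 hu.2.2, ← quadForm_sub_const hα0 hu.1 m]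
    gcongr
    exact energy_coercive hα0.le (hu.1.sub_const hα0 m) (integral_sub_mean hu.1.integrable hu.2.2)
  have hbdd : BddBelow (energyB α c '' Admissible α m) := by
    refine ⟨c * Real.pi * m ^ 2, ?_⟩
    rintro _ ⟨u, hu, rfl⟩
    have h1 := hlow u hu
    have h2 := mul_nonneg hκ.le (mul_nonneg Real.pi_pos.le (quadForm_nonneg α u))
    linarith
  obtain ⟨E, -, hE, hEmem⟩ := exists_seq_tendsto_sInf
    ((admissible_nonempty hα hm4).image (energyB α c)) hbdd
  choose u huA huE using hEmem
  set I := sInf (energyB α c '' Admissible α m) with hI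
  -- a uniform bound for the quadratic form along the minimising sequence
  obtain ⟨K, hK0, hK⟩ : ∃ K, 0 ≤ K ∧ ∀ k, quadForm α (u k) ≤ K := by
    obtain ⟨B, hB⟩ := hE.bddAbove_range
    refine ⟨|(B - c * Real.pi * m ^ 2) / (min 1 (1 + c) * Real.pi)|, abs_nonneg _, fun k => ?_⟩
    refine le_trans ?_ (le_abs_self _)
    rw [le_div_iff₀ (mul_pos hκ Real.pi_pos)]
    have h1 := hlow _ (huA k)
    have h2 : energyB α c (u k) ≤ B := by rw [huE]; exact hB ⟨k, rfl⟩
    nlinarith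
  have hc0 : ∀ k, coeff (u k) 0 = m := fun k => by rw [coeff_zero, (huA k).2.2]
  have hcoefbd : ∀ k n, ‖coeff (u k) n‖ ≤ |m| + (K + 1) := by
    intro k n
    by_cases hn : n = 0
    · rw [hn, hc0, Complex.norm_real, Real.norm_eq_abs]; linarith
    · have h1 := le_hasSum ((huA k).1.summable_quad hα0.le).hasSum n fun i _ => by positivity
      have h2 : ‖coeff (u k) n‖ ^ 2 ≤ K :=
        (le_mul_of_one_le_left (by positivity) (one_le_rpow_abs hα0.le hn)).trans (h1.trans (hK k))
      nlinarith [abs_nonneg m, norm_nonneg (coeff (u k) n), sq_nonneg (‖coeff (u k) n‖ - 1)]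
  -- pointwise convergence of the coefficients along a subsequence
  obtain ⟨a, -, φ, hφ, ha⟩ := (isCompact_univ_pi fun _ : ℤ =>
    isCompact_closedBall (0 : ℂ) (|m| + (K + 1))).tendsto_subseq
      (x := fun k n => coeff (u k) n) fun k n _ => by
        rw [mem_closedBall_zero_iff]; exact hcoefbd k n
  have ha' : ∀ n, Tendsto (fun k => coeff (u (φ k)) n) atTop (𝓝 (a n)) := fun n =>
    (tendsto_pi_nhds.1 ha) n
  have ha0 : a 0 = m := tendsto_nhds_unique (ha' 0) (by simp_rw [hc0]; exact tendsto_const_nhds)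
  have haconj : ∀ n, a (-n) = conj (a n) := fun n => by
    refine tendsto_nhds_unique (ha' (-n)) ?_
    simp_rw [coeff_neg_index]
    exact (Complex.continuous_conj.tendsto _).comp (ha' n)
  have haK : ∀ F : Finset ℤ, ∑ n ∈ F, |(n : ℝ)| ^ α * ‖a n‖ ^ 2 ≤ K := by
    intro F
    refine le_of_tendsto (tendsto_finsetSum F fun n _ => ((ha' n).norm.pow 2).const_mul _)
      (Eventually.of_forall fun k => ?_)
    exact (((huA (φ k)).1.summable_quad hα0.le).sum_le_tsum F fun n _ => by positivity).trans
      (hK (φ k))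
  have hasum : Summable fun n : ℤ => |(n : ℝ)| ^ α * ‖a n‖ ^ 2 :=
    summable_of_sum_le (fun n => by positivity) haK
  have hasq : Summable fun n => ‖a n‖ ^ 2 := by
    refine hasum.of_norm_bounded_eventually ?_
    filter_upwards [(Set.finite_singleton (0 : ℤ)).compl_mem_cofinite] with n hn
    rw [Real.norm_of_nonneg (by positivity)]
    exact le_mul_of_one_le_left (by positivity) (one_le_rpow_abs hα0.le (by simpa using hn))
  obtain ⟨hv2, hvco⟩ := coeff_re_tsum hasq haconj
  set v := fun x => ((∑' n : ℤ, a n • fourierLp 2 n :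
      Lp ℂ 2 (haarAddCircle : Measure Torus)) x).re with hv
  have hvS : MemSobolev (α / 2) v := memSobolev_of_summable hα0.le hv2 (by simp_rw [hvco]; exact hasum)
  have hvm : 1 / (2 * Real.pi) * ∫ x, v x = m := by
    have := coeff_zero v
    rw [hvco, ha0] at this
    exact_mod_cast this.symm
  -- strong convergence in `L⁴`
  obtain ⟨σ, hσ1, hσ2⟩ := exists_between (show (1 : ℝ) / 4 < α / 2 by linarith)
  have hdS : ∀ k, MemSobolev (α / 2) (fun x => v x + (-1) * u (φ k) x) := fun k =>
    hvS.add_mul hα0.le (huA (φ k)).1 (-1)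
  have hdco : ∀ k n, coeff (fun x => v x + (-1) * u (φ k) x) n = a n - coeff (u (φ k)) n := by
    intro k n
    rw [coeff_add_const_mul hvS.integrable (huA (φ k)).1.integrable, hvco]
    push_cast; ring
  have hQv : quadForm α v ≤ K := by
    unfold quadForm
    simp_rw [hvco]
    exact hasum.tsum_le_of_sum_le haK
  -- the parallelogram law
  have hdQ : ∀ k, quadForm α (fun x => v x + (-1) * u (φ k) x) ≤ 4 * K := by
    intro k
    have h1 := quadForm_add_mul hα0.le hvS (huA (φ k)).1 (-1)
    have h2 := quadForm_add_mul hα0.le hvS (huA (φ k)).1 1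
    have h3 := quadForm_nonneg α (fun x => v x + 1 * u (φ k) x)
    have h4 := hK (φ k)
    nlinarith
  have hsob : Tendsto (fun k => sobolevSq σ (fun x => v x + (-1) * u (φ k) x)) atTop (𝓝 0) := by
    refine tendsto_tsum_weight hσ2 (M := ENNReal.ofReal (2 ^ (α / 2) * (0 + 2 * (4 * K))))
      ENNReal.ofReal_ne_top (fun n => ?_) fun k => ?_
    · simp_rw [hdco]
      have h1 : Tendsto (fun k => a n - coeff (u (φ k)) n) atTop (𝓝 0) := by
        simpa using (ha' n).const_sub (a n)
      have h2 := (((ENNReal.continuous_pow 2).comp continuous_enorm).tendsto (0 : ℂ)).comp h1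
      rw [Function.comp_apply, enorm_zero, zero_pow two_ne_zero] at h2
      exact h2
    · refine (sobolevSq_le hα0.le (hdS k)).trans (ENNReal.ofReal_le_ofReal ?_)
      have h0 : coeff (fun x => v x + (-1) * u (φ k) x) 0 = 0 := by
        rw [hdco, ha0, hc0, sub_self]
      rw [h0]
      gcongr
      · simp
      · exact hdQ k
  have hL4 : Tendsto (fun k => eLpNorm (fun x => v x + (-1) * u (φ k) x) 4 volume) atTop (𝓝 0) := by
    have h1 : Tendsto (fun k => eLpNorm (fun x => v x + (-1) * u (φ k) x) 4 volume ^ 4) atTop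
        (𝓝 0) := by
      have h3 := tsum_weight_ne_top (τ := 2 * σ) (by linarith)
      have h2 : Tendsto (fun k => ENNReal.ofReal (2 * Real.pi) *
          (2 * (∑' i, weight (-(2 * σ)) i) *
            sobolevSq σ (fun x => v x + (-1) * u (φ k) x) ^ 2)) atTop (𝓝 0) := by
        have h4 := ((ENNReal.continuous_pow 2).tendsto 0).comp hsob
        have h5 := ENNReal.Tendsto.const_mul (a := ENNReal.ofReal (2 * Real.pi))
          (ENNReal.Tendsto.const_mul (a := 2 * (∑' i, weight (-(2 * σ)) i)) h4
            (Or.inr (ENNReal.mul_ne_top (by norm_num) h3))) (Or.inr ENNReal.ofReal_ne_top)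
        simpa using h5
      refine tendsto_of_tendsto_of_tendsto_of_le_of_le tendsto_const_nhds h2 (fun _ => zero_le)
        fun k => ?_
      rw [eLpNorm_four_pow]
      exact lintegral_enorm_pow_four_le (by linarith) (hdS k).1
    have h2 := h1.ennrpow_const (1 / 4)
    refine (h2.congr fun N => ?_).trans (by simp)
    rw [← ENNReal.rpow_natCast, ← ENNReal.rpow_mul]
    norm_num
  have hu4 : ∀ k, MemLp (u k) 4 volume := fun k => (huA k).1.memLp_four (by linarith)
  have hv4 : MemLp v 4 volume := hvS.memLp_four (by linarith)
  have hnorm : eLpNorm v 4 volume = 1 := by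
    have hone : ∀ k, eLpNorm (u k) 4 volume = 1 := fun k =>
      (integral_pow_four_eq_one_iff (hu4 k)).1 (huA k).2.1
    apply le_antisymm
    · have h1 : Tendsto (fun k => eLpNorm (fun x => v x + (-1) * u (φ k) x) 4 volume + 1) atTop
          (𝓝 (0 + 1)) := hL4.add_const 1
      rw [zero_add] at h1
      refine ge_of_tendsto h1 (Eventually.of_forall fun k => ?_)
      have h2 := eLpNorm_add_le (μ := volume) (p := 4) (hv4.1.add ((hu4 (φ k)).1.const_mul (-1)))
        (hu4 (φ k)).1 (by norm_num)
      rw [hone] at h2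
      refine le_trans (le_of_eq ?_) h2
      congr 1; ext x; simp
    · have h1 : Tendsto (fun k => eLpNorm (fun x => v x + (-1) * u (φ k) x) 4 volume +
          eLpNorm v 4 volume) atTop (𝓝 (0 + eLpNorm v 4 volume)) := hL4.add_const _
      rw [zero_add] at h1
      refine ge_of_tendsto h1 (Eventually.of_forall fun k => ?_)
      have h2 := eLpNorm_sub_le (μ := volume) (p := 4) hv4.1
        (hv4.1.add ((hu4 (φ k)).1.const_mul (-1))) (by norm_num)
      rw [add_comm]
      refine le_trans (le_of_eq ?_) h2
      rw [← hone (φ k)]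
      congr 1; ext x; simp
  have hvA : v ∈ Admissible α m := ⟨hvS, (integral_pow_four_eq_one_iff hv4).2 hnorm, hvm⟩
  -- lower semicontinuity: all terms of the series for the energy but the zeroth are nonnegative
  have hlsc : energyB α c v ≤ I := by
    have h1 : Tendsto (fun F : Finset ℤ => ∑ n ∈ F, Real.pi * ((|(n : ℝ)| ^ α + c) *
        ‖coeff v n‖ ^ 2)) atTop (𝓝 (energyB α c v)) := hasSum_energyB hα0.le c hvS
    refine le_of_tendsto h1 ?_
    filter_upwards [eventually_ge_atTop {0}] with F hF
    have h2 : Tendsto (fun k => ∑ n ∈ F, Real.pi * ((|(n : ℝ)| ^ α + c) *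
        ‖coeff (u (φ k)) n‖ ^ 2)) atTop (𝓝 (∑ n ∈ F, Real.pi * ((|(n : ℝ)| ^ α + c) *
        ‖coeff v n‖ ^ 2))) := by
      simp_rw [hvco]
      exact tendsto_finsetSum F fun n _ => (((ha' n).norm.pow 2).const_mul _).const_mul _
    refine le_of_tendsto_of_tendsto h2 (hE.comp hφ.tendsto_atTop) (Eventually.of_forall fun k => ?_)
    show _ ≤ E (φ k)
    rw [← huE]
    refine sum_le_hasSum F (fun n hn => ?_) (hasSum_energyB hα0.le c (huA (φ k)).1)
    have hn0 : n ≠ 0 := by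
      rintro rfl
      exact hn (hF (Finset.mem_singleton_self 0))
    have h3 := one_le_rpow_abs hα0.le hn0
    have h4 : 0 ≤ |(n : ℝ)| ^ α + c := by linarith
    have := Real.pi_pos
    positivity
  exact ⟨v, hvA, fun w hw => hlsc.trans (csInf_le hbdd ⟨w, hw, rfl⟩)⟩

/-! ### The Euler–Lagrange equation -/

/-- A ground state also minimises the energy under the relaxed constraint `∫ u⁴ ≥ 1`. -/
lemma IsGroundState.energy_le_of_one_le {α c m : ℝ} (hα : 1 / 2 < α) (hc : -1 < c)
    (hm4 : 2 * Real.pi * m ^ 4 ≤ 1) {χ : Torus → ℝ} (hχ : IsGroundState α c m χ)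
    {u : Torus → ℝ} (hu : MemSobolev (α / 2) u) (hum : 1 / (2 * Real.pi) * ∫ x, u x = m)
    (hu1 : 1 ≤ ∫ x, (u x) ^ 4) : energyB α c χ ≤ energyB α c u := by
  have hα0 : 0 < α := by linarith
  have hη := hu.sub_const hα0 m
  have h0 := integral_sub_mean hu.integrable hum
  obtain ⟨t, ht, hA⟩ := exists_shrink hα hm4 hη h0 (by simpa using hu1)
  refine (hχ.2 hA).trans ?_
  show energyB α c (fun x => m + t * (u x - m)) ≤ energyB α c u
  rw [energyB_const_add_mul hα0 c hη h0, energyB_eq_sub_mean hα0 c hu hum]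
  have h1 := energy_coercive (c := c) hα0.le hη h0
  have h2 : 0 ≤ min 1 (1 + c) * (Real.pi * quadForm α fun x => u x - m) :=
    mul_nonneg (le_min zero_le_one (by linarith))
      (mul_nonneg Real.pi_pos.le (quadForm_nonneg α _))
  have h3 : t ^ 2 ≤ 1 := by nlinarith [ht.1, ht.2]
  nlinarith

lemma integrable_cube_mul {u v : Torus → ℝ} (hu : MemLp u 4 volume) (hv : MemLp v 4 volume) :
    Integrable (fun x => (u x) ^ 3 * v x) volume := by
  refine ((integrable_pow_four hu).add (integrable_pow_four hv)).mono'
    ((hu.1.pow 3).mul hv.1) (Eventually.of_forall fun x => ?_)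
  rw [Real.norm_eq_abs, abs_le]
  show -(u x ^ 4 + v x ^ 4) ≤ _ ∧ _ ≤ u x ^ 4 + v x ^ 4
  constructor
  · nlinarith [sq_nonneg (u x ^ 2 + u x * v x), sq_nonneg (u x ^ 2 - v x ^ 2),
      sq_nonneg (u x * v x), sq_nonneg (v x ^ 2), sq_nonneg (u x ^ 2)]
  · nlinarith [sq_nonneg (u x ^ 2 - u x * v x), sq_nonneg (u x ^ 2 - v x ^ 2),
      sq_nonneg (u x * v x), sq_nonneg (v x ^ 2), sq_nonneg (u x ^ 2)]

lemma integrable_mul_of_memLp_two {u v : Torus → ℝ} (hu : MemLp u 2 volume)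
    (hv : MemLp v 2 volume) : Integrable (fun x => u x * v x) volume :=
  hu.integrable_mul hv

lemma integral_add_mul_sq {u v : Torus → ℝ} (hu : MemLp u 2 volume) (hv : MemLp v 2 volume)
    (t : ℝ) : ∫ x, (u x + t * v x) ^ 2 =
      (∫ x, (u x) ^ 2) + 2 * t * (∫ x, u x * v x) + t ^ 2 * ∫ x, (v x) ^ 2 := by
  have e : ∀ x, (u x + t * v x) ^ 2 = (u x) ^ 2 + (2 * t * (u x * v x) + t ^ 2 * (v x) ^ 2) :=
    fun x => by ring
  have h1 : Integrable (fun x => 2 * t * (u x * v x)) volume :=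
    (integrable_mul_of_memLp_two hu hv).const_mul _
  have h2 : Integrable (fun x => t ^ 2 * (v x) ^ 2) volume := hv.integrable_sq.const_mul _
  have h3 : Integrable (fun x => 2 * t * (u x * v x) + t ^ 2 * (v x) ^ 2) volume := h1.add h2
  simp_rw [e]
  rw [integral_add hu.integrable_sq h3, integral_add h1 h2, integral_const_mul, integral_const_mul]
  ring

/-- The first variation of the energy at `u` in the direction `v`. -/
def energyDeriv (α c : ℝ) (u v : Torus → ℝ) : ℝ :=
  2 * Real.pi * bilinForm α u v + c * ∫ x, u x * v x

lemma energyB_add_mul {α : ℝ} (hα : 0 ≤ α) (c : ℝ) {u v : Torus → ℝ}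
    (hu : MemSobolev (α / 2) u) (hv : MemSobolev (α / 2) v) (t : ℝ) :
    energyB α c (fun x => u x + t * v x) =
      energyB α c u + t * energyDeriv α c u v + t ^ 2 * energyB α c v := by
  rw [energyB_eq hα c (hu.add_mul hα hv t), energyB_eq hα c hu, energyB_eq hα c hv,
    quadForm_add_mul hα hu hv, integral_add_mul_sq hu.1 hv.1, energyDeriv]
  ring

lemma energyDeriv_add_mul {α : ℝ} (hα : 0 ≤ α) (c : ℝ) {u v w : Torus → ℝ}
    (hu : MemSobolev (α / 2) u) (hv : MemSobolev (α / 2) v) (hw : MemSobolev (α / 2) w) (t : ℝ) :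
    energyDeriv α c u (fun x => v x + t * w x) =
      energyDeriv α c u v + t * energyDeriv α c u w := by
  have e : ∀ x, u x * (v x + t * w x) = u x * v x + t * (u x * w x) := fun x => by ring
  unfold energyDeriv
  simp_rw [e]
  rw [bilinForm_add_right hα hu hv hw, integral_add (integrable_mul_of_memLp_two hu.1 hv.1)
    ((integrable_mul_of_memLp_two hu.1 hw.1).const_mul t), integral_const_mul]
  ring

lemma integral_cube_mul_add_mul {u v w : Torus → ℝ} (hu : MemLp u 4 volume)
    (hv : MemLp v 4 volume) (hw : MemLp w 4 volume) (t : ℝ) :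
    ∫ x, (u x) ^ 3 * (v x + t * w x) =
      (∫ x, (u x) ^ 3 * v x) + t * ∫ x, (u x) ^ 3 * w x := by
  have e : ∀ x, (u x) ^ 3 * (v x + t * w x) = (u x) ^ 3 * v x + t * ((u x) ^ 3 * w x) :=
    fun x => by ring
  simp_rw [e]
  rw [integral_add (integrable_cube_mul hu hv) ((integrable_cube_mul hu hw).const_mul t),
    integral_const_mul]

lemma pow_four_add_ge (a b : ℝ) : a ^ 4 + 4 * (a ^ 3 * b) ≤ (a + b) ^ 4 := by
  nlinarith [sq_nonneg (b * (b + 2 * a)), sq_nonneg (a * b)]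

/-- The one-sided first order condition, which follows from the convexity of `y ↦ y⁴`. -/
lemma IsGroundState.energyDeriv_nonneg {α c m : ℝ} (hα : 1 / 2 < α) (hc : -1 < c)
    (hm4 : 2 * Real.pi * m ^ 4 ≤ 1) {χ : Torus → ℝ} (hχ : IsGroundState α c m χ)
    {φ : Torus → ℝ} (hφ : MemSobolev (α / 2) φ) (h0 : ∫ x, φ x = 0)
    (hℓ : 0 ≤ ∫ x, (χ x) ^ 3 * φ x) : 0 ≤ energyDeriv α c χ φ := by
  have hα0 : 0 < α := by linarith
  have hχS := hχ.1.1
  have hχ4 : MemLp χ 4 volume := hχS.memLp_four (by linarith)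
  have hφ4 : MemLp φ 4 volume := hφ.memLp_four (by linarith)
  have key : ∀ t : ℝ, 0 < t → 0 ≤ energyDeriv α c χ φ + t * energyB α c φ := by
    intro t ht
    have hS := hχS.add_mul hα0.le hφ t
    have hmean : 1 / (2 * Real.pi) * ∫ x, (χ x + t * φ x) = m := by
      rw [integral_add hχS.integrable (hφ.integrable.const_mul t), integral_const_mul, h0, mul_zero,
        add_zero, hχ.1.2.2]
    have h4 : 1 ≤ ∫ x, (χ x + t * φ x) ^ 4 := by
      have hi := integrable_cube_mul hχ4 (hφ4.const_mul t)
      calc (1 : ℝ) ≤ 1 + 4 * (t * ∫ x, (χ x) ^ 3 * φ x) := by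
            have := mul_nonneg ht.le hℓ
            linarith
        _ = ∫ x, ((χ x) ^ 4 + 4 * ((χ x) ^ 3 * (t * φ x))) := by
            rw [integral_add (integrable_pow_four hχ4) (hi.const_mul 4), integral_const_mul,
              hχ.1.2.1, ← integral_const_mul t]
            congr 3; ext x; ring
        _ ≤ _ := integral_mono ((integrable_pow_four hχ4).add (hi.const_mul 4))
            (integrable_pow_four (hχ4.add (hφ4.const_mul t))) fun x => pow_four_add_ge _ _
    have h5 := hχ.energy_le_of_one_le hα hc hm4 hS hmean h4
    rw [energyB_add_mul hα0.le c hχS hφ] at h5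
    have h6 : 0 ≤ t * (energyDeriv α c χ φ + t * energyB α c φ) := by nlinarith
    exact nonneg_of_mul_nonneg_right h6 ht
  have hlim : Tendsto (fun t : ℝ => energyDeriv α c χ φ + t * energyB α c φ) (𝓝[>] 0)
      (𝓝 (energyDeriv α c χ φ + 0 * energyB α c φ)) :=
    (Continuous.tendsto (by fun_prop) 0).mono_left nhdsWithin_le_nhds
  rw [zero_mul, add_zero] at hlim
  exact ge_of_tendsto hlim (by filter_upwards [self_mem_nhdsWithin] with t ht using key t ht)

/-- The weak Euler–Lagrange equation. The multiplier of the quartic constraint is positive. -/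
theorem IsGroundState.exists_multipliers {α c m : ℝ} (hα : 1 / 2 < α) (hc : -1 < c)
    (hm4 : 2 * Real.pi * m ^ 4 < 1) {χ : Torus → ℝ} (hχ : IsGroundState α c m χ) :
    ∃ μ : ℝ, 0 < μ ∧ ∃ b : ℝ, ∀ φ, MemSobolev (α / 2) φ →
      energyDeriv α c χ φ + b * ∫ x, φ x = μ * ∫ x, (χ x) ^ 3 * φ x := by
  have hα0 : 0 < α := by linarith
  have hpi := Real.pi_pos
  have hχS := hχ.1.1
  have L4 : ∀ {φ : Torus → ℝ}, MemSobolev (α / 2) φ → MemLp φ 4 volume := fun h =>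
    h.memLp_four (by linarith)
  have hη := hχS.sub_const hα0 m
  have hη0 := integral_sub_mean hχS.integrable hχ.1.2.2
  set η : Torus → ℝ := fun x => χ x - m with hηdef
  -- convexity between `χ` and the constant `m`
  have hℓη : 0 < ∫ x, (χ x) ^ 3 * η x := by
    have hi := integrable_cube_mul (L4 hχS) (L4 hη)
    have h1 : ∫ x, ((χ x) ^ 4 - 4 * ((χ x) ^ 3 * η x)) ≤ ∫ _ : Torus, m ^ 4 := by
      refine integral_mono ((integrable_pow_four (L4 hχS)).sub (hi.const_mul 4))
        (integrable_const _) fun x => ?_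
      have := pow_four_add_ge (χ x) (-(η x))
      have e : χ x + -(η x) = m := by simp [hηdef]
      rw [e] at this
      show (χ x) ^ 4 - 4 * ((χ x) ^ 3 * η x) ≤ m ^ 4
      linarith
    rw [integral_sub (integrable_pow_four (L4 hχS)) (hi.const_mul 4), integral_const_mul,
      hχ.1.2.1, integral_const_torus] at h1
    linarith
  have hDη : 0 < energyDeriv α c χ η := by
    have h1 := energy_coercive (c := c) hα0.le hη hη0
    have h2 : energyDeriv α c χ η =
        2 * (Real.pi * quadForm α η + c / 2 * ∫ x, (η x) ^ 2) := by
      have e1 : bilinForm α χ η = quadForm α η := by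
        have := bilinForm_add_right hα0.le hη hη (memSobolev_const hα0 m) 1
        rw [bilinForm_const_right hα0, mul_zero, add_zero, bilinForm_self] at this
        rw [← this, bilinForm_comm]
        congr 1; ext x; simp [hηdef]
      have e2 : ∫ x, χ x * η x = ∫ x, (η x) ^ 2 := by
        have e : ∀ x, χ x * η x = (η x) ^ 2 + m * η x := fun x => by simp only [hηdef]; ring
        simp_rw [e]
        rw [integral_add hη.1.integrable_sq (hη.integrable.const_mul m), integral_const_mul, hη0,
          mul_zero, add_zero]
      rw [energyDeriv, e1, e2]; ring
    have h3 : 0 < quadForm α η := by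
      refine lt_of_le_of_ne (quadForm_nonneg α η) fun h => ?_
      have h4 := integral_sq_le_quadForm hα0.le hη hη0
      rw [← h, mul_zero] at h4
      have h5 := le_antisymm h4 (integral_nonneg fun x => sq_nonneg _)
      rw [integral_eq_zero_iff_of_nonneg (fun x => sq_nonneg _) hη.1.integrable_sq] at h5
      have h6 : ∫ x, (χ x) ^ 3 * η x = 0 := by
        rw [← integral_zero Torus ℝ]
        refine integral_congr_ae ?_
        filter_upwards [h5] with x hx
        have hx0 : η x = 0 := by simpa using hx
        rw [hx0, mul_zero]
      linarith
    have h4 : 0 < min 1 (1 + c) * (Real.pi * quadForm α η) :=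
      mul_pos (lt_min one_pos (by linarith)) (mul_pos hpi h3)
    linarith
  have hzero : ∀ θ, MemSobolev (α / 2) θ → ∫ x, θ x = 0 → ∫ x, (χ x) ^ 3 * θ x = 0 →
      energyDeriv α c χ θ = 0 := by
    intro θ hθ h0 hℓ
    have hz : MemSobolev (α / 2) (fun _ : Torus => (0 : ℝ)) := memSobolev_const hα0 0
    have hDz : energyDeriv α c χ (fun _ => 0) = 0 := by
      simp [energyDeriv, bilinForm_const_right hα0]
    have h1 := hχ.energyDeriv_nonneg hα hc hm4.le hθ h0 hℓ.ge
    have h2 := hχ.energyDeriv_nonneg hα hc hm4.le (hz.add_mul hα0.le hθ (-1))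
      (by simp [integral_neg, h0]) (by simp [integral_neg, hℓ])
    rw [energyDeriv_add_mul hα0.le c hχS hz hθ, hDz] at h2
    linarith
  set ℓη := ∫ x, (χ x) ^ 3 * η x with hℓηdef
  set Dη := energyDeriv α c χ η with hDηdef
  have h1S : MemSobolev (α / 2) (fun _ : Torus => (1 : ℝ)) := memSobolev_const hα0 1
  set ℓ1 := ∫ x, (χ x) ^ 3 * (1 : ℝ) with hℓ1
  set D1 := energyDeriv α c χ (fun _ => 1) with hD1
  -- subtracting from `φ` its mean and a multiple of `η` leaves a direction in the kernel of both
  -- constraints, on which the derivative of the energy vanishes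
  refine ⟨Dη / ℓη, div_pos hDη hℓη, -(D1 - Dη / ℓη * ℓ1) / (2 * Real.pi), fun φ hφ => ?_⟩
  set p := 1 / (2 * Real.pi) * ∫ x, φ x with hp
  have hpφ : ∫ x, φ x = 2 * Real.pi * p := by rw [hp]; field_simp
  have hφ1 := hφ.add_mul hα0.le h1S (-p)
  set t := (∫ x, (χ x) ^ 3 * (φ x + -p * 1)) / ℓη with ht
  have hθ := hφ1.add_mul hα0.le hη (-t)
  have hθ0 := hzero _ hθ (by
      rw [integral_add hφ1.integrable (hη.integrable.const_mul _), integral_const_mul, hη0,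
        integral_add hφ.integrable (integrable_const _), integral_const_torus, hpφ]
      ring) (by
      rw [integral_cube_mul_add_mul (L4 hχS) (L4 hφ1) (L4 hη), ht]
      field_simp
      ring)
  rw [energyDeriv_add_mul hα0.le c hχS hφ1 hη, energyDeriv_add_mul hα0.le c hχS hφ h1S] at hθ0
  rw [integral_cube_mul_add_mul (L4 hχS) (L4 hφ) (L4 h1S)] at ht
  rw [hpφ]
  rw [← hDηdef, ← hD1] at hθ0
  rw [← hℓ1] at ht
  have h7 : energyDeriv α c χ φ = p * D1 + t * Dη := by linarith
  rw [h7, ht]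
  field_simp
  ring

/-! ### The equation for the Fourier coefficients -/

/-- `Re e^{inx}`, that is `cos (n x)`. -/
def cosT (n : ℤ) (x : Torus) : ℝ := (fourier n x : ℂ).re

/-- `Im e^{inx}`, that is `sin (n x)`. -/
def sinT (n : ℤ) (x : Torus) : ℝ := (fourier n x : ℂ).im

lemma continuous_cosT (n : ℤ) : Continuous (cosT n) :=
  Complex.continuous_re.comp (fourier n).continuous

lemma continuous_sinT (n : ℤ) : Continuous (sinT n) :=
  Complex.continuous_im.comp (fourier n).continuous

lemma fourierCoeff_fourier_apply (n k : ℤ) :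
    fourierCoeff (fourier n : Torus → ℂ) k = if k = n then 1 else 0 := by
  rw [fourierCoeff_fourier, Pi.single_apply]

lemma coeff_re_im (u : Torus → ℝ) (hu : Integrable u volume) (n : ℤ) :
    (coeff u n).re = (2 * Real.pi)⁻¹ * ∫ x, u x * cosT n x ∧
    (coeff u n).im = -((2 * Real.pi)⁻¹ * ∫ x, u x * sinT n x) := by
  have hi : Integrable (fun x => fourier (-n) x • (u x : ℂ)) (haarAddCircle : Measure Torus) :=
    (integrable_ofReal hu).fourier_smul (-n)
  unfold coeff fourierCoeff
  constructor
  · rw [← integral_haar]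
    refine ((integral_re hi).symm).trans ?_
    congr 1; ext x
    simp only [cosT]
    rw [smul_eq_mul, fourier_neg]
    simp [mul_comm]
  · rw [← integral_haar, ← integral_neg]
    refine ((integral_im hi).symm).trans ?_
    congr 1; ext x
    simp only [sinT]
    rw [smul_eq_mul, fourier_neg]
    simp [mul_comm]

lemma coeff_cosT (n k : ℤ) :
    coeff (cosT n) k = ((if k = n then 1 else 0) + if k = -n then 1 else 0) / 2 := by
  have e : (fun x => ((cosT n x : ℝ) : ℂ)) =
      fun x => (1 / 2 : ℂ) * ((fourier n : Torus → ℂ) + (fourier (-n) : Torus → ℂ)) x := by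
    ext x
    rw [Pi.add_apply, fourier_neg, Complex.add_conj, cosT]
    push_cast; ring
  have hi : ∀ n : ℤ, Integrable (fourier n : Torus → ℂ) (haarAddCircle : Measure Torus) :=
    fun n => (fourier n).continuous.integrable_of_hasCompactSupport
      (HasCompactSupport.of_compactSpace _)
  unfold coeff
  rw [e, fourierCoeff.const_mul, fourierCoeff.add (hi n) (hi (-n)), Pi.add_apply,
    fourierCoeff_fourier_apply, fourierCoeff_fourier_apply]
  ring

lemma coeff_sinT (n k : ℤ) :
    coeff (sinT n) k
      = ((if k = n then 1 else 0) - if k = -n then 1 else 0) / (2 * Complex.I) := by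
  have e : (fun x => ((sinT n x : ℝ) : ℂ)) =
      fun x => (1 / (2 * Complex.I) : ℂ) *
        ((fourier n : Torus → ℂ) + fun x => (-1 : ℂ) * (fourier (-n) : Torus → ℂ) x) x := by
    ext x
    rw [Pi.add_apply, fourier_neg, neg_one_mul, ← sub_eq_add_neg, Complex.sub_conj, sinT]
    push_cast
    field_simp
  have hi : ∀ n : ℤ, Integrable (fourier n : Torus → ℂ) (haarAddCircle : Measure Torus) :=
    fun n => (fourier n).continuous.integrable_of_hasCompactSupport
      (HasCompactSupport.of_compactSpace _)
  unfold coeff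
  rw [e, fourierCoeff.const_mul, fourierCoeff.add (hi n) ((hi (-n)).const_mul _), Pi.add_apply,
    fourierCoeff.const_mul, fourierCoeff_fourier_apply, fourierCoeff_fourier_apply]
  ring

lemma memSobolev_of_finite_support {α : ℝ} (hα : 0 ≤ α) {u : Torus → ℝ} (hu : Continuous u)
    (F : Finset ℤ) (h : ∀ n ∉ F, coeff u n = 0) : MemSobolev (α / 2) u :=
  memSobolev_of_summable hα (memLp_of_continuous hu 2)
    (summable_of_ne_finset_zero (s := F) fun n hn => by rw [h n hn]; simp)

lemma memSobolev_cosT {α : ℝ} (hα : 0 ≤ α) (n : ℤ) : MemSobolev (α / 2) (cosT n) := by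
  refine memSobolev_of_finite_support hα (continuous_cosT n) {n, -n} fun k hk => ?_
  simp only [Finset.mem_insert, Finset.mem_singleton, not_or] at hk
  rw [coeff_cosT, if_neg hk.1, if_neg hk.2]; simp

lemma memSobolev_sinT {α : ℝ} (hα : 0 ≤ α) (n : ℤ) : MemSobolev (α / 2) (sinT n) := by
  refine memSobolev_of_finite_support hα (continuous_sinT n) {n, -n} fun k hk => ?_
  simp only [Finset.mem_insert, Finset.mem_singleton, not_or] at hk
  rw [coeff_sinT, if_neg hk.1, if_neg hk.2]; simp

lemma bilinForm_cosT (α : ℝ) (u : Torus → ℝ) (n : ℤ) :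
    bilinForm α u (cosT n) = |(n : ℝ)| ^ α * (coeff u n).re := by
  have h := (hasSum_ite_eq n (|(n : ℝ)| ^ α * (coeff u n).re / 2)).add
    (hasSum_ite_eq (-n) (|(n : ℝ)| ^ α * (coeff u n).re / 2))
  rw [add_halves] at h
  refine HasSum.tsum_eq (h.congr_fun fun k => ?_)
  rw [coeff_cosT]
  by_cases h1 : k = n <;> by_cases h2 : k = -n
  · subst h1; simp only [if_true, if_pos h2]; simp
  · subst h1; simp only [if_true, if_neg h2]; simp; ring
  · subst h2; simp only [if_true, if_neg h1, coeff_neg_index]; simp; ring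
  · simp only [if_neg h1, if_neg h2]; simp

lemma bilinForm_sinT (α : ℝ) (u : Torus → ℝ) (n : ℤ) :
    bilinForm α u (sinT n) = -(|(n : ℝ)| ^ α * (coeff u n).im) := by
  have h := (hasSum_ite_eq n (-(|(n : ℝ)| ^ α * (coeff u n).im) / 2)).add
    (hasSum_ite_eq (-n) (-(|(n : ℝ)| ^ α * (coeff u n).im) / 2))
  rw [add_halves] at h
  refine HasSum.tsum_eq (h.congr_fun fun k => ?_)
  rw [coeff_sinT]
  have eI : (1 : ℂ) / (2 * Complex.I) = -Complex.I / 2 := by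
    rw [div_eq_div_iff (by simp) (by simp)]
    ring_nf; simp
  have eI' : (-1 : ℂ) / (2 * Complex.I) = Complex.I / 2 := by
    rw [neg_div, eI]; ring
  by_cases h1 : k = n <;> by_cases h2 : k = -n
  · have h0 : n = 0 := by omega
    subst h1; subst h0
    have := congrArg Complex.im (coeff_neg_index u 0)
    simp at this
    have h00 : (coeff u 0).im = 0 := by linarith
    simp [h00]
  · subst h1; simp only [if_true, if_neg h2, sub_zero, eI]; simp; ring
  · subst h2; simp only [if_true, if_neg h1, coeff_neg_index, zero_sub, eI']; simp; ring
  · simp only [if_neg h1, if_neg h2]; simp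

lemma integrable_cube_of_memLp_four {u : Torus → ℝ} (hu : MemLp u 4 volume) :
    Integrable (fun x => (u x) ^ 3) volume := by
  have := integrable_cube_mul hu (memLp_const (1 : ℝ))
  simpa using this

/-- The Euler–Lagrange equation in terms of Fourier coefficients. -/
lemma coeff_equation {α c μ b : ℝ} (hα : 1 / 2 < α) {χ : Torus → ℝ} (hχ : MemSobolev (α / 2) χ)
    (h : ∀ φ, MemSobolev (α / 2) φ →
      energyDeriv α c χ φ + b * ∫ x, φ x = μ * ∫ x, (χ x) ^ 3 * φ x) (n : ℤ) :
    ((|(n : ℝ)| ^ α : ℝ) + c : ℂ) * coeff χ n + (if n = 0 then (b : ℂ) else 0)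
      = μ * coeff (fun x => (χ x) ^ 3) n := by
  have hα0 : 0 ≤ α := by linarith
  have hpi := Real.pi_pos
  have hi3 := integrable_cube_of_memLp_four (hχ.memLp_four (by linarith))
  obtain ⟨r1, i1⟩ := coeff_re_im χ hχ.integrable n
  obtain ⟨r3, i3⟩ := coeff_re_im _ hi3 n
  have hc := h _ (memSobolev_cosT hα0 n)
  have hs := h _ (memSobolev_sinT hα0 n)
  rw [energyDeriv, bilinForm_cosT] at hc
  rw [energyDeriv, bilinForm_sinT] at hs
  have hcm : (2 * Real.pi)⁻¹ * ∫ x, cosT n x = if n = 0 then 1 else 0 := by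
    have h1 := coeff_zero (cosT n)
    rw [coeff_cosT] at h1
    rw [← one_div]
    have h2 := congrArg Complex.re h1
    rw [Complex.ofReal_re] at h2
    rw [← h2]
    by_cases hn : n = 0
    · simp [hn]
    · simp [hn, Ne.symm hn]
  have hsm : (2 * Real.pi)⁻¹ * ∫ x, sinT n x = 0 := by
    have h1 := coeff_zero (sinT n)
    rw [coeff_sinT] at h1
    rw [← one_div]
    have h2 := congrArg Complex.re h1
    rw [Complex.ofReal_re] at h2
    rw [← h2]
    by_cases hn : n = 0
    · simp [hn]
    · simp [hn, Ne.symm hn]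
  rw [inv_mul_eq_iff_eq_mul₀ (by positivity)] at hcm hsm
  have r1' : ∫ x, χ x * cosT n x = 2 * Real.pi * (coeff χ n).re := by rw [r1]; field_simp
  have r3' : ∫ x, (χ x) ^ 3 * cosT n x = 2 * Real.pi * (coeff (fun x => (χ x) ^ 3) n).re := by
    rw [r3]; field_simp
  have i1' : ∫ x, χ x * sinT n x = -(2 * Real.pi * (coeff χ n).im) := by rw [i1]; field_simp
  have i3' : ∫ x, (χ x) ^ 3 * sinT n x = -(2 * Real.pi * (coeff (fun x => (χ x) ^ 3) n).im) := by
    rw [i3]; field_simp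
  rw [r1', r3', hcm] at hc
  rw [i1', i3', hsm] at hs
  apply Complex.ext
  · have : 2 * Real.pi * ((|(n : ℝ)| ^ α + c) * (coeff χ n).re + (if n = 0 then b else 0))
        = 2 * Real.pi * (μ * (coeff (fun x => (χ x) ^ 3) n).re) := by
      split_ifs at hc ⊢ <;> linarith
    have := mul_left_cancel₀ (by positivity) this
    rw [← Complex.ofReal_add, Complex.add_re, Complex.re_ofReal_mul, Complex.re_ofReal_mul, ← this]
    split_ifs <;> simp
  · have : 2 * Real.pi * ((|(n : ℝ)| ^ α + c) * (coeff χ n).im)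
        = 2 * Real.pi * (μ * (coeff (fun x => (χ x) ^ 3) n).im) := by
      linarith
    have := mul_left_cancel₀ (by positivity) this
    rw [← Complex.ofReal_add, Complex.add_im, Complex.im_ofReal_mul, Complex.im_ofReal_mul, ← this]
    split_ifs <;> simp

/-! ### Regularity by a bootstrap in Sobolev spaces -/

lemma sobolevSq_ne_top {σ : ℝ} {u : Torus → ℝ} (hu : MemSobolev σ u) : sobolevSq σ u ≠ ⊤ :=
  (memSobolev_iff_sobolevSq hu.1).1 hu

lemma memLp_mul_self {u : Torus → ℝ} (hu : MemLp u 4 volume) :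
    MemLp (fun x => u x * u x) 2 volume := by
  have hm : AEStronglyMeasurable (fun x => u x * u x) volume := hu.1.mul hu.1
  rw [memLp_two_iff_integrable_sq hm]
  refine (integrable_pow_four hu).congr (Eventually.of_forall fun x => ?_)
  ring

/-- Pointwise consequence of the equation for the coefficients, in squared form. -/
lemma weight_mul_sq_le {α c μ : ℝ} (hα : 0 < α) {z w : ℂ} {n : ℤ}
    (h : n ≠ 0 → ((|(n : ℝ)| ^ α : ℝ) + c : ℂ) * z = μ * w) :
    (1 + (n : ℝ) ^ 2) ^ α * ‖z‖ ^ 2 ≤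
      2 ^ α * (1 + 2 * c ^ 2) * ‖z‖ ^ 2 + 2 ^ α * (2 * μ ^ 2) * ‖w‖ ^ 2 := by
  have h1 : |(n : ℝ)| ^ α * ‖z‖ ≤ |μ| * ‖w‖ + |c| * ‖z‖ := by
    by_cases hn : n = 0
    · rw [hn]; simp only [Int.cast_zero, abs_zero, Real.zero_rpow hα.ne', zero_mul]; positivity
    · have h2 : ((|(n : ℝ)| ^ α : ℝ) : ℂ) * z = μ * w - c * z := by rw [← h hn]; ring
      calc |(n : ℝ)| ^ α * ‖z‖ = ‖((|(n : ℝ)| ^ α : ℝ) : ℂ) * z‖ := by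
            rw [norm_mul, Complex.norm_real, Real.norm_of_nonneg (by positivity)]
        _ ≤ ‖(μ : ℂ) * w‖ + ‖(c : ℂ) * z‖ := by rw [h2]; exact norm_sub_le _ _
        _ = _ := by simp
  have h2 : |(n : ℝ)| ^ (2 * α) * ‖z‖ ^ 2 ≤ 2 * μ ^ 2 * ‖w‖ ^ 2 + 2 * c ^ 2 * ‖z‖ ^ 2 := by
    calc |(n : ℝ)| ^ (2 * α) * ‖z‖ ^ 2 = (|(n : ℝ)| ^ α * ‖z‖) ^ 2 := by
          rw [mul_pow, mul_comm 2 α, Real.rpow_mul (abs_nonneg _), Real.rpow_two]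
      _ ≤ (|μ| * ‖w‖ + |c| * ‖z‖) ^ 2 := by gcongr
      _ ≤ 2 * ((|μ| * ‖w‖) ^ 2 + (|c| * ‖z‖) ^ 2) := add_sq_le
      _ = _ := by rw [mul_pow, mul_pow, sq_abs, sq_abs]; ring
  have h3 := weight_le n hα.le
  calc _ ≤ 2 ^ α * (1 + |(n : ℝ)| ^ (2 * α)) * ‖z‖ ^ 2 := by gcongr
    _ = 2 ^ α * (‖z‖ ^ 2 + |(n : ℝ)| ^ (2 * α) * ‖z‖ ^ 2) := by ring
    _ ≤ 2 ^ α * (‖z‖ ^ 2 + (2 * μ ^ 2 * ‖w‖ ^ 2 + 2 * c ^ 2 * ‖z‖ ^ 2)) := by gcongr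
    _ = _ := by ring

/-- One step of the bootstrap: regularity `σ` improves to `α - τ` as soon as `σ + τ > 1/2`. -/
lemma bootstrap_step {α c μ : ℝ} (hα : 1 / 2 < α) {χ : Torus → ℝ} (hχ : MemSobolev (α / 2) χ)
    (h : ∀ n : ℤ, n ≠ 0 → ((|(n : ℝ)| ^ α : ℝ) + c : ℂ) * coeff χ n
      = μ * coeff (fun x => (χ x) ^ 3) n)
    {σ τ : ℝ} (hσ : 0 ≤ σ) (hτ : 0 ≤ τ) (hστ : 1 / 2 < τ + σ) (hχσ : MemSobolev σ χ) :
    MemSobolev (α - τ) χ := by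
  have hα0 : 0 < α := by linarith
  have hχ4 := hχ.memLp_four (by linarith)
  have hV := memLp_mul_self hχ4
  rw [memSobolev_iff_sobolevSq hχ.1]
  set A : ℝ := 2 ^ α * (1 + 2 * c ^ 2)
  set B : ℝ := 2 ^ α * (2 * μ ^ 2)
  have hw : ∀ n, ‖coeff (fun x => (χ x) ^ 3) n‖ₑ ≤
      ∑' i, ‖coeff (fun x => χ x * χ x) (n - i)‖ₑ * ‖coeff χ i‖ₑ := by
    intro n
    refine le_trans (le_of_eq ?_) (enorm_coeff_mul_le hV hχ.1 n)
    congr 2; ext x; ring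
  have hpt : ∀ n, weight (α - τ) n * ‖coeff χ n‖ₑ ^ 2 ≤
      ENNReal.ofReal A * ‖coeff χ n‖ₑ ^ 2 + ENNReal.ofReal B * (weight (-τ) n *
        (∑' i, ‖coeff (fun x => χ x * χ x) (n - i)‖ₑ * ‖coeff χ i‖ₑ) ^ 2) := by
    intro n
    have h1 : weight α n * ‖coeff χ n‖ₑ ^ 2 ≤ ENNReal.ofReal A * ‖coeff χ n‖ₑ ^ 2 +
        ENNReal.ofReal B * ‖coeff (fun x => (χ x) ^ 3) n‖ₑ ^ 2 := by
      have e : ∀ z : ℂ, ‖z‖ₑ ^ 2 = ENNReal.ofReal (‖z‖ ^ 2) := fun z => by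
        rw [ENNReal.ofReal_pow (norm_nonneg _), ofReal_norm]
      rw [weight_mul_enorm_sq, e, e, ← ENNReal.ofReal_mul (by positivity),
        ← ENNReal.ofReal_mul (by positivity), ← ENNReal.ofReal_add (by positivity) (by positivity)]
      exact ENNReal.ofReal_le_ofReal (weight_mul_sq_le hα0 (h n))
    calc weight (α - τ) n * ‖coeff χ n‖ₑ ^ 2
        = weight (-τ) n * (weight α n * ‖coeff χ n‖ₑ ^ 2) := by
          rw [← mul_assoc, weight_mul]; congr 2; ring
      _ ≤ weight (-τ) n * (ENNReal.ofReal A * ‖coeff χ n‖ₑ ^ 2 +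
        ENNReal.ofReal B * ‖coeff (fun x => (χ x) ^ 3) n‖ₑ ^ 2) := by gcongr
      _ = weight (-τ) n * (ENNReal.ofReal A * ‖coeff χ n‖ₑ ^ 2) +
        ENNReal.ofReal B * (weight (-τ) n * ‖coeff (fun x => (χ x) ^ 3) n‖ₑ ^ 2) := by ring
      _ ≤ weight 0 n * (ENNReal.ofReal A * ‖coeff χ n‖ₑ ^ 2) + ENNReal.ofReal B * (weight (-τ) n *
        (∑' i, ‖coeff (fun x => χ x * χ x) (n - i)‖ₑ * ‖coeff χ i‖ₑ) ^ 2) := by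
          gcongr
          · exact weight_anti (by linarith) n
          · exact hw n
      _ = _ := by rw [weight_zero, one_mul]
  have hfin0 : ∀ {u : Torus → ℝ}, MemLp u 2 volume → ∑' n, ‖coeff u n‖ₑ ^ 2 ≠ ⊤ := by
    intro u hu
    have h1 : MemSobolev 0 u := ⟨hu, by simpa using (hasSum_norm_coeff_sq hu).summable⟩
    have h2 := sobolevSq_ne_top h1
    unfold sobolevSq at h2
    simpa only [weight_zero, one_mul] using h2
  refine ne_top_of_le_ne_top ?_ (ENNReal.tsum_le_tsum hpt)
  rw [ENNReal.tsum_add, ENNReal.tsum_mul_left, ENNReal.tsum_mul_left]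
  refine ENNReal.add_ne_top.2 ⟨ENNReal.mul_ne_top ENNReal.ofReal_ne_top (hfin0 hχ.1),
    ENNReal.mul_ne_top ENNReal.ofReal_ne_top ?_⟩
  refine ne_top_of_le_ne_top ?_ (tsum_weight_conv_sq_le hσ hτ
    (fun i => ‖coeff (fun x => χ x * χ x) i‖ₑ) fun i => ‖coeff χ i‖ₑ)
  exact ENNReal.mul_ne_top (ENNReal.mul_ne_top (ENNReal.mul_ne_top (by norm_num)
    (tsum_weight_ne_top hστ)) (hfin0 hV)) (sobolevSq_ne_top hχσ)

/-- Each step of the bootstrap gains `δ = (α - 1/2) / 2` derivatives until the order exceeds `1/2`;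
one more step with `τ = 0` then reaches the order `α`. -/
lemma memSobolev_of_coeff_equation {α c μ : ℝ} (hα : 1 / 2 < α) {χ : Torus → ℝ}
    (hχ : MemSobolev (α / 2) χ)
    (h : ∀ n : ℤ, n ≠ 0 → ((|(n : ℝ)| ^ α : ℝ) + c : ℂ) * coeff χ n
      = μ * coeff (fun x => (χ x) ^ 3) n) : MemSobolev α χ := by
  set δ := (α - 1 / 2) / 2 with hδ
  have hδ0 : 0 < δ := by rw [hδ]; linarith
  have key : ∀ k : ℕ, MemSobolev (min (α / 2 + k * δ) (1 / 2 + δ)) χ := by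
    intro k
    induction k with
    | zero => exact hχ.mono (by simp)
    | succ k ih =>
      set σ := min (α / 2 + k * δ) (1 / 2 + δ) with hσ
      have hσ0 : 0 ≤ σ := le_min (by positivity) (by positivity)
      have hσ1 : σ ≤ 1 / 2 + δ := min_le_right _ _
      have h1 := bootstrap_step hα hχ h hσ0 (τ := 1 / 2 + δ - σ) (by linarith) (by linarith) ih
      refine h1.mono ?_
      have e : α - (1 / 2 + δ - σ) = σ + δ := by rw [hδ]; ring
      rw [e, hσ, min_add]
      refine min_le_min (le_of_eq (by push_cast; ring)) (by linarith)
  obtain ⟨k, hk⟩ := exists_nat_gt (1 / δ)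
  have hk' : 1 ≤ k * δ := by
    rw [div_lt_iff₀ hδ0] at hk
    exact hk.le
  have h1 := key k
  rw [min_eq_right (by rw [hδ] at hk' ⊢; linarith)] at h1
  have h2 := bootstrap_step hα hχ h (by positivity) le_rfl (by linarith) h1
  simpa using h2

lemma MemSobolev.summable_norm_coeff {s : ℝ} (hs : 1 / 2 < s) {u : Torus → ℝ}
    (hu : MemSobolev s u) : Summable fun n => ‖coeff u n‖ := by
  refine (hu.2.add (summable_weight hs)).of_norm_bounded fun n => ?_
  rw [norm_norm, Real.rpow_neg (by positivity)]
  set w := (1 + (n : ℝ) ^ 2) ^ s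
  have hw : 0 < w := by positivity
  have h1 : w * w⁻¹ = 1 := mul_inv_cancel₀ hw.ne'
  have h2 : 0 < w⁻¹ := inv_pos.2 hw
  nlinarith [mul_nonneg hw.le (sq_nonneg (‖coeff u n‖ - w⁻¹)), norm_nonneg (coeff u n),
    mul_nonneg hw.le (sq_nonneg (‖coeff u n‖))]

/-- A function with absolutely summable coefficients has a continuous representative. -/
lemma exists_continuous_rep {u : Torus → ℝ} (hu : MemLp u 2 volume)
    (hs : Summable fun n => ‖coeff u n‖) : ∃ v : Torus → ℝ, Continuous v ∧ u =ᵐ[volume] v := by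
  have h1 : Summable fun n => coeff u n • (fourier n : C(Torus, ℂ)) := by
    refine Summable.of_norm ?_
    simp_rw [norm_smul, fourier_norm, mul_one]
    exact hs
  set g : C(Torus, ℂ) := ∑' n, coeff u n • fourier n
  have h2 := (ContinuousMap.toLp (E := ℂ) 2 (haarAddCircle : Measure Torus) ℂ).hasSum h1.hasSum
  have h3 := hasSum_fourier_series_L2 ((memLp_ofReal hu).toLp _)
  have h4 : ∀ n, fourierCoeff ((memLp_ofReal hu).toLp _) n = coeff u n := fun n => by
    rw [fourierCoeff_congr_ae (memLp_ofReal hu).coeFn_toLp]; rfl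
  simp_rw [h4] at h3
  have h5 : (memLp_ofReal hu).toLp _ = ContinuousMap.toLp 2 haarAddCircle ℂ g := by
    refine h3.unique ?_
    convert h2 using 1
    ext1 n
    simp
  refine ⟨fun x => (g x).re, Complex.continuous_re.comp g.continuous, ?_⟩
  rw [EventuallyEq, ← ae_haar_iff]
  filter_upwards [(memLp_ofReal hu).coeFn_toLp,
    ContinuousMap.coeFn_toLp (p := 2) (𝕜 := ℂ) haarAddCircle g] with x h6 h7
  rw [← h7, ← h5, h6, Complex.ofReal_re]

lemma IsGroundState.congr {α c m : ℝ} {χ v : Torus → ℝ} (hα : 0 ≤ α) (h : IsGroundState α c m χ)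
    (hv : χ =ᵐ[volume] v) : IsGroundState α c m v := by
  have hS := h.1.1.congr hv
  refine ⟨⟨hS, ?_, ?_⟩, fun w hw => ?_⟩
  · rw [← h.1.2.1]
    refine integral_congr_ae ?_
    filter_upwards [hv] with x hx
    rw [hx]
  · rw [← h.1.2.2, integral_congr_ae hv]
  · show energyB α c v ≤ energyB α c w
    have e : energyB α c v = energyB α c χ := by
      rw [energyB_eq hα c hS, energyB_eq hα c h.1.1, quadForm, quadForm, coeff_congr hv]
      congr 2
      refine integral_congr_ae ?_
      filter_upwards [hv] with x hx
      rw [hx]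
    rw [e]
    exact h.2 hw

/-- Regularity of ground states: they are continuous up to a null set, and a multiple of them solves
the stationary equation. -/
theorem IsGroundState.regularity {α c m : ℝ} (hα : 1 / 2 < α) (hc : -1 < c)
    (hm4 : 2 * Real.pi * m ^ 4 < 1) {χ : Torus → ℝ} (hχ : IsGroundState α c m χ) :
    (∃ v, Continuous v ∧ χ =ᵐ[volume] v) ∧
      ∃ C : ℝ, 0 < C ∧ ∃ b : ℝ, SolvesStationary α c b (fun x => C * χ x) := by
  have hα0 : 0 < α := by linarith
  obtain ⟨μ, hμ, b, h⟩ := hχ.exists_multipliers hα hc hm4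
  have heq := coeff_equation hα hχ.1.1 h
  have hχα : MemSobolev α χ := memSobolev_of_coeff_equation (c := c) (μ := μ) hα hχ.1.1 fun n hn => by
    have := heq n
    rwa [if_neg hn, add_zero] at this
  obtain ⟨v, hv, hχv⟩ := exists_continuous_rep hχ.1.1.1 (hχα.summable_norm_coeff hα)
  refine ⟨⟨v, hv, hχv⟩, Real.sqrt (μ / 2), by positivity, Real.sqrt (μ / 2) * b, ?_⟩
  set C := Real.sqrt (μ / 2) with hC
  have hC2 : 2 * C ^ 2 = μ := by rw [hC, Real.sq_sqrt (by positivity)]; ring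
  have hψ : MemSobolev α (fun x => C * χ x) := by
    refine ⟨hχα.1.const_mul C, (hχα.2.mul_left (C ^ 2)).congr fun n => ?_⟩
    rw [coeff_const_mul, norm_mul, mul_pow, Complex.norm_real, Real.norm_eq_abs, sq_abs]
    ring
  refine ⟨hψ, ?_⟩
  obtain ⟨hD, hDc⟩ := fracD_spec hα0.le hψ
  have hχ3 : MemLp (fun x => (χ x) ^ 3) 2 volume := by
    refine (memLp_congr_ae ?_).1 (memLp_of_continuous (hv.pow 3) 2)
    filter_upwards [hχv] with x hx
    rw [hx]; rfl
  have hψ3 : MemLp (fun x => 2 * (C * χ x) ^ 3) 2 volume := by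
    have := hχ3.const_mul (2 * C ^ 3)
    refine this.congr_norm ?_ ?_
    · exact (((hχα.1.const_mul C).1.pow 3).const_mul 2)
    · refine Eventually.of_forall fun x => ?_
      congr 1; ring
  have hl1 : MemLp (fun x => fracD α (fun x => C * χ x) x + c * (C * χ x)) 2 volume :=
    hD.add (hψ.1.const_mul c)
  have hl : MemLp (fun x => fracD α (fun x => C * χ x) x + c * (C * χ x) + C * b) 2 volume :=
    hl1.add (memLp_const _)
  refine ae_eq_of_coeff_eq hl hψ3 fun n => ?_
  have hint : ∀ {u : Torus → ℝ}, MemLp u 2 volume → Integrable u volume := fun h =>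
    h.integrable (by norm_num)
  have e3 : coeff (fun x => 2 * (C * χ x) ^ 3) n = (2 * C ^ 3 : ℝ) * coeff (fun x => (χ x) ^ 3) n := by
    rw [← coeff_const_mul]
    congr 1; ext x; ring
  rw [coeff_add (hint hl1) (integrable_const _), coeff_add (hint hD) (hint (hψ.1.const_mul c)), hDc,
    coeff_const_mul, coeff_const_mul, coeff_const_mul, coeff_const, e3]
  have h7 : ((2 * C ^ 3 : ℝ) : ℂ) = C * μ := by
    rw [← hC2]; push_cast; ring
  rw [h7, mul_assoc (C : ℂ), ← heq n]
  split_ifs <;> push_cast <;> ring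

/-! ### The fractional form as a mixture of resolvent forms -/

/-- The quadratic form with multiplier `n² / (l² + n²)`. -/
def resolventForm (l : ℝ) (u : Torus → ℝ) : ℝ :=
  ∑' n : ℤ, (n : ℝ) ^ 2 / (l ^ 2 + (n : ℝ) ^ 2) * ‖coeff u n‖ ^ 2

lemma resolvent_multiplier_le_one (l : ℝ) (n : ℤ) : (n : ℝ) ^ 2 / (l ^ 2 + (n : ℝ) ^ 2) ≤ 1 :=
  div_le_one_of_le₀ (by nlinarith [sq_nonneg l]) (by positivity)

lemma summable_resolventForm (l : ℝ) {u : Torus → ℝ} (hu : MemLp u 2 volume) :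
    Summable fun n : ℤ => (n : ℝ) ^ 2 / (l ^ 2 + (n : ℝ) ^ 2) * ‖coeff u n‖ ^ 2 :=
  (hasSum_norm_coeff_sq hu).summable.of_nonneg_of_le (fun n => by positivity) fun n =>
    mul_le_of_le_one_left (by positivity) (resolvent_multiplier_le_one l n)

/-- The constant `∫₀^∞ l^(α-1) / (l² + 1) dl` of the subordination formula. -/
def subordConst (α : ℝ) : ℝ := ∫ l in Set.Ioi (0 : ℝ), l ^ (α - 1) / (l ^ 2 + 1)

lemma integrableOn_subord {α : ℝ} (h0 : 0 < α) (h2 : α < 2) :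
    IntegrableOn (fun l : ℝ => l ^ (α - 1) / (l ^ 2 + 1)) (Set.Ioi 0) := by
  have hm : Measurable fun l : ℝ => l ^ (α - 1) / (l ^ 2 + 1) := by fun_prop
  rw [← Set.Ioc_union_Ioi_eq_Ioi (zero_le_one' ℝ)]
  refine IntegrableOn.union ?_ ?_
  · have h := (intervalIntegral.intervalIntegrable_rpow' (a := 0) (b := 1)
      (show -1 < α - 1 by linarith))
    rw [intervalIntegrable_iff_integrableOn_Ioc_of_le zero_le_one] at h
    refine h.mono' hm.aestronglyMeasurable ?_
    filter_upwards [ae_restrict_mem measurableSet_Ioc] with l hl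
    have h3 : 0 ≤ l ^ (α - 1) := Real.rpow_nonneg hl.1.le _
    rw [Real.norm_of_nonneg (by positivity)]
    exact div_le_self h3 (by nlinarith [sq_nonneg l])
  · have h := integrableOn_Ioi_rpow_of_lt (show α - 3 < -1 by linarith) one_pos
    refine h.mono' hm.aestronglyMeasurable ?_
    filter_upwards [ae_restrict_mem measurableSet_Ioi] with l hl
    have hl0 : (0 : ℝ) < l := one_pos.trans hl
    have h3 : 0 ≤ l ^ (α - 1) := Real.rpow_nonneg hl0.le _
    rw [Real.norm_of_nonneg (by positivity), div_le_iff₀ (by positivity)]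
    have h4 : l ^ (α - 1) = l ^ (α - 3) * l ^ 2 := by
      rw [← Real.rpow_two, ← Real.rpow_add hl0]; congr 1; ring
    rw [h4]
    have := Real.rpow_nonneg hl0.le (α - 3)
    nlinarith

lemma subordConst_pos {α : ℝ} (h0 : 0 < α) (h2 : α < 2) : 0 < subordConst α := by
  unfold subordConst
  rw [integral_pos_iff_support_of_nonneg_ae ?_ (integrableOn_subord h0 h2)]
  · have : Set.Ioi (0 : ℝ) ⊆ Function.support fun l : ℝ => l ^ (α - 1) / (l ^ 2 + 1) := by
      intro l hl
      have := Real.rpow_pos_of_pos hl (α - 1)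
      exact (by positivity : (0 : ℝ) < _).ne'
    refine lt_of_lt_of_le ?_ (measure_mono this)
    simp
  · filter_upwards [ae_restrict_mem measurableSet_Ioi] with l hl
    have := Real.rpow_pos_of_pos hl (α - 1)
    show (0 : ℝ) ≤ _
    positivity

/-- The subordination formula `∫₀^∞ l^(α-1) n² / (l² + n²) dl = subordConst α * |n|^α`, by the
substitution `l = |n| s`. -/
lemma lintegral_subord {α : ℝ} (h0 : 0 < α) (h2 : α < 2) (n : ℤ) :
    ∫⁻ l in Set.Ioi (0 : ℝ), ENNReal.ofReal (l ^ (α - 1) * ((n : ℝ) ^ 2 / (l ^ 2 + (n : ℝ) ^ 2)))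
      = ENNReal.ofReal (subordConst α * |(n : ℝ)| ^ α) := by
  by_cases hn : n = 0
  · subst hn
    simp [Real.zero_rpow h0.ne']
  have hn0 : 0 < |(n : ℝ)| := abs_pos.2 (by exact_mod_cast hn)
  set g : ℝ → ℝ := fun l => l ^ (α - 1) * ((n : ℝ) ^ 2 / (l ^ 2 + (n : ℝ) ^ 2)) with hg
  have e : ∀ l ∈ Set.Ioi (0 : ℝ), g (|(n : ℝ)| * l)
      = |(n : ℝ)| ^ (α - 1) * (l ^ (α - 1) / (l ^ 2 + 1)) := by
    intro l hl
    have hl0 : (0 : ℝ) < l := hl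
    simp only [hg]
    rw [Real.mul_rpow hn0.le hl0.le, mul_pow, sq_abs]
    have : (n : ℝ) ^ 2 ≠ 0 := by positivity
    field_simp
  have hint' : IntegrableOn (fun l => g (|(n : ℝ)| * l)) (Set.Ioi 0) := by
    rw [integrableOn_congr_fun e measurableSet_Ioi]
    exact (integrableOn_subord h0 h2).const_mul _
  have hint : IntegrableOn g (Set.Ioi 0) := by
    have := (integrableOn_Ioi_comp_mul_left_iff g 0 hn0).1 hint'
    rwa [mul_zero] at this
  have hval : ∫ l in Set.Ioi 0, g l = subordConst α * |(n : ℝ)| ^ α := by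
    have h1 := integral_comp_mul_left_Ioi g 0 hn0
    rw [setIntegral_congr_fun measurableSet_Ioi e, mul_zero, integral_const_mul, smul_eq_mul,
      eq_inv_mul_iff_mul_eq₀ hn0.ne'] at h1
    rw [← h1, subordConst, Real.rpow_sub_one hn0.ne']
    field_simp
  rw [← hval, ofReal_integral_eq_lintegral_ofReal hint]
  filter_upwards [ae_restrict_mem measurableSet_Ioi] with l hl
  have := Real.rpow_pos_of_pos hl (α - 1)
  show (0 : ℝ) ≤ _
  simp only [hg]
  positivity

lemma ofReal_resolventForm (l : ℝ) {u : Torus → ℝ} (hu : MemLp u 2 volume) :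
    ENNReal.ofReal (resolventForm l u) =
      ∑' n : ℤ, ENNReal.ofReal ((n : ℝ) ^ 2 / (l ^ 2 + (n : ℝ) ^ 2) * ‖coeff u n‖ ^ 2) :=
  ENNReal.ofReal_tsum_of_nonneg (fun n => by positivity) (summable_resolventForm l hu)

lemma measurable_resolventForm {u : Torus → ℝ} (hu : MemLp u 2 volume) :
    Measurable fun l => ENNReal.ofReal (resolventForm l u) := by
  simp_rw [ofReal_resolventForm _ hu]
  refine Measurable.tsum fun n => ?_
  fun_prop

/-- For `0 < α < 2` the quadratic form `∑ |n|^α |u_n|²` is a mixture of resolvent forms. -/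
lemma lintegral_resolventForm {α : ℝ} (h0 : 0 < α) (h2 : α < 2) {u : Torus → ℝ}
    (hu : MemLp u 2 volume) :
    ∫⁻ l in Set.Ioi (0 : ℝ), ENNReal.ofReal (l ^ (α - 1)) * ENNReal.ofReal (resolventForm l u) =
      ENNReal.ofReal (subordConst α) *
        ∑' n : ℤ, ENNReal.ofReal (|(n : ℝ)| ^ α * ‖coeff u n‖ ^ 2) := by
  simp_rw [ofReal_resolventForm _ hu]
  simp_rw [← ENNReal.tsum_mul_left]
  rw [lintegral_tsum fun n => by fun_prop]
  congr 1; ext n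
  have hC := (subordConst_pos h0 h2).le
  calc ∫⁻ l in Set.Ioi (0 : ℝ), ENNReal.ofReal (l ^ (α - 1)) *
        ENNReal.ofReal ((n : ℝ) ^ 2 / (l ^ 2 + (n : ℝ) ^ 2) * ‖coeff u n‖ ^ 2)
      = ∫⁻ l in Set.Ioi (0 : ℝ), ENNReal.ofReal (l ^ (α - 1) *
          ((n : ℝ) ^ 2 / (l ^ 2 + (n : ℝ) ^ 2))) * ENNReal.ofReal (‖coeff u n‖ ^ 2) := by
        refine setLIntegral_congr_fun measurableSet_Ioi fun l hl => ?_
        have := Real.rpow_nonneg (le_of_lt hl) (α - 1)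
        rw [← ENNReal.ofReal_mul this, ← ENNReal.ofReal_mul (by positivity), mul_assoc]
    _ = _ := by
        rw [lintegral_mul_const _ (by fun_prop), lintegral_subord h0 h2,
          ← ENNReal.ofReal_mul (by positivity), ← ENNReal.ofReal_mul hC, mul_assoc]

lemma summable_quad_iff {α : ℝ} {u : Torus → ℝ} :
    (Summable fun n : ℤ => |(n : ℝ)| ^ α * ‖coeff u n‖ ^ 2) ↔
      ∑' n : ℤ, ENNReal.ofReal (|(n : ℝ)| ^ α * ‖coeff u n‖ ^ 2) ≠ ⊤ := by
  refine ⟨fun h => h.tsum_ofReal_ne_top, fun h => ?_⟩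
  refine (ENNReal.summable_toReal h).congr fun n => ?_
  rw [ENNReal.toReal_ofReal (by positivity)]

lemma sq_mul_resolventForm_le {u : Torus → ℝ} (hu : MemSobolev (2 / 2) u) (l : ℝ) :
    l ^ 2 * resolventForm l u ≤ quadForm 2 u := by
  unfold resolventForm quadForm
  rw [← tsum_mul_left]
  refine ((summable_resolventForm l hu.1).mul_left _).tsum_le_tsum (fun n => ?_)
    (hu.summable_quad zero_le_two)
  rw [← mul_assoc, Real.rpow_two, sq_abs]
  gcongr
  rw [mul_div_assoc', mul_comm, mul_div_assoc]
  exact mul_le_of_le_one_right (sq_nonneg _)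
    (div_le_one_of_le₀ (by nlinarith [sq_nonneg (n : ℝ)]) (by positivity))

/-- Domination of all resolvent forms implies domination of the fractional forms of order at most
two. The case `α = 2` is the limit of `l² n² / (l² + n²)` as `l → ∞`. -/
lemma quadForm_le_of_resolventForm_le {α : ℝ} (h0 : 0 < α) (h2 : α ≤ 2) {u v : Torus → ℝ}
    (hu : MemLp u 2 volume) (hv : MemSobolev (α / 2) v)
    (h : ∀ l, 0 < l → resolventForm l u ≤ resolventForm l v) :
    MemSobolev (α / 2) u ∧ quadForm α u ≤ quadForm α v := by
  rcases h2.lt_or_eq with h2 | rfl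
  · have hC := subordConst_pos h0 h2
    have h1 := lintegral_resolventForm h0 h2 hu
    have h3 := lintegral_resolventForm h0 h2 hv.1
    have h4 : ENNReal.ofReal (subordConst α) *
        ∑' n : ℤ, ENNReal.ofReal (|(n : ℝ)| ^ α * ‖coeff u n‖ ^ 2) ≤
        ENNReal.ofReal (subordConst α) *
        ∑' n : ℤ, ENNReal.ofReal (|(n : ℝ)| ^ α * ‖coeff v n‖ ^ 2) := by
      rw [← h1, ← h3]
      refine setLIntegral_mono' measurableSet_Ioi fun l hl => ?_
      gcongr
      exact h l hl
    rw [ENNReal.mul_le_mul_iff_right (by simpa using hC) ENNReal.ofReal_ne_top] at h4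
    have hvs := hv.summable_quad h0.le
    have hus : Summable fun n : ℤ => |(n : ℝ)| ^ α * ‖coeff u n‖ ^ 2 :=
      summable_quad_iff.2 (ne_top_of_le_ne_top (summable_quad_iff.1 hvs) h4)
    refine ⟨memSobolev_of_summable h0.le hu hus, ?_⟩
    rw [← ENNReal.ofReal_tsum_of_nonneg (fun n => by positivity) hus,
      ← ENNReal.ofReal_tsum_of_nonneg (fun n => by positivity) hvs,
      ENNReal.ofReal_le_ofReal_iff (tsum_nonneg fun n => by positivity)] at h4
    exact h4
  · have hF : ∀ F : Finset ℤ, ∑ n ∈ F, |(n : ℝ)| ^ (2 : ℝ) * ‖coeff u n‖ ^ 2 ≤ quadForm 2 v := by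
      intro F
      have hlim : Tendsto (fun l : ℝ => ∑ n ∈ F, l ^ 2 * ((n : ℝ) ^ 2 / (l ^ 2 + (n : ℝ) ^ 2) *
          ‖coeff u n‖ ^ 2)) atTop (𝓝 (∑ n ∈ F, |(n : ℝ)| ^ (2 : ℝ) * ‖coeff u n‖ ^ 2)) := by
        refine tendsto_finsetSum F fun n _ => ?_
        have h1 : Tendsto (fun l : ℝ => 1 - (n : ℝ) ^ 2 / (l ^ 2 + (n : ℝ) ^ 2)) atTop (𝓝 (1 - 0)) :=
          (tendsto_const_nhds.div_atTop (tendsto_atTop_add_const_right _ _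
            (tendsto_pow_atTop two_ne_zero))).const_sub 1
        have h3 := (h1.const_mul ((n : ℝ) ^ 2)).mul_const (‖coeff u n‖ ^ 2)
        rw [sub_zero, mul_one] at h3
        rw [Real.rpow_two, sq_abs]
        refine h3.congr' ?_
        filter_upwards [eventually_gt_atTop 0] with l hl
        have : l ^ 2 + (n : ℝ) ^ 2 ≠ 0 := by positivity
        field_simp
        ring
      refine le_of_tendsto hlim ?_
      filter_upwards [eventually_gt_atTop 0] with l hl
      calc _ = l ^ 2 * ∑ n ∈ F, (n : ℝ) ^ 2 / (l ^ 2 + (n : ℝ) ^ 2) * ‖coeff u n‖ ^ 2 := by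
            rw [Finset.mul_sum]
        _ ≤ l ^ 2 * resolventForm l u := by
            gcongr
            exact (summable_resolventForm l hu).sum_le_tsum F fun n _ => by positivity
        _ ≤ l ^ 2 * resolventForm l v := by gcongr; exact h l hl
        _ ≤ _ := sq_mul_resolventForm_le hv l
    have hus : Summable fun n : ℤ => |(n : ℝ)| ^ (2 : ℝ) * ‖coeff u n‖ ^ 2 :=
      summable_of_sum_le (fun n => by positivity) hF
    exact ⟨memSobolev_of_summable h0.le hu hus, hus.tsum_le_of_sum_le hF⟩

lemma quadForm_lt_of_resolventForm_lt {α : ℝ} (h0 : 0 < α) (h2 : α < 2) {u v : Torus → ℝ}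
    (hu : MemLp u 2 volume) (hv : MemSobolev (α / 2) v)
    (h : ∀ l, 0 < l → resolventForm l u < resolventForm l v) :
    quadForm α u < quadForm α v := by
  have hu' := (quadForm_le_of_resolventForm_le h0 h2.le hu hv fun l hl => (h l hl).le).1
  have hC := subordConst_pos h0 h2
  have h1 := lintegral_resolventForm h0 h2 hu
  have h3 := lintegral_resolventForm h0 h2 hv.1
  have hus := hu'.summable_quad h0.le
  have hvs := hv.summable_quad h0.le
  have h4 : ∫⁻ l in Set.Ioi (0 : ℝ), ENNReal.ofReal (l ^ (α - 1)) *
      ENNReal.ofReal (resolventForm l u) < ∫⁻ l in Set.Ioi (0 : ℝ), ENNReal.ofReal (l ^ (α - 1)) *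
      ENNReal.ofReal (resolventForm l v) := by
    refine lintegral_strict_mono ?_ ?_ ?_ ?_
    · rw [Ne, Measure.restrict_eq_zero]; simp
    · exact ((by fun_prop : Measurable fun l : ℝ => ENNReal.ofReal (l ^ (α - 1))).mul
        (measurable_resolventForm hv.1)).aemeasurable
    · rw [h1]
      exact ENNReal.mul_ne_top ENNReal.ofReal_ne_top (summable_quad_iff.1 hus)
    · filter_upwards [ae_restrict_mem measurableSet_Ioi] with l hl
      have h5 := Real.rpow_pos_of_pos hl (α - 1)
      rw [ENNReal.mul_lt_mul_iff_right (by simpa using h5) ENNReal.ofReal_ne_top]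
      exact (ENNReal.ofReal_lt_ofReal_iff_of_nonneg (tsum_nonneg fun n => by positivity)).2 (h l hl)
  rw [h1, h3, ENNReal.mul_lt_mul_iff_right (by simpa using hC) ENNReal.ofReal_ne_top,
    ← ENNReal.ofReal_tsum_of_nonneg (fun n => by positivity) hus,
    ← ENNReal.ofReal_tsum_of_nonneg (fun n => by positivity) hvs,
    ENNReal.ofReal_lt_ofReal_iff_of_nonneg (tsum_nonneg fun n => by positivity)] at h4
  exact h4

/-! ### The resolvent kernel -/

lemma cosT_coe (n : ℤ) (t : ℝ) : cosT n (t : Torus) = Real.cos (n * t) := by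
  have hpi : (Real.pi : ℂ) ≠ 0 := by exact_mod_cast Real.pi_ne_zero
  have e : (fourier n (t : Torus) : ℂ) = Complex.exp (((n * t : ℝ) : ℂ) * Complex.I) := by
    rw [fourier_coe_apply]
    congr 1
    push_cast
    field_simp
  rw [cosT, e, Complex.exp_ofReal_mul_I_re]

lemma sinT_coe (n : ℤ) (t : ℝ) : sinT n (t : Torus) = Real.sin (n * t) := by
  have hpi : (Real.pi : ℂ) ≠ 0 := by exact_mod_cast Real.pi_ne_zero
  have e : (fourier n (t : Torus) : ℂ) = Complex.exp (((n * t : ℝ) : ℂ) * Complex.I) := by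
    rw [fourier_coe_apply]
    congr 1
    push_cast
    field_simp
  rw [sinT, e, Complex.exp_ofReal_mul_I_im]

/-- The kernel `cosh (l (π - ‖θ‖))`, a multiple of the Green function of `l² - d²/dx²` on the
circle; `‖θ‖` is the distance from `θ` to `0`. -/
def resolventKernel (l : ℝ) (θ : Torus) : ℝ := Real.cosh (l * (Real.pi - ‖θ‖))

lemma continuous_resolventKernel (l : ℝ) : Continuous (resolventKernel l) := by
  unfold resolventKernel
  fun_prop

lemma resolventKernel_neg (l : ℝ) (θ : Torus) : resolventKernel l (-θ) = resolventKernel l θ := by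
  rw [resolventKernel, norm_neg, resolventKernel]

lemma norm_coe_torus {t : ℝ} (ht : |t| ≤ Real.pi) : ‖(t : Torus)‖ = |t| := by
  rw [AddCircle.norm_coe_eq_abs_iff _ Real.two_pi_pos.ne', abs_of_pos Real.two_pi_pos]
  linarith

lemma resolventKernel_coe (l : ℝ) {t : ℝ} (ht : t ∈ Set.Icc 0 (2 * Real.pi)) :
    resolventKernel l (t : Torus) = Real.cosh (l * (Real.pi - t)) := by
  rcases le_total t Real.pi with h | h
  · rw [resolventKernel, norm_coe_torus (by rw [abs_of_nonneg ht.1]; exact h), abs_of_nonneg ht.1]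
  · have e : (t : Torus) = ((t - 2 * Real.pi : ℝ) : Torus) := by
      rw [AddCircle.coe_sub, AddCircle.coe_period, sub_zero]
    have h1 : |t - 2 * Real.pi| = 2 * Real.pi - t := by
      rw [abs_of_nonpos (by linarith [ht.2])]; ring
    rw [resolventKernel, e, norm_coe_torus (by rw [h1]; linarith), h1, ← Real.cosh_neg]
    congr 1; ring

lemma integral_resolventKernel_mul_cosT {l : ℝ} (hl : 0 < l) (n : ℤ) :
    ∫ θ, resolventKernel l θ * cosT n θ
      = 2 * l * Real.sinh (l * Real.pi) / (l ^ 2 + (n : ℝ) ^ 2) := by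
  have hden : l ^ 2 + (n : ℝ) ^ 2 ≠ 0 := by positivity
  rw [← AddCircle.intervalIntegral_preimage (2 * Real.pi) 0, zero_add]
  have h1 : ∫ t in (0 : ℝ)..2 * Real.pi, resolventKernel l (t : Torus) * cosT n (t : Torus)
      = ∫ t in (0 : ℝ)..2 * Real.pi, Real.cosh (l * (Real.pi - t)) * Real.cos (n * t) := by
    refine intervalIntegral.integral_congr fun t ht => ?_
    rw [Set.uIcc_of_le Real.two_pi_pos.le] at ht
    show resolventKernel l (t : Torus) * cosT n (t : Torus) = _
    rw [resolventKernel_coe l ht, cosT_coe]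
  rw [h1, intervalIntegral.integral_eq_sub_of_hasDerivAt
    (f := fun t => (-l * Real.sinh (l * (Real.pi - t)) * Real.cos (n * t) +
      n * Real.cosh (l * (Real.pi - t)) * Real.sin (n * t)) / (l ^ 2 + (n : ℝ) ^ 2))]
  · have e1 : Real.cos (n * (2 * Real.pi)) = 1 := Real.cos_int_mul_two_pi n
    have e2 : Real.sin (n * (2 * Real.pi)) = 0 := by
      have := Real.sin_int_mul_pi (2 * n)
      push_cast at this
      rw [← this]; ring_nf
    have e3 : l * (Real.pi - 2 * Real.pi) = -(l * Real.pi) := by ring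
    rw [e1, e2, e3, Real.sinh_neg]
    simp
    ring
  · intro t _
    have hA : HasDerivAt (fun t : ℝ => l * (Real.pi - t)) (-l) t := by
      simpa using ((hasDerivAt_id t).const_sub Real.pi).const_mul l
    have hB : HasDerivAt (fun t : ℝ => (n : ℝ) * t) n t := by
      simpa using (hasDerivAt_id t).const_mul (n : ℝ)
    have h := ((((hA.sinh).const_mul (-l)).mul hB.cos).add
      (((hA.cosh).const_mul (n : ℝ)).mul hB.sin)).div_const (l ^ 2 + (n : ℝ) ^ 2)
    refine h.congr_deriv ?_
    rw [div_eq_iff hden]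
    ring
  · exact Continuous.intervalIntegrable (by fun_prop) _ _

lemma integrable_continuous {f : Torus → ℝ} (hf : Continuous f) : Integrable f volume :=
  (memLp_of_continuous hf 1).integrable le_rfl

lemma integrable_continuous_prod {f : Torus × Torus → ℝ} (hf : Continuous f) :
    Integrable f ((volume : Measure Torus).prod volume) := by
  obtain ⟨M, hM⟩ := isCompact_univ.exists_bound_of_continuousOn hf.continuousOn
  exact (memLp_top_of_bound hf.aestronglyMeasurable M
    (Eventually.of_forall fun x => hM x trivial)).integrable le_top

/-- The Dirichlet form of the resolvent kernel. -/
def kernelForm (l : ℝ) (u : Torus → ℝ) : ℝ :=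
  ∫ x, ∫ y, resolventKernel l (x - y) * (u x - u y) ^ 2

lemma normSq_fourier_sub_one (n : ℤ) (h : Torus) :
    ‖(fourier n h : ℂ) - 1‖ ^ 2 = 2 - 2 * cosT n h := by
  have h1 : ‖(fourier n h : ℂ)‖ ^ 2 = 1 := by rw [fourier_apply, Circle.norm_coe, one_pow]
  rw [← Complex.normSq_eq_norm_sq, Complex.normSq_apply] at h1 ⊢
  simp only [Complex.sub_re, Complex.one_re, Complex.sub_im, Complex.one_im, sub_zero, cosT]
  linarith

lemma hasSum_translate_sub {u : Torus → ℝ} (hu : MemLp u 2 volume) (h : Torus)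
    (hu' : MemLp (fun x => u (x + h)) 2 volume) :
    HasSum (fun n => (2 - 2 * cosT n h) * ‖coeff u n‖ ^ 2)
      ((2 * Real.pi)⁻¹ * ∫ x, (u (x + h) - u x) ^ 2) := by
  have h1 : MemLp (fun x => u (x + h) - u x) 2 volume := hu'.sub hu
  refine (hasSum_norm_coeff_sq h1).congr_fun fun n => ?_
  rw [coeff_sub (hu'.integrable (by norm_num)) (hu.integrable (by norm_num)),
    coeff_comp_add_right, ← sub_one_mul, norm_mul, mul_pow, normSq_fourier_sub_one]

/-- The kernel form is a multiple of the resolvent form: integrate Parseval's identity for the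
translates `u (· + h) - u` against the kernel. -/
lemma kernelForm_eq {l : ℝ} (hl : 0 < l) {u : Torus → ℝ} (hu : Continuous u) :
    kernelForm l u = 8 * Real.pi * Real.sinh (l * Real.pi) / l * resolventForm l u := by
  have hpi := Real.pi_pos
  have hK := continuous_resolventKernel l
  have hu2 := memLp_of_continuous hu 2
  have e1 : kernelForm l u = ∫ h, ∫ x, resolventKernel l h * (u (x + h) - u x) ^ 2 := by
    unfold kernelForm
    rw [integral_integral_swap]
    · rw [← integral_integral_swap (f := fun x h => resolventKernel l h * (u (x + h) - u x) ^ 2)]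
      · congr 1; ext y
        rw [← integral_add_right_eq_self _ y]
        congr 1; ext h
        rw [add_sub_cancel_right, add_comm h y]
      · exact integrable_continuous_prod (by simp only [Function.uncurry_def]; fun_prop)
    · exact integrable_continuous_prod (by simp only [Function.uncurry_def]; fun_prop)
  have e2 : ∀ h, ∫ x, resolventKernel l h * (u (x + h) - u x) ^ 2
      = ∑' n, 2 * Real.pi * (resolventKernel l h * (2 - 2 * cosT n h) * ‖coeff u n‖ ^ 2) := by
    intro h
    have h1 := (hasSum_translate_sub hu2 h (memLp_of_continuous (by fun_prop) 2)).mul_left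
      (2 * Real.pi * resolventKernel l h)
    rw [integral_const_mul]
    refine Eq.trans ?_ (h1.congr_fun fun n => ?_).tsum_eq.symm
    · field_simp
    · ring
  have hcos : ∀ n : ℤ, ∫ h, resolventKernel l h * (2 - 2 * cosT n h)
      = 4 * Real.sinh (l * Real.pi) / l * ((n : ℝ) ^ 2 / (l ^ 2 + (n : ℝ) ^ 2)) := by
    intro n
    have i0 := integral_resolventKernel_mul_cosT hl 0
    have i1 := integral_resolventKernel_mul_cosT hl n
    have c0 : ∀ h : Torus, cosT 0 h = 1 := fun h => by rw [cosT, fourier_zero, Complex.one_re]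
    have e : ∀ h, resolventKernel l h * (2 - 2 * cosT n h)
        = 2 * (resolventKernel l h * cosT 0 h) - 2 * (resolventKernel l h * cosT n h) := by
      intro h; rw [c0]; ring
    have hc : ∀ k, Integrable (fun h => 2 * (resolventKernel l h * cosT k h)) volume := fun k =>
      integrable_continuous (continuous_const.mul (hK.mul (continuous_cosT k)))
    simp_rw [e]
    rw [integral_sub (hc 0) (hc n), integral_const_mul, integral_const_mul, i0, i1]
    have hden : l ^ 2 + (n : ℝ) ^ 2 ≠ 0 := by positivity
    push_cast
    field_simp
    ring
  obtain ⟨M, hM⟩ := isCompact_univ.exists_bound_of_continuousOn hK.continuousOn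
  have hcosle : ∀ (n : ℤ) (h : Torus), ‖2 - 2 * cosT n h‖ ≤ 4 := by
    intro n h
    have h1 : |cosT n h| ≤ 1 := by
      refine (Complex.abs_re_le_norm _).trans ?_
      rw [fourier_apply, Circle.norm_coe]
    rw [abs_le] at h1
    rw [Real.norm_eq_abs, abs_le]
    constructor <;> linarith
  have h3 := hasSum_integral_of_dominated_convergence (μ := (volume : Measure Torus))
    (F := fun n h => 2 * Real.pi * (resolventKernel l h * (2 - 2 * cosT n h) * ‖coeff u n‖ ^ 2))
    (f := fun h => ∑' n, 2 * Real.pi *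
      (resolventKernel l h * (2 - 2 * cosT n h) * ‖coeff u n‖ ^ 2))
    (fun n _ => 2 * Real.pi * (M * 4 * ‖coeff u n‖ ^ 2))
    (fun n => by
      have := continuous_cosT n
      exact (by fun_prop : Continuous fun h => 2 * Real.pi * (resolventKernel l h *
        (2 - 2 * cosT n h) * ‖coeff u n‖ ^ 2)).aestronglyMeasurable)
    (fun n => Eventually.of_forall fun h => by
      rw [norm_mul (2 * Real.pi), norm_mul (_ * _) (_ ^ 2), norm_mul (resolventKernel l h),
        Real.norm_of_nonneg Real.two_pi_pos.le,
        Real.norm_of_nonneg (sq_nonneg (‖coeff u n‖))]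
      gcongr
      · exact (norm_nonneg _).trans (hM h trivial)
      · exact hM h trivial
      · exact hcosle n h)
    (Eventually.of_forall fun h =>
      ((hasSum_norm_coeff_sq hu2).summable.mul_left (M * 4)).mul_left _)
    (integrable_const _)
    (Eventually.of_forall fun h => by
      have h1 := (hasSum_translate_sub hu2 h (memLp_of_continuous (by fun_prop) 2)).mul_left
        (2 * Real.pi * resolventKernel l h)
      refine (h1.summable.congr fun n => ?_).hasSum
      ring)
  rw [e1]
  simp_rw [e2]
  rw [← h3.tsum_eq, resolventForm, ← tsum_mul_left]
  congr 1; ext n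
  rw [integral_const_mul, integral_mul_const, hcos]
  ring

/-! ### Polarization -/

lemma exists_coe_eq (θ : Torus) : ∃ t : ℝ, -Real.pi < t ∧ t ≤ Real.pi ∧ (t : Torus) = θ := by
  have h := AddCircle.coe_image_Ioc_eq (2 * Real.pi) (-Real.pi)
  have h2 : θ ∈ ((↑) : ℝ → Torus) '' Set.Ioc (-Real.pi) (-Real.pi + 2 * Real.pi) := by
    rw [h]; trivial
  obtain ⟨t, ht, rfl⟩ := h2
  exact ⟨t, ht.1, by linarith [ht.2], rfl⟩

lemma sinT_one_coe (t : ℝ) : sinT 1 (t : Torus) = Real.sin t := by rw [sinT_coe]; simp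

lemma cosT_one_coe (t : ℝ) : cosT 1 (t : Torus) = Real.cos t := by rw [cosT_coe]; simp

lemma sinT_one_neg (x : Torus) : sinT 1 (-x) = -sinT 1 x := by
  obtain ⟨t, -, -, rfl⟩ := exists_coe_eq x
  rw [← AddCircle.coe_neg, sinT_one_coe, sinT_one_coe, Real.sin_neg]

lemma cosT_sub_cosT (x y : Torus) :
    cosT 1 (x - y) - cosT 1 (x + y) = 2 * (sinT 1 x * sinT 1 y) := by
  obtain ⟨s, -, -, rfl⟩ := exists_coe_eq x
  obtain ⟨t, -, -, rfl⟩ := exists_coe_eq y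
  rw [← AddCircle.coe_sub, ← AddCircle.coe_add, cosT_one_coe, cosT_one_coe, sinT_one_coe,
    sinT_one_coe, Real.cos_sub, Real.cos_add]
  ring

lemma cosT_eq_cos_norm (θ : Torus) : cosT 1 θ = Real.cos ‖θ‖ := by
  obtain ⟨t, h1, h2, rfl⟩ := exists_coe_eq θ
  rw [cosT_one_coe, norm_coe_torus (abs_le.2 ⟨h1.le, h2⟩), Real.cos_abs]

lemma norm_le_pi (θ : Torus) : ‖θ‖ ≤ Real.pi := by
  obtain ⟨t, h1, h2, rfl⟩ := exists_coe_eq θ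
  rw [norm_coe_torus (abs_le.2 ⟨h1.le, h2⟩)]
  exact abs_le.2 ⟨h1.le, h2⟩

lemma neg_eq_self_of_sinT_eq_zero {x : Torus} (h : sinT 1 x = 0) : -x = x := by
  obtain ⟨t, h1, h2, rfl⟩ := exists_coe_eq x
  rw [sinT_one_coe] at h
  rcases h2.lt_or_eq with h2 | rfl
  · rw [(Real.sin_eq_zero_iff_of_lt_of_lt h1 h2).1 h]; simp
  · rw [← AddCircle.coe_neg, ← sub_eq_zero, ← AddCircle.coe_sub]
    have : -Real.pi - Real.pi = -(2 * Real.pi) := by ring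
    rw [this, AddCircle.coe_neg, AddCircle.coe_period, neg_zero]

lemma resolventKernel_le {l : ℝ} (hl : 0 < l) {θ θ' : Torus} (h : cosT 1 θ' ≤ cosT 1 θ) :
    resolventKernel l θ' ≤ resolventKernel l θ := by
  rw [cosT_eq_cos_norm, cosT_eq_cos_norm, Real.strictAntiOn_cos.le_iff_ge ⟨norm_nonneg _,
    norm_le_pi _⟩ ⟨norm_nonneg _, norm_le_pi _⟩] at h
  have h1 := norm_le_pi θ'
  unfold resolventKernel
  rw [Real.cosh_le_cosh, abs_of_nonneg (mul_nonneg hl.le (by linarith)),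
    abs_of_nonneg (mul_nonneg hl.le (by linarith))]
  gcongr

lemma resolventKernel_lt {l : ℝ} (hl : 0 < l) {θ θ' : Torus} (h : cosT 1 θ' < cosT 1 θ) :
    resolventKernel l θ' < resolventKernel l θ := by
  rw [cosT_eq_cos_norm, cosT_eq_cos_norm, Real.strictAntiOn_cos.lt_iff_gt ⟨norm_nonneg _,
    norm_le_pi _⟩ ⟨norm_nonneg _, norm_le_pi _⟩] at h
  have h1 := norm_le_pi θ'
  unfold resolventKernel
  rw [Real.cosh_lt_cosh, abs_of_nonneg (mul_nonneg hl.le (by linarith)),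
    abs_of_nonneg (mul_nonneg hl.le (by linarith))]
  gcongr

/-- The polarization (two-point rearrangement) of `u` with respect to the reflection `x ↦ -x`: the
larger of the two values is placed in the half circle `sin ≥ 0`. -/
def polar (u : Torus → ℝ) (x : Torus) : ℝ :=
  if 0 ≤ sinT 1 x then max (u x) (u (-x)) else min (u x) (u (-x))

lemma continuous_polar {u : Torus → ℝ} (hu : Continuous u) : Continuous (polar u) := by
  refine Continuous.if_le (by fun_prop) (by fun_prop) continuous_const (continuous_sinT 1)
    fun x hx => ?_
  rw [neg_eq_self_of_sinT_eq_zero hx.symm]; simp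

lemma polar_cases (u : Torus → ℝ) (x : Torus) :
    (0 ≤ sinT 1 x ∧ polar u x = max (u x) (u (-x)) ∧ polar u (-x) = min (u x) (u (-x))) ∨
    (sinT 1 x < 0 ∧ polar u x = min (u x) (u (-x)) ∧ polar u (-x) = max (u x) (u (-x))) := by
  have hs := sinT_one_neg x
  rcases lt_trichotomy (sinT 1 x) 0 with h | h | h
  · right
    refine ⟨h, if_neg (by linarith), ?_⟩
    rw [polar, if_pos (by linarith), neg_neg, max_comm]
  · left
    have hx := neg_eq_self_of_sinT_eq_zero h
    refine ⟨h.ge, if_pos h.ge, ?_⟩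
    rw [polar, if_pos (by linarith), neg_neg, hx]; simp
  · left
    refine ⟨h.le, if_pos h.le, ?_⟩
    rw [polar, if_neg (by linarith), neg_neg, min_comm]

lemma polar_add_polar_neg (f : ℝ → ℝ) (u : Torus → ℝ) (x : Torus) :
    f (polar u x) + f (polar u (-x)) = f (u x) + f (u (-x)) := by
  rcases polar_cases u x with ⟨-, h1, h2⟩ | ⟨-, h1, h2⟩ <;> rw [h1, h2] <;>
    rcases le_total (u x) (u (-x)) with h | h <;> simp [h, add_comm]

/-- Polarization is equimeasurable. -/
lemma integral_comp_polar {f : ℝ → ℝ} (hf : Continuous f) {u : Torus → ℝ} (hu : Continuous u) :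
    ∫ x, f (polar u x) = ∫ x, f (u x) := by
  have hp := continuous_polar hu
  have key : ∀ v : Torus → ℝ, Continuous v →
      2 * ∫ x, f (v x) = ∫ x, (f (v x) + f (v (-x))) := by
    intro v hv
    rw [integral_add (integrable_continuous (by fun_prop)) (integrable_continuous (by fun_prop)),
      integral_neg_eq_self (fun x => f (v x)), two_mul]
  have h1 := key _ hp
  simp_rw [polar_add_polar_neg] at h1
  rw [← key u hu] at h1
  linarith

/-- The kernel form as an integral over the square, symmetrised under both reflections. -/
lemma four_mul_kernelForm (l : ℝ) {u : Torus → ℝ} (hu : Continuous u) :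
    4 * kernelForm l u = ∫ z : Torus × Torus,
      (resolventKernel l (z.1 - z.2) * ((u z.1 - u z.2) ^ 2 + (u (-z.1) - u (-z.2)) ^ 2) +
      resolventKernel l (z.1 + z.2) * ((u z.1 - u (-z.2)) ^ 2 + (u (-z.1) - u z.2) ^ 2))
        ∂((volume : Measure Torus).prod volume) := by
  have hK := continuous_resolventKernel l
  have hF : Continuous fun z : Torus × Torus =>
      resolventKernel l (z.1 - z.2) * (u z.1 - u z.2) ^ 2 := by fun_prop
  set F : Torus × Torus → ℝ := fun z => resolventKernel l (z.1 - z.2) * (u z.1 - u z.2) ^ 2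
    with hFdef
  have h0 : kernelForm l u = ∫ z, F z ∂((volume : Measure Torus).prod volume) := by
    rw [integral_prod _ (integrable_continuous_prod hF)]; rfl
  have h1 : ∫ z, F z ∂((volume : Measure Torus).prod volume)
      = ∫ z : Torus × Torus, F (-z.1, z.2) ∂((volume : Measure Torus).prod volume) := by
    rw [integral_prod _ (integrable_continuous_prod hF),
      integral_prod _ (integrable_continuous_prod (by fun_prop)),
      ← integral_neg_eq_self (fun x => ∫ y, F (x, y))]
  have h2 : ∫ z, F z ∂((volume : Measure Torus).prod volume)
      = ∫ z : Torus × Torus, F (z.1, -z.2) ∂((volume : Measure Torus).prod volume) := by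
    rw [integral_prod _ (integrable_continuous_prod hF),
      integral_prod _ (integrable_continuous_prod (by fun_prop))]
    congr 1; ext x
    rw [← integral_neg_eq_self (fun y => F (x, y))]
  have h3 : ∫ z, F z ∂((volume : Measure Torus).prod volume)
      = ∫ z : Torus × Torus, F (-z.1, -z.2) ∂((volume : Measure Torus).prod volume) := by
    rw [h1, integral_prod _ (integrable_continuous_prod (by fun_prop)),
      integral_prod _ (integrable_continuous_prod (by fun_prop))]
    congr 1; ext x
    rw [← integral_neg_eq_self (fun y => F (-x, y))]
  have h4 : 4 * kernelForm l u = (∫ z, F z ∂((volume : Measure Torus).prod volume)) +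
      (∫ z : Torus × Torus, F (-z.1, z.2) ∂((volume : Measure Torus).prod volume)) +
      (∫ z : Torus × Torus, F (z.1, -z.2) ∂((volume : Measure Torus).prod volume)) +
      ∫ z : Torus × Torus, F (-z.1, -z.2) ∂((volume : Measure Torus).prod volume) := by
    rw [← h1, ← h2, ← h3, h0]; ring
  rw [h4, ← integral_add (integrable_continuous_prod (by fun_prop))
    (integrable_continuous_prod (by fun_prop)), ← integral_add (integrable_continuous_prod
    (by fun_prop)) (integrable_continuous_prod (by fun_prop)), ← integral_add
    (integrable_continuous_prod (by fun_prop)) (integrable_continuous_prod (by fun_prop))]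
  congr 1; ext z
  have e1 : resolventKernel l (-z.1 - z.2) = resolventKernel l (z.1 + z.2) := by
    rw [← resolventKernel_neg]; congr 1; abel
  have e2 : resolventKernel l (-z.1 - -z.2) = resolventKernel l (z.1 - z.2) := by
    rw [← resolventKernel_neg]; congr 1; abel
  simp only [hFdef]
  rw [e1, e2, sub_neg_eq_add]
  ring

/-- The change of the symmetrised integrand under polarization. -/
def polarGain (l : ℝ) (u : Torus → ℝ) (z : Torus × Torus) : ℝ :=
  (resolventKernel l (z.1 - z.2) - resolventKernel l (z.1 + z.2)) *
    ((polar u z.1 - polar u (-z.1)) * (polar u z.2 - polar u (-z.2)) -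
      (u z.1 - u (-z.1)) * (u z.2 - u (-z.2)))

lemma continuous_polarGain (l : ℝ) {u : Torus → ℝ} (hu : Continuous u) :
    Continuous (polarGain l u) := by
  have hK := continuous_resolventKernel l
  have hp := continuous_polar hu
  unfold polarGain
  fun_prop

lemma kernelForm_sub_polar (l : ℝ) {u : Torus → ℝ} (hu : Continuous u) :
    4 * kernelForm l u - 4 * kernelForm l (polar u)
      = ∫ z, polarGain l u z ∂((volume : Measure Torus).prod volume) := by
  have hK := continuous_resolventKernel l
  have hp := continuous_polar hu
  rw [four_mul_kernelForm l hu, four_mul_kernelForm l hp, ← integral_sub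
    (integrable_continuous_prod (by fun_prop)) (integrable_continuous_prod (by fun_prop))]
  congr 1; ext z
  have a1 := polar_add_polar_neg id u z.1
  have a2 := polar_add_polar_neg id u z.2
  have b1 := polar_add_polar_neg (fun t => t ^ 2) u z.1
  have b2 := polar_add_polar_neg (fun t => t ^ 2) u z.2
  simp only [id] at a1 a2 b1 b2
  unfold polarGain
  generalize resolventKernel l (z.1 - z.2) = k1
  generalize resolventKernel l (z.1 + z.2) = k2
  generalize polar u z.1 = p1 at *
  generalize polar u z.2 = p2 at *
  generalize polar u (-z.1) = q1 at *
  generalize polar u (-z.2) = q2 at *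
  have hs : (p1 + q1) * (p2 + q2) = (u z.1 + u (-z.1)) * (u z.2 + u (-z.2)) := by rw [a1, a2]
  linear_combination (-(k1 + k2)) * (b1 + b2) + (k1 + k2) * hs

lemma polarGain_nonneg {l : ℝ} (hl : 0 < l) (u : Torus → ℝ) (z : Torus × Torus) :
    0 ≤ polarGain l u z := by
  obtain ⟨x, y⟩ := z
  have hw : ∀ x, (0 ≤ sinT 1 x ∧ polar u x - polar u (-x) = |u x - u (-x)|) ∨
      (sinT 1 x < 0 ∧ polar u x - polar u (-x) = -|u x - u (-x)|) := by
    intro x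
    rcases polar_cases u x with ⟨h, h1, h2⟩ | ⟨h, h1, h2⟩
    · exact Or.inl ⟨h, by rw [h1, h2, max_sub_min_eq_abs']⟩
    · exact Or.inr ⟨h, by rw [h1, h2, ← neg_sub, max_sub_min_eq_abs']⟩
  have hcos := cosT_sub_cosT x y
  have habs := abs_mul (u x - u (-x)) (u y - u (-y))
  have hle := le_abs_self ((u x - u (-x)) * (u y - u (-y)))
  have hge := neg_abs_le ((u x - u (-x)) * (u y - u (-y)))
  unfold polarGain
  simp only
  rcases hw x with ⟨hx, ex⟩ | ⟨hx, ex⟩ <;> rcases hw y with ⟨hy, ey⟩ | ⟨hy, ey⟩ <;> rw [ex, ey]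
  · have hk := resolventKernel_le hl (θ := x - y) (θ' := x + y) (by nlinarith)
    exact mul_nonneg (by linarith) (by linarith)
  · have hk := resolventKernel_le hl (θ := x + y) (θ' := x - y) (by nlinarith)
    exact mul_nonneg_of_nonpos_of_nonpos (by linarith) (by linarith)
  · have hk := resolventKernel_le hl (θ := x + y) (θ' := x - y) (by nlinarith)
    exact mul_nonneg_of_nonpos_of_nonpos (by linarith) (by linarith)
  · have hk := resolventKernel_le hl (θ := x - y) (θ' := x + y) (by nlinarith)
    exact mul_nonneg (by linarith) (by linarith)

lemma polarGain_pos {l : ℝ} (hl : 0 < l) (u : Torus → ℝ) {x y : Torus} (hx : 0 < sinT 1 x)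
    (hy : 0 < sinT 1 y) (hux : u (-x) < u x) (huy : u y < u (-y)) : 0 < polarGain l u (x, y) := by
  have hk := resolventKernel_lt hl (θ := x - y) (θ' := x + y)
    (by nlinarith [cosT_sub_cosT x y, mul_pos hx hy])
  unfold polarGain
  refine mul_pos (by simpa using hk) ?_
  have h1 : polar u x - polar u (-x) = u x - u (-x) := by
    rcases polar_cases u x with ⟨-, h1, h2⟩ | ⟨h, -⟩
    · rw [h1, h2, max_eq_left hux.le, min_eq_right hux.le]
    · linarith
  have h2 : polar u y - polar u (-y) = u (-y) - u y := by
    rcases polar_cases u y with ⟨-, h1, h2⟩ | ⟨h, -⟩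
    · rw [h1, h2, max_eq_right huy.le, min_eq_left huy.le]
    · linarith
  simp only
  rw [h1, h2]
  nlinarith [mul_pos (sub_pos.2 hux) (sub_pos.2 huy)]

lemma resolventForm_le_of_kernelForm {l : ℝ} (hl : 0 < l) {u v : Torus → ℝ} (hu : Continuous u)
    (hv : Continuous v) (h : kernelForm l u ≤ kernelForm l v) :
    resolventForm l u ≤ resolventForm l v := by
  rw [kernelForm_eq hl hu, kernelForm_eq hl hv] at h
  have h1 : 0 < Real.sinh (l * Real.pi) := Real.sinh_pos_iff.2 (mul_pos hl Real.pi_pos)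
  have := Real.pi_pos
  exact le_of_mul_le_mul_left h (by positivity)

lemma resolventForm_polar_le {l : ℝ} (hl : 0 < l) {u : Torus → ℝ} (hu : Continuous u) :
    resolventForm l (polar u) ≤ resolventForm l u := by
  refine resolventForm_le_of_kernelForm hl (continuous_polar hu) hu ?_
  have h := kernelForm_sub_polar l hu
  have h2 : 0 ≤ ∫ z, polarGain l u z ∂((volume : Measure Torus).prod volume) :=
    integral_nonneg (polarGain_nonneg hl u)
  linarith

lemma resolventForm_polar_lt {l : ℝ} (hl : 0 < l) {u : Torus → ℝ} (hu : Continuous u)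
    {x y : Torus} (hx : 0 < sinT 1 x) (hy : 0 < sinT 1 y) (hux : u (-x) < u x)
    (huy : u y < u (-y)) : resolventForm l (polar u) < resolventForm l u := by
  have h := kernelForm_sub_polar l hu
  have h2 : 0 < ∫ z, polarGain l u z ∂((volume : Measure Torus).prod volume) :=
    (continuous_polarGain l hu).integral_pos_of_hasCompactSupport_nonneg_nonzero
      (HasCompactSupport.of_compactSpace _) (polarGain_nonneg hl u)
      (polarGain_pos hl u hx hy hux huy).ne'
  by_contra hcon
  push Not at hcon
  have h1 : 0 < Real.sinh (l * Real.pi) := Real.sinh_pos_iff.2 (mul_pos hl Real.pi_pos)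
  have h3 : kernelForm l u ≤ kernelForm l (polar u) := by
    rw [kernelForm_eq hl hu, kernelForm_eq hl (continuous_polar hu)]
    have := Real.pi_pos
    gcongr
  linarith

/-- Polarization does not increase the fractional form of order at most two. -/
lemma quadForm_polar_le {α : ℝ} (h0 : 0 < α) (h2 : α ≤ 2) {u : Torus → ℝ} (hu : Continuous u)
    (hS : MemSobolev (α / 2) u) :
    MemSobolev (α / 2) (polar u) ∧ quadForm α (polar u) ≤ quadForm α u :=
  quadForm_le_of_resolventForm_le h0 h2 (memLp_of_continuous (continuous_polar hu) 2) hS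
    fun _ hl => resolventForm_polar_le hl hu

/-- For `α < 2` polarization strictly decreases the fractional form unless `u` or its reflection
dominates on the half circle. -/
lemma quadForm_polar_lt {α : ℝ} (h0 : 0 < α) (h2 : α < 2) {u : Torus → ℝ} (hu : Continuous u)
    (hS : MemSobolev (α / 2) u) {x y : Torus} (hx : 0 < sinT 1 x) (hy : 0 < sinT 1 y)
    (hux : u (-x) < u x) (huy : u y < u (-y)) : quadForm α (polar u) < quadForm α u :=
  quadForm_lt_of_resolventForm_lt h0 h2 (memLp_of_continuous (continuous_polar hu) 2) hS
    fun _ hl => resolventForm_polar_lt hl hu hx hy hux huy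

/-- The polarization of a continuous ground state is a ground state. -/
lemma IsGroundState.polar {α c m : ℝ} (h0 : 0 < α) (h2 : α ≤ 2) {v : Torus → ℝ}
    (hv : Continuous v) (h : IsGroundState α c m v) :
    IsGroundState α c m (polar v) ∧ quadForm α (polar v) = quadForm α v := by
  obtain ⟨hS, hQ⟩ := quadForm_polar_le h0 h2 hv h.1.1
  have hA : FracMKdV.polar v ∈ Admissible α m := by
    refine ⟨hS, ?_, ?_⟩
    · rw [integral_comp_polar (f := fun t => t ^ 4) (by fun_prop) hv]; exact h.1.2.1
    · rw [integral_comp_polar (f := fun t => t) continuous_id hv]; exact h.1.2.2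
  have h1 : energyB α c v ≤ energyB α c (FracMKdV.polar v) := h.2 hA
  have h3 : ∫ x, (FracMKdV.polar v x) ^ 2 = ∫ x, (v x) ^ 2 :=
    integral_comp_polar (f := fun t => t ^ 2) (by fun_prop) hv
  rw [energyB_eq h0.le c h.1.1, energyB_eq h0.le c hS, h3] at h1
  have h4 : quadForm α v ≤ quadForm α (FracMKdV.polar v) := by
    have := Real.pi_pos
    nlinarith
  refine ⟨⟨hA, fun w hw => ?_⟩, le_antisymm hQ h4⟩
  have h5 : energyB α c v ≤ energyB α c w := h.2 hw
  show energyB α c (FracMKdV.polar v) ≤ energyB α c w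
  refine le_trans (le_of_eq ?_) h5
  rw [energyB_eq h0.le c h.1.1, energyB_eq h0.le c hS, h3, le_antisymm hQ h4]

/-! ### Functions ordered by every reflection -/

/-- For every reflection `e + t ↦ e - t` of the line, the function `f` or its reflection dominates
on the half period following `e`. -/
def ReflectionOrdered (f : ℝ → ℝ) : Prop :=
  ∀ e, (∀ t ∈ Set.Ioo 0 Real.pi, f (e - t) ≤ f (e + t)) ∨
    (∀ t ∈ Set.Ioo 0 Real.pi, f (e + t) ≤ f (e - t))

/-- Unique continuation for reflections: local symmetry of `f` about a point is global. -/
def ReflectionRigid (f : ℝ → ℝ) : Prop :=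
  ∀ e, ∀ δ > 0, (∀ t ∈ Set.Ioo 0 δ, f (e + t) = f (e - t)) → ∀ t, f (e + t) = f (e - t)

lemma ReflectionOrdered.neg {f : ℝ → ℝ} (h : ReflectionOrdered f) :
    ReflectionOrdered fun x => -f x := fun e =>
  (h e).symm.imp (fun h t ht => neg_le_neg (h t ht)) fun h t ht => neg_le_neg (h t ht)

lemma ReflectionRigid.neg {f : ℝ → ℝ} (h : ReflectionRigid f) :
    ReflectionRigid fun x => -f x := fun e δ hδ h0 t => by
  have := h e δ hδ (fun s hs => neg_injective (h0 s hs)) t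
  simp only [this]

section

variable {f : ℝ → ℝ}

/-- Ordered, rigid and nonconstant functions have no period `p ≤ π`. -/
lemma not_periodic_of_reflectionOrdered (hS : ReflectionOrdered f) (hP : ReflectionRigid f)
    (hnc : ∃ x y, f x ≠ f y) {p : ℝ} (hp0 : 0 < p) (hp1 : p ≤ Real.pi)
    (hper : Function.Periodic f p) : False := by
  -- the difference of the two branches is antisymmetric about `p / 2`, yet has a constant sign
  have hsymm : ∀ e t, f (e + t) = f (e - t) := by
    intro e
    refine hP e p hp0 fun t ht => ?_
    have e1 : f (e + (p - t)) = f (e - t) := by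
      rw [← hper (e - t)]; congr 1; ring
    have e2 : f (e - (p - t)) = f (e + t) := by
      rw [← hper (e - (p - t))]; congr 1; ring
    have ht1 : t ∈ Set.Ioo 0 Real.pi := ⟨ht.1, ht.2.trans_le hp1⟩
    have ht2 : p - t ∈ Set.Ioo 0 Real.pi := ⟨by linarith [ht.2], by linarith [ht.1]⟩
    rcases hS e with h | h
    · have h1 := h t ht1
      have h2 := h _ ht2
      rw [e1, e2] at h2
      linarith
    · have h1 := h t ht1
      have h2 := h _ ht2
      rw [e1, e2] at h2
      linarith
  obtain ⟨x, y, hxy⟩ := hnc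
  apply hxy
  have := hsymm ((x + y) / 2) ((x - y) / 2)
  ring_nf at this
  exact this

/-- Two centres of symmetry at a distance less than `π` would produce a period smaller than `2π`. -/
lemma eq_of_two_centers (hf : Function.Periodic f (2 * Real.pi)) (hS : ReflectionOrdered f)
    (hP : ReflectionRigid f) (hnc : ∃ x y, f x ≠ f y) {a b : ℝ} (hab : a < b) (hb : b < a + Real.pi)
    (ha : ∀ t, f (a + t) = f (a - t)) (hb' : ∀ t, f (b + t) = f (b - t)) : False := by
  have hper : Function.Periodic f (2 * (b - a)) := by
    intro x
    have h1 := hb' (x + b - 2 * a)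
    have h2 := ha (x - a)
    have e1 : b + (x + b - 2 * a) = x + 2 * (b - a) := by ring
    have e2 : b - (x + b - 2 * a) = a - (x - a) := by ring
    rw [e1, e2, ← h2] at h1
    rw [h1]; congr 1; ring
  rcases le_total (2 * (b - a)) Real.pi with h | h
  · exact not_periodic_of_reflectionOrdered hS hP hnc (by linarith) h hper
  · refine not_periodic_of_reflectionOrdered hS hP hnc (p := 2 * Real.pi - 2 * (b - a))
      (by linarith) (by linarith) ?_
    exact hf.sub_period hper

/-- On an interval where the function is constant every point is locally, hence globally, a centre
of symmetry. -/
lemma not_locally_constant (hf : Function.Periodic f (2 * Real.pi)) (hS : ReflectionOrdered f)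
    (hP : ReflectionRigid f) (hnc : ∃ x y, f x ≠ f y) {a b : ℝ} (hab : a < b)
    (hconst : ∀ y ∈ Set.Icc a b, f y = f a) : False := by
  set b' := min b (a + Real.pi) with hb'
  have hb1 : a < b' := lt_min hab (by linarith [Real.pi_pos])
  have hb2 : b' ≤ b := min_le_left _ _
  have hb3 : b' ≤ a + Real.pi := min_le_right _ _
  set d := (b' - a) / 3 with hd
  have hd0 : 0 < d := by rw [hd]; linarith
  have hbd : b' = a + 3 * d := by rw [hd]; ring
  have hsymm : ∀ e ∈ Set.Icc (a + d) (a + 2 * d), ∀ t, f (e + t) = f (e - t) := by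
    intro e he
    refine hP e d hd0 fun t ht => ?_
    rw [hconst (e + t) ⟨by linarith [he.1, ht.1], by linarith [he.2, ht.2]⟩,
      hconst (e - t) ⟨by linarith [he.1, ht.2], by linarith [he.2, ht.1]⟩]
  exact eq_of_two_centers hf hS hP hnc (a := a + d) (b := a + 2 * d) (by linarith) (by linarith)
    (hsymm _ ⟨le_rfl, by linarith⟩) (hsymm _ ⟨by linarith, le_rfl⟩)

/-- A continuous periodic function ordered by every reflection is, about a suitable centre,
symmetric and decreasing. -/
lemma exists_center (hc : Continuous f) (hf : Function.Periodic f (2 * Real.pi))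
    (hS : ReflectionOrdered f) (hP : ReflectionRigid f) (hnc : ∃ x y, f x ≠ f y) :
    ∃ e, (∀ t, f (e + t) = f (e - t)) ∧ AntitoneOn f (Set.Icc e (e + Real.pi)) := by
  have hpi := Real.pi_pos
  set A : Set ℝ := {e | ∀ t ∈ Set.Ioo 0 Real.pi, f (e - t) ≤ f (e + t)} with hA
  set B : Set ℝ := {e | ∀ t ∈ Set.Ioo 0 Real.pi, f (e + t) ≤ f (e - t)} with hB
  have hAc : IsClosed A := by
    simp only [hA, Set.ofPred_forall]
    exact isClosed_iInter fun t => isClosed_iInter fun _ => isClosed_le (by fun_prop) (by fun_prop)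
  have hBc : IsClosed B := by
    simp only [hB, Set.ofPred_forall]
    exact isClosed_iInter fun t => isClosed_iInter fun _ => isClosed_le (by fun_prop) (by fun_prop)
  have hAB : ∀ s : Set ℝ, s ⊆ A ∪ B := fun s e _ => hS e
  -- translation by half a period exchanges the two alternatives
  have hshift : ∀ e t, f (e + Real.pi + t) = f (e - (Real.pi - t)) := by
    intro e t
    rw [← hf (e - (Real.pi - t))]; congr 1; ring
  have hshift' : ∀ e t, f (e + Real.pi - t) = f (e + (Real.pi - t)) := by
    intro e t
    congr 1; ring
  have hswap1 : ∀ e ∈ A, e + Real.pi ∈ B := by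
    intro e he t ht
    rw [hshift, hshift']
    exact he _ ⟨by linarith [ht.2], by linarith [ht.1]⟩
  have hswap2 : ∀ e ∈ B, e + Real.pi ∈ A := by
    intro e he t ht
    rw [hshift, hshift']
    exact he _ ⟨by linarith [ht.2], by linarith [ht.1]⟩
  have hsymm : ∀ e ∈ A ∩ B, ∀ t, f (e + t) = f (e - t) := fun e he =>
    hP e Real.pi hpi fun t ht => le_antisymm (he.2 t ht) (he.1 t ht)
  have hne : A.Nonempty ∧ B.Nonempty := by
    rcases hS 0 with h | h
    · exact ⟨⟨0, h⟩, ⟨_, hswap1 0 h⟩⟩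
    · exact ⟨⟨_, hswap2 0 h⟩, ⟨0, h⟩⟩
  obtain ⟨e₀, -, he₀⟩ := isPreconnected_closed_iff.1 isPreconnected_univ A B hAc hBc (hAB _)
    (by simpa using hne.1) (by simpa using hne.2)
  have hanti : ∀ e, Set.Ioo e (e + Real.pi) ⊆ B → AntitoneOn f (Set.Icc e (e + Real.pi)) := by
    intro e he x hx y hy hxy
    rcases hxy.eq_or_lt with rfl | hxy
    · exact le_rfl
    by_cases hfull : y - x < 2 * Real.pi
    · have h1 := he (a := (x + y) / 2) ⟨by linarith [hx.1], by linarith [hy.2]⟩ ((y - x) / 2)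
        ⟨by linarith, by linarith⟩
      ring_nf at h1
      exact h1
    · linarith [hx.1, hy.2]
  by_cases h1 : Set.Ioo e₀ (e₀ + Real.pi) ⊆ B
  · exact ⟨e₀, hsymm e₀ he₀, hanti e₀ h1⟩
  · have h2 : Set.Ioo e₀ (e₀ + Real.pi) ⊆ A := by
      by_contra h2
      obtain ⟨a, ha, haA⟩ := Set.not_subset.1 h2
      obtain ⟨b, hb, hbB⟩ := Set.not_subset.1 h1
      obtain ⟨e₁, he₁, he₁'⟩ := isPreconnected_closed_iff.1 isPreconnected_Ioo A B hAc hBc (hAB _)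
        ⟨b, hb, (hS b).resolve_right hbB⟩ ⟨a, ha, (hS a).resolve_left haA⟩
      exact eq_of_two_centers hf hS hP hnc he₁.1 he₁.2 (hsymm e₀ he₀) (hsymm e₁ he₁')
    refine ⟨e₀ + Real.pi, hsymm _ ⟨hswap2 _ he₀.2, hswap1 _ he₀.1⟩, hanti _ fun e he => ?_⟩
    have := hswap1 (e - Real.pi) (h2 ⟨by linarith [he.1], by linarith [he.2]⟩)
    rwa [sub_add_cancel] at this

end

lemma isLocalMax_coe_iff (v : Torus → ℝ) (x : ℝ) :
    IsLocalMax v (x : Torus) ↔ IsLocalMax (fun t : ℝ => v (t : Torus)) x := by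
  unfold IsLocalMax IsMaxFilter
  rw [← (AddCircle.isLocalHomeomorph_coe (2 * Real.pi)).map_nhds_eq x, eventually_map]

/-- A nonconstant continuous function on the circle which is ordered by every reflection, rigidly,
has exactly one local maximum point. -/
theorem existsUnique_isLocalMax {v : Torus → ℝ} (hv : Continuous v)
    (hS : ReflectionOrdered fun t : ℝ => v (t : Torus))
    (hP : ReflectionRigid fun t : ℝ => v (t : Torus))
    (hnc : ∃ x y : ℝ, v (x : Torus) ≠ v (y : Torus)) : ∃! x, IsLocalMax v x := by
  have hpi := Real.pi_pos
  set f : ℝ → ℝ := fun t => v (t : Torus) with hf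
  have hper : Function.Periodic f (2 * Real.pi) := fun x => by
    simp only [hf]
    rw [AddCircle.coe_add_period]
  have hc : Continuous f := hv.comp (AddCircle.continuous_mk' _)
  obtain ⟨e, hsym, hanti⟩ := exists_center hc hper hS hP hnc
  have hsym' : ∀ x, f x = f (2 * e - x) := fun x => by
    have := hsym (x - e)
    ring_nf at this
    rw [this]; congr 1; ring
  have hright : ∀ x ∈ Set.Ioc e (e + Real.pi), ¬ IsLocalMax f x := by
    intro x hx hmax
    obtain ⟨δ, hδ, hball⟩ := Metric.eventually_nhds_iff.1 hmax
    set a := max e (x - δ / 2) with ha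
    have hax : a < x := max_lt hx.1 (by linarith)
    have hae : e ≤ a := le_max_left _ _
    have hxe : x ∈ Set.Icc e (e + Real.pi) := ⟨hx.1.le, hx.2⟩
    have hmid : ∀ y ∈ Set.Icc a x, f y = f x := by
      intro y hy
      have hya : x - δ / 2 ≤ y := (le_max_right _ _).trans hy.1
      refine le_antisymm (hball ?_)
        (hanti ⟨hae.trans hy.1, hy.2.trans hx.2⟩ hxe hy.2)
      rw [Real.dist_eq, abs_lt]
      constructor <;> linarith [hy.2]
    exact not_locally_constant hper hS hP hnc hax fun y hy => by
      rw [hmid y hy, hmid a ⟨le_rfl, hax.le⟩]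
  have hleft : ∀ x ∈ Set.Ico (e - Real.pi) e, ¬ IsLocalMax f x := by
    intro x hx hmax
    refine hright (2 * e - x) ⟨by linarith [hx.2], by linarith [hx.1]⟩ ?_
    have hcont : Tendsto (fun y : ℝ => 2 * e - y) (𝓝 (2 * e - x)) (𝓝 x) := by
      have : Continuous fun y : ℝ => 2 * e - y := by fun_prop
      have := this.tendsto (2 * e - x)
      simpa using this
    have := hcont.eventually hmax
    filter_upwards [this] with y hy
    rw [← hsym' x, hsym' y]
    exact hy
  have hcenter : IsLocalMax f e := by
    have hnhds : Set.Ioo (e - Real.pi) (e + Real.pi) ∈ 𝓝 e :=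
      Ioo_mem_nhds (by linarith) (by linarith)
    filter_upwards [hnhds] with y hy
    have he0 : e ∈ Set.Icc e (e + Real.pi) := ⟨le_rfl, by linarith⟩
    rcases le_total e y with h | h
    · exact hanti he0 ⟨h, hy.2.le⟩ h
    · rw [hsym' y]
      exact hanti he0 ⟨by linarith, by linarith [hy.1]⟩ (by linarith)
  refine ⟨(e : Torus), (isLocalMax_coe_iff v e).2 hcenter, fun θ hθ => ?_⟩
  have h := AddCircle.coe_image_Ioc_eq (2 * Real.pi) (e - Real.pi)
  have h2 : θ ∈ ((↑) : ℝ → Torus) '' Set.Ioc (e - Real.pi) (e - Real.pi + 2 * Real.pi) := by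
    rw [h]; trivial
  obtain ⟨x, hx, rfl⟩ := h2
  have hx' := (isLocalMax_coe_iff v x).1 hθ
  rcases lt_trichotomy x e with h | h | h
  · exact (hleft x ⟨hx.1.le, h⟩ hx').elim
  · rw [h]
  · exact (hright x ⟨h, by linarith [hx.2]⟩ hx').elim

theorem singleLobe_of_reflectionOrdered {u v : Torus → ℝ} (hv : Continuous v)
    (huv : u =ᵐ[volume] v) (hS : ReflectionOrdered fun t : ℝ => v (t : Torus))
    (hP : ReflectionRigid fun t : ℝ => v (t : Torus))
    (hnc : ∃ x y : ℝ, v (x : Torus) ≠ v (y : Torus)) : SingleLobe u := by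
  refine ⟨v, hv, huv, existsUnique_isLocalMax hv hS hP hnc, ?_⟩
  obtain ⟨x, hx, huniq⟩ := existsUnique_isLocalMax (v := fun x => -v x) hv.neg hS.neg hP.neg
    (by simpa using hnc)
  refine ⟨x, by simpa using hx.neg, fun y hy => huniq y hy.neg⟩

/-! ### Ground states for `α < 2` -/

/-- A function with the same distribution as a ground state, and with the same moduli of the
Fourier coefficients up to reflection of the index, is a ground state. -/
lemma IsGroundState.of_equimeasurable {α c m : ℝ} (hα : 0 ≤ α) {χ χ' : Torus → ℝ}
    (h : IsGroundState α c m χ) (h2 : MemLp χ' 2 volume)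
    (hco : ∀ n, ‖coeff χ' n‖ = ‖coeff χ n‖ ∨ ‖coeff χ' n‖ = ‖coeff χ (-n)‖)
    (hint : ∀ f : ℝ → ℝ, ∫ x, f (χ' x) = ∫ x, f (χ x)) : IsGroundState α c m χ' := by
  have hco' : ∀ n, ‖coeff χ' n‖ = ‖coeff χ n‖ := fun n => by
    rcases hco n with h | h
    · exact h
    · rw [h, coeff_neg_index, RCLike.norm_conj]
  have hS : MemSobolev (α / 2) χ' := ⟨h2, by simp_rw [hco']; exact h.1.1.2⟩
  refine ⟨⟨hS, ?_, ?_⟩, fun w hw => ?_⟩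
  · rw [hint fun t => t ^ 4]; exact h.1.2.1
  · rw [hint fun t => t]; exact h.1.2.2
  · show energyB α c χ' ≤ energyB α c w
    have e : energyB α c χ' = energyB α c χ := by
      rw [energyB_eq hα c hS, energyB_eq hα c h.1.1, hint fun t => t ^ 2, quadForm, quadForm]
      simp_rw [hco']
    rw [e]
    exact h.2 hw

lemma IsGroundState.translate {α c m : ℝ} (hα : 0 ≤ α) {v : Torus → ℝ} (hv : Continuous v)
    (h : IsGroundState α c m v) (e : Torus) : IsGroundState α c m fun x => v (x + e) :=
  h.of_equimeasurable hα (memLp_of_continuous (by fun_prop) 2)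
    (fun n => Or.inl (norm_coeff_comp_add_right v e n))
    fun f => integral_add_right_eq_self (fun x => f (v x)) e

lemma IsGroundState.reflect {α c m : ℝ} (hα : 0 ≤ α) {v : Torus → ℝ} (hv : Continuous v)
    (h : IsGroundState α c m v) : IsGroundState α c m fun x => v (-x) :=
  h.of_equimeasurable hα (memLp_of_continuous (by fun_prop) 2)
    (fun n => Or.inr (by rw [coeff_comp_neg])) fun f => integral_neg_eq_self (fun x => f (v x)) volume

lemma IsGroundState.nonconstant {α c m : ℝ} (hm4 : 2 * Real.pi * m ^ 4 < 1) {v : Torus → ℝ}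
    (h : IsGroundState α c m v) : ∃ x y : ℝ, v (x : Torus) ≠ v (y : Torus) := by
  by_contra hcon
  push Not at hcon
  have hconst : v = fun _ => v 0 := by
    ext x
    obtain ⟨t, -, -, rfl⟩ := exists_coe_eq x
    simpa using hcon t 0
  have h4 := h.1.2.1
  have h1 := h.1.2.2
  rw [hconst, integral_const_torus] at h4 h1
  have : v 0 = m := by
    rw [← h1]
    have := Real.pi_pos
    field_simp
  rw [this] at h4
  linarith

lemma add_coe_eq (e t : ℝ) : ((e + t : ℝ) : Torus) = (t : Torus) + (e : Torus) := by
  rw [AddCircle.coe_add, add_comm]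

lemma sub_coe_eq (e t : ℝ) : ((e - t : ℝ) : Torus) = -(t : Torus) + (e : Torus) := by
  rw [AddCircle.coe_sub, sub_eq_add_neg, add_comm]

lemma IsGroundState.reflectionOrdered {α c m : ℝ} (h0 : 0 < α) (h2 : α < 2) {v : Torus → ℝ}
    (hv : Continuous v) (h : IsGroundState α c m v) :
    ReflectionOrdered fun t : ℝ => v (t : Torus) := by
  intro e
  by_contra hcon
  push Not at hcon
  obtain ⟨⟨s, hs, hs'⟩, ⟨t, ht, ht'⟩⟩ := hcon
  have hg := h.translate h0.le hv (e : Torus)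
  have hc : Continuous fun x => v (x + (e : Torus)) := by fun_prop
  rw [add_coe_eq, sub_coe_eq] at hs' ht'
  have hlt := quadForm_polar_lt h0 h2 hc hg.1.1 (x := (t : Torus)) (y := (s : Torus))
    (by rw [sinT_one_coe]; exact Real.sin_pos_of_mem_Ioo ht)
    (by rw [sinT_one_coe]; exact Real.sin_pos_of_mem_Ioo hs) ht' hs'
  exact hlt.ne (hg.polar h0 h2.le hc).2

/-- A normal contraction of a function in the Sobolev space is in the Sobolev space. -/
lemma memSobolev_of_contraction {α : ℝ} (h0 : 0 < α) (h2 : α ≤ 2) {u v : Torus → ℝ}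
    (hu : Continuous u) (hv : Continuous v) (hvS : MemSobolev (α / 2) v)
    (h : ∀ x y, |u x - u y| ≤ |v x - v y|) : MemSobolev (α / 2) u := by
  refine (quadForm_le_of_resolventForm_le h0 h2 (memLp_of_continuous hu 2) hvS fun l hl =>
    resolventForm_le_of_kernelForm hl hu hv ?_).1
  have hK := continuous_resolventKernel l
  have e : ∀ w : Torus → ℝ, Continuous w → kernelForm l w = ∫ z : Torus × Torus,
      resolventKernel l (z.1 - z.2) * (w z.1 - w z.2) ^ 2
        ∂((volume : Measure Torus).prod volume) := fun w hw => by
    rw [integral_prod _ (integrable_continuous_prod (by fun_prop))]; rfl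
  rw [e u hu, e v hv]
  refine integral_mono (integrable_continuous_prod (by fun_prop))
    (integrable_continuous_prod (by fun_prop)) fun z => ?_
  exact mul_le_mul_of_nonneg_left (sq_le_sq.2 (h _ _)) (Real.cosh_pos _).le

/-- A truncated cosine: a nonnegative bump of radius `r` about `r`. -/
def bump (r : ℝ) (x : Torus) : ℝ := max 0 (cosT 1 (x - (r : Torus)) - Real.cos r)

lemma continuous_bump (r : ℝ) : Continuous (bump r) := by
  have := continuous_cosT 1
  unfold bump
  fun_prop

lemma memSobolev_bump {α : ℝ} (h0 : 0 < α) (h2 : α ≤ 2) (r : ℝ) :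
    MemSobolev (α / 2) (bump r) := by
  have hc := continuous_cosT 1
  refine memSobolev_of_contraction h0 h2 (v := fun x => cosT 1 (x - (r : Torus)))
    (continuous_bump r) (by fun_prop) ?_ fun x y => ?_
  · have h := memSobolev_cosT h0.le 1
    refine ⟨memLp_of_continuous (by fun_prop) 2, ?_⟩
    simp_rw [sub_eq_add_neg, norm_coeff_comp_add_right]
    exact h.2
  · refine (abs_max_sub_max_le_max _ _ _ _).trans ?_
    simp

lemma exists_coe_of_bump_ne_zero {r : ℝ} (hr0 : 0 < r) (hr : r ≤ Real.pi) {x : Torus}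
    (h : bump r x ≠ 0) : ∃ t ∈ Set.Ioo 0 (2 * r), (t : Torus) = x := by
  have h1 : Real.cos r < cosT 1 (x - (r : Torus)) := by
    by_contra hcon
    push Not at hcon
    exact h (max_eq_left (by linarith))
  rw [cosT_eq_cos_norm, Real.strictAntiOn_cos.lt_iff_gt ⟨hr0.le, hr⟩
    ⟨norm_nonneg _, norm_le_pi _⟩] at h1
  obtain ⟨s, hs1, hs2, hs⟩ := exists_coe_eq (x - (r : Torus))
  rw [← hs, norm_coe_torus (abs_le.2 ⟨hs1.le, hs2⟩), abs_lt] at h1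
  refine ⟨s + r, ⟨by linarith, by linarith⟩, ?_⟩
  rw [AddCircle.coe_add, hs, sub_add_cancel]

lemma bump_neg_le {r : ℝ} (hr0 : 0 < r) (hr : r ≤ Real.pi) {x : Torus} (hx : 0 ≤ sinT 1 x) :
    bump r (-x) ≤ bump r x := by
  refine max_le_max le_rfl (sub_le_sub_right ?_ _)
  have h1 := cosT_sub_cosT x (r : Torus)
  have h2 : cosT 1 (-x - (r : Torus)) = cosT 1 (x + (r : Torus)) := by
    rw [cosT_eq_cos_norm, cosT_eq_cos_norm, ← norm_neg]; congr 2; abel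
  rw [sinT_one_coe] at h1
  rw [h2]
  nlinarith [mul_nonneg hx (Real.sin_nonneg_of_nonneg_of_le_pi hr0.le hr)]

lemma integral_eq_zero_of_odd {g : Torus → ℝ} (h : ∀ x, g (-x) = -g x) : ∫ x, g x = 0 := by
  have h1 := integral_neg_eq_self g (volume : Measure Torus)
  simp_rw [h] at h1
  rw [integral_neg] at h1
  linarith

/-- Rigidity of ground states: if a ground state dominates its reflection on the half circle and
agrees with it near one of the fixed points, it is symmetric. Otherwise an odd bump `φ` supported
where `u` agrees with its reflection satisfies `polar (u - φ) = u + φ`, so that the strict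
polarization inequality gives `bilinForm u φ < 0`, against the Euler–Lagrange equation. -/
lemma IsGroundState.eq_reflect {α c m : ℝ} (hα : 1 / 2 < α) (h2 : α < 2) (hc : -1 < c)
    (hm4 : 2 * Real.pi * m ^ 4 < 1) {u : Torus → ℝ} (hu : Continuous u)
    (h : IsGroundState α c m u) {δ : ℝ} (hδ : 0 < δ)
    (hloc : ∀ t ∈ Set.Ioo 0 δ, u (t : Torus) = u (-(t : Torus)))
    (hdom : ∀ t ∈ Set.Ioo 0 Real.pi, u (-(t : Torus)) ≤ u (t : Torus)) (x : Torus) :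
    u x = u (-x) := by
  have h0 : 0 < α := by linarith
  have hpi := Real.pi_pos
  by_contra hne
  -- a point of the open half circle at which `u` strictly dominates its reflection
  obtain ⟨t₀, ht₀, ht₀'⟩ : ∃ t ∈ Set.Ioo 0 Real.pi, u (-(t : Torus)) < u (t : Torus) := by
    obtain ⟨s, hs1, hs2, rfl⟩ := exists_coe_eq x
    have hsin : sinT 1 (s : Torus) ≠ 0 := fun h =>
      hne (by rw [neg_eq_self_of_sinT_eq_zero h])
    rw [sinT_one_coe] at hsin
    have hsp : s ≠ Real.pi := by rintro rfl; simp at hsin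
    have hs0 : s ≠ 0 := by rintro rfl; simp at hsin
    rcases lt_or_gt_of_ne hs0 with hs | hs
    · have hmem : -s ∈ Set.Ioo 0 Real.pi := ⟨by linarith, by linarith⟩
      refine ⟨-s, hmem, lt_of_le_of_ne (hdom _ hmem) ?_⟩
      simpa using hne
    · have hmem : s ∈ Set.Ioo 0 Real.pi := ⟨hs, lt_of_le_of_ne hs2 hsp⟩
      exact ⟨s, hmem, lt_of_le_of_ne (hdom _ hmem) (Ne.symm hne)⟩
  set r := min (δ / 2) (Real.pi / 2) with hr
  have hr0 : 0 < r := lt_min (by linarith) (by linarith)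
  have hrδ : 2 * r ≤ δ := by have := min_le_left (δ / 2) (Real.pi / 2); linarith
  have hrπ : r ≤ Real.pi / 2 := min_le_right _ _
  have hb := continuous_bump r
  set φ : Torus → ℝ := fun x => bump r x + (-1) * bump r (-x) with hφ
  have hφc : Continuous φ := by fun_prop
  have hφodd : ∀ x, φ (-x) = -φ x := fun x => by simp only [hφ, neg_neg]; ring
  have hbS := memSobolev_bump h0 h2.le r
  have hbS' : MemSobolev (α / 2) fun x => bump r (-x) := by
    refine ⟨memLp_of_continuous (by fun_prop) 2, ?_⟩
    simp_rw [coeff_comp_neg, coeff_neg_index, RCLike.norm_conj]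
    exact hbS.2
  have hφS : MemSobolev (α / 2) φ := hbS.add_mul h0.le hbS' (-1)
  have hφu : ∀ x, φ x ≠ 0 → u x = u (-x) := by
    intro x hx
    by_cases h1 : bump r x = 0
    · by_cases h3 : bump r (-x) = 0
      · exact (hx (by simp only [hφ]; rw [h1, h3]; simp)).elim
      · obtain ⟨t, ht, hteq⟩ := exists_coe_of_bump_ne_zero hr0 (by linarith) h3
        have := hloc t ⟨ht.1, ht.2.trans_le hrδ⟩
        rw [hteq, neg_neg] at this
        exact this.symm
    · obtain ⟨t, ht, hteq⟩ := exists_coe_of_bump_ne_zero hr0 (by linarith) h1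
      have := hloc t ⟨ht.1, ht.2.trans_le hrδ⟩
      rwa [hteq] at this
  have hφnonneg : ∀ x, 0 ≤ sinT 1 x → 0 ≤ φ x := fun x hx => by
    have := bump_neg_le hr0 (by linarith) hx
    simp only [hφ]; linarith
  have hdom' : ∀ x, 0 ≤ sinT 1 x → u (-x) ≤ u x := by
    intro x hx
    obtain ⟨s, hs1, hs2, rfl⟩ := exists_coe_eq x
    rcases hx.eq_or_lt with hx | hx
    · rw [neg_eq_self_of_sinT_eq_zero hx.symm]
    · rw [sinT_one_coe] at hx
      have hs0 : 0 < s := by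
        by_contra hcon
        push Not at hcon
        linarith [Real.sin_nonpos_of_nonpos_of_neg_pi_le hcon hs1.le]
      refine hdom s ⟨hs0, lt_of_le_of_ne hs2 ?_⟩
      rintro rfl
      simp at hx
  -- the odd bump is exchanged for its negative by polarization
  have hpol : FracMKdV.polar (fun x => u x + (-1) * φ x) = fun x => u x + 1 * φ x := by
    ext x
    rcases polar_cases (fun x => u x + (-1) * φ x) x with ⟨hx, h1, -⟩ | ⟨hx, h1, -⟩
    · rw [h1, hφodd]
      by_cases hφx : φ x = 0
      · simp [hφx, hdom' x hx]
      · rw [← hφu x hφx]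
        have := hφnonneg x hx
        rw [max_eq_right (by linarith)]; ring
    · rw [h1, hφodd]
      have hx' : 0 ≤ sinT 1 (-x) := by rw [sinT_one_neg]; linarith
      by_cases hφx : φ x = 0
      · have := hdom' _ hx'
        rw [neg_neg] at this
        simp [hφx, this]
      · rw [← hφu x hφx]
        have := hφnonneg _ hx'
        rw [hφodd] at this
        rw [min_eq_right (by linarith)]; ring
  have hr_mem : r ∈ Set.Ioo 0 Real.pi := ⟨hr0, by linarith⟩
  have hφr : 0 < φ (r : Torus) := by
    have hsin : 0 < sinT 1 (r : Torus) := by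
      rw [sinT_one_coe]; exact Real.sin_pos_of_mem_Ioo hr_mem
    have e1 : bump r (r : Torus) = 1 - Real.cos r := by
      have hcos : Real.cos r ≤ 1 := Real.cos_le_one r
      rw [bump, sub_self, ← AddCircle.coe_zero, cosT_one_coe, Real.cos_zero,
        max_eq_right (by linarith)]
    have e2 : bump r (-(r : Torus)) = 0 := by
      rw [bump, ← AddCircle.coe_neg, ← AddCircle.coe_sub, cosT_one_coe]
      refine max_eq_left ?_
      rw [show -r - r = -(2 * r) by ring, Real.cos_neg]
      have := Real.strictAntiOn_cos.antitoneOn (a := r) (b := 2 * r) ⟨hr0.le, by linarith⟩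
        ⟨by linarith, by linarith⟩ (by linarith)
      linarith
    have e3 : Real.cos r < 1 := by
      have := Real.strictAntiOn_cos (a := 0) (b := r) ⟨le_rfl, hpi.le⟩ ⟨hr0.le, by linarith⟩ hr0
      simpa using this
    simp only [hφ]
    rw [e1, e2]; linarith
  have hφt₀ : φ (t₀ : Torus) = 0 := by
    by_contra hcon
    exact ht₀'.ne (hφu _ hcon).symm
  have hur : u (r : Torus) = u (-(r : Torus)) := hφu _ hφr.ne'
  have hlt := quadForm_polar_lt h0 h2 (u := fun x => u x + (-1) * φ x) (by fun_prop)
    (h.1.1.add_mul h0.le hφS (-1)) (x := (t₀ : Torus)) (y := (r : Torus))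
    (by rw [sinT_one_coe]; exact Real.sin_pos_of_mem_Ioo ht₀)
    (by rw [sinT_one_coe]; exact Real.sin_pos_of_mem_Ioo hr_mem)
    (by rw [hφodd, hφt₀]; simpa using ht₀') (by rw [hφodd, hur]; linarith)
  rw [hpol, quadForm_add_mul h0.le h.1.1 hφS, quadForm_add_mul h0.le h.1.1 hφS] at hlt
  -- the Euler–Lagrange equation tested with `φ`
  obtain ⟨μ, -, b, hEL⟩ := h.exists_multipliers hα hc hm4
  have hEL := hEL φ hφS
  have i1 : ∫ x, φ x = 0 := integral_eq_zero_of_odd hφodd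
  have hmulodd : ∀ f : ℝ → ℝ, ∀ x, f (u (-x)) * φ (-x) = -(f (u x) * φ x) := by
    intro f x
    rw [hφodd]
    by_cases hx : φ x = 0
    · rw [hx]; simp
    · rw [← hφu x hx]; ring
  have i2 : ∫ x, u x * φ x = 0 := integral_eq_zero_of_odd (hmulodd fun t => t)
  have i3 : ∫ x, (u x) ^ 3 * φ x = 0 := integral_eq_zero_of_odd (hmulodd fun t => t ^ 3)
  rw [energyDeriv, i1, i2, i3] at hEL
  have hB : bilinForm α u φ = 0 := by
    have : 2 * Real.pi * bilinForm α u φ = 0 := by linarith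
    rcases mul_eq_zero.1 this with h | h
    · linarith
    · exact h
  rw [hB] at hlt
  linarith

lemma IsGroundState.reflectionRigid {α c m : ℝ} (hα : 1 / 2 < α) (h2 : α < 2) (hc : -1 < c)
    (hm4 : 2 * Real.pi * m ^ 4 < 1) {v : Torus → ℝ} (hv : Continuous v)
    (h : IsGroundState α c m v) : ReflectionRigid fun t : ℝ => v (t : Torus) := by
  have h0 : 0 < α := by linarith
  intro e δ hδ hloc t
  simp only [add_coe_eq, sub_coe_eq] at hloc ⊢
  have hg := h.translate h0.le hv (e : Torus)
  have hgc : Continuous fun x => v (x + (e : Torus)) := by fun_prop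
  rcases h.reflectionOrdered h0 h2 hv e with hs | hs <;> simp only [add_coe_eq, sub_coe_eq] at hs
  · exact hg.eq_reflect hα h2 hc hm4 hgc hδ hloc hs (t : Torus)
  · have := (hg.reflect h0.le hgc).eq_reflect hα h2 hc hm4 (by fun_prop) hδ
      (fun s hs => by rw [neg_neg]; exact (hloc s hs).symm)
      (fun s hs' => by rw [neg_neg]; exact hs s hs') (-(t : Torus))
    rwa [neg_neg] at this

/-! ### Ground states for `α = 2` -/

/-- Functions with absolutely summable coefficients form an algebra. -/
lemma summable_norm_coeff_mul {u v : Torus → ℝ} (hu : MemLp u 2 volume) (hv : MemLp v 2 volume)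
    (hus : Summable fun n => ‖coeff u n‖) (hvs : Summable fun n => ‖coeff v n‖) :
    Summable fun n => ‖coeff (fun x => u x * v x) n‖ := by
  rw [← tsum_enorm_ne_top_iff_summable_norm] at hus hvs ⊢
  refine ne_top_of_le_ne_top ?_ (ENNReal.tsum_le_tsum (enorm_coeff_mul_le hu hv))
  rw [tsum_conv (fun i => ‖coeff u i‖ₑ) fun i => ‖coeff v i‖ₑ]
  exact ENNReal.mul_ne_top hus hvs

lemma hasSum_fourier_of_continuous {u : Torus → ℝ} (hu : Continuous u)
    (h : Summable fun n => ‖coeff u n‖) (x : Torus) :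
    HasSum (fun n => coeff u n * fourier n x) (u x : ℂ) := by
  have h1 := has_pointwise_sum_fourier_series_of_summable
    (f := ⟨fun x => (u x : ℂ), by fun_prop⟩) h.of_norm x
  exact h1

lemma hasDerivAt_tsum_fourier {a : ℤ → ℂ} (h0 : Summable fun n => ‖a n‖)
    (h1 : Summable fun n : ℤ => ‖Complex.I * n * a n‖) (t : ℝ) :
    HasDerivAt (fun s : ℝ => ∑' n : ℤ, a n * fourier n (s : Torus))
      (∑' n : ℤ, Complex.I * n * a n * fourier n (t : Torus)) t := by
  have hn : ∀ (n : ℤ) (x : Torus), ‖(fourier n x : ℂ)‖ = 1 := fun n x => by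
    rw [fourier_apply, Circle.norm_coe]
  refine hasDerivAt_tsum (𝕜 := ℝ) (g := fun n (s : ℝ) => a n * fourier n (s : Torus))
    (g' := fun n s => Complex.I * n * a n * fourier n (s : Torus)) h1
    (fun n y => ?_) (fun n y => ?_) (y₀ := 0) ?_ t
  · refine ((hasDerivAt_fourier (2 * Real.pi) n y).const_mul (a n)).congr_deriv ?_
    have : (Real.pi : ℂ) ≠ 0 := by exact_mod_cast Real.pi_ne_zero
    push_cast
    field_simp
  · rw [norm_mul, hn, mul_one]
  · refine Summable.of_norm ?_
    simp_rw [norm_mul, hn, mul_one]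
    exact h0

lemma summable_norm_mul_of_sq {a : ℤ → ℂ} (h0 : Summable fun n => ‖a n‖)
    (h2 : Summable fun n : ℤ => ‖Complex.I * n * (Complex.I * n * a n)‖) :
    Summable fun n : ℤ => ‖Complex.I * n * a n‖ := by
  refine (h0.add h2).of_nonneg_of_le (fun n => norm_nonneg _) fun n => ?_
  simp only [norm_mul, Complex.norm_I, one_mul, Complex.norm_intCast]
  nlinarith [mul_nonneg (norm_nonneg (a n)) (sq_nonneg (|(n : ℝ)| - 1)), norm_nonneg (a n),
    mul_nonneg (norm_nonneg (a n)) (sq_nonneg (|(n : ℝ)|))]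

/-- For `α = 2` a continuous ground state is a classical solution of its Euler–Lagrange
equation. -/
lemma IsGroundState.hasDerivAt_two {c m : ℝ} (hc : -1 < c) (hm4 : 2 * Real.pi * m ^ 4 < 1)
    {u : Torus → ℝ} (hu : Continuous u) (h : IsGroundState 2 c m u) :
    ∃ (μ b : ℝ) (f' : ℝ → ℝ), (∀ t : ℝ, HasDerivAt (fun s : ℝ => u (s : Torus)) (f' t) t) ∧
      ∀ t : ℝ, HasDerivAt f' (c * u (t : Torus) + b - μ * u (t : Torus) ^ 3) t := by
  have hα : (1 / 2 : ℝ) < 2 := by norm_num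
  obtain ⟨μ, -, b, hEL⟩ := h.exists_multipliers hα hc hm4
  have heq := coeff_equation hα h.1.1 hEL
  have hu2 := memLp_of_continuous hu 2
  have hs := (memSobolev_of_coeff_equation (c := c) (μ := μ) hα h.1.1 fun n hn => by
    have := heq n
    rwa [if_neg hn, add_zero] at this).summable_norm_coeff hα
  have hs3 : Summable fun n => ‖coeff (fun x => u x ^ 3) n‖ := by
    have := summable_norm_coeff_mul hu2 (memLp_of_continuous (hu.mul hu) 2) hs
      (summable_norm_coeff_mul hu2 hu2 hs hs)
    refine this.congr fun n => ?_
    congr 2; ext x; simp only [Pi.mul_apply]; ring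
  set a := coeff u with ha
  have heq' : ∀ n : ℤ, Complex.I * n * (Complex.I * n * a n) =
      c * a n + (if n = 0 then (b : ℂ) else 0) - μ * coeff (fun x => u x ^ 3) n := fun n => by
    have h1 := heq n
    rw [Real.rpow_two, sq_abs] at h1
    push_cast at h1
    rw [← h1]
    linear_combination (n : ℂ) ^ 2 * a n * Complex.I_sq
  have hsb : HasSum (fun n : ℤ => if n = 0 then (b : ℂ) else 0) b := hasSum_ite_eq 0 (b : ℂ)
  have hs2 : Summable fun n : ℤ => ‖Complex.I * n * (Complex.I * n * a n)‖ := by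
    simp_rw [heq']
    rw [summable_norm_iff]
    exact ((hs.of_norm.mul_left _).add hsb.summable).sub (hs3.of_norm.mul_left _)
  have hs1 := summable_norm_mul_of_sq hs hs2
  have hd1 := hasDerivAt_tsum_fourier hs hs1
  have hd2 := hasDerivAt_tsum_fourier hs1 hs2
  have eu : ∀ x : Torus, ∑' n, a n * fourier n x = u x := fun x =>
    (hasSum_fourier_of_continuous hu hs x).tsum_eq
  have e2 : ∀ x : Torus, ∑' n : ℤ, Complex.I * n * (Complex.I * n * a n) * fourier n x
      = ((c * u x + b - μ * u x ^ 3 : ℝ) : ℂ) := fun x => by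
    have i1 := (hasSum_fourier_of_continuous hu hs x).mul_left (c : ℂ)
    have i3 := (hasSum_fourier_of_continuous (hu.pow 3) hs3 x).mul_left (μ : ℂ)
    have := ((i1.add hsb).sub i3).tsum_eq
    simp only [Pi.pow_apply] at this
    push_cast at this ⊢
    rw [← this]
    congr 1; ext n
    rw [heq' n]
    have e : (u ^ 3 : Torus → ℝ) = fun x => u x ^ 3 := rfl
    rw [e]
    split_ifs with hn
    · subst hn; simp [ha]
    · ring
  simp_rw [eu] at hd1
  simp_rw [e2] at hd2
  refine ⟨μ, b, fun t => (∑' n : ℤ, Complex.I * n * a n * fourier n (t : Torus)).re, fun t => ?_,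
    fun t => ?_⟩
  · exact (Complex.reCLM.hasFDerivAt.comp_hasDerivAt t (hd1 t))
  · exact (Complex.reCLM.hasFDerivAt.comp_hasDerivAt t (hd2 t))

/-- Uniqueness for the linear equation `w'' = g w` with bounded `g`. -/
lemma eq_zero_of_second_order {w w' g : ℝ → ℝ} {K : ℝ} (h1 : ∀ t, HasDerivAt w (w' t) t)
    (h2 : ∀ t, HasDerivAt w' (g t * w t) t) (hg : ∀ t, |g t| ≤ K) {t₀ : ℝ} (hw : w t₀ = 0)
    (hw' : w' t₀ = 0) (t : ℝ) : w t = 0 := by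
  have hK : 0 ≤ K := (abs_nonneg _).trans (hg 0)
  have key := ODE_solution_unique_univ (v := fun t (y : ℝ × ℝ) => (y.2, g t * y.1))
    (s := fun _ => Set.univ) (K := max 1 K.toNNReal) (f := fun t => (w t, w' t))
    (g := fun _ => (0 : ℝ × ℝ)) (t₀ := t₀) (fun t => ?_) (fun t => ⟨(h1 t).prodMk (h2 t), trivial⟩)
    (fun t => ⟨?_, trivial⟩) (by simp [hw, hw'])
  · simpa using congrArg Prod.fst (congrFun key t)
  · refine LipschitzWith.lipschitzOnWith ?_
    refine LipschitzWith.prodMk LipschitzWith.prod_snd (LipschitzWith.of_dist_le_mul fun x y => ?_)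
    rw [Real.dist_eq, ← mul_sub, abs_mul, Real.coe_toNNReal _ hK]
    refine mul_le_mul (hg t) ?_ (abs_nonneg _) hK
    rw [← Real.dist_eq]
    exact le_max_left _ _
  · exact (hasDerivAt_const t (0 : ℝ × ℝ)).congr_deriv (by ext <;> simp)

/-- For `α = 2`, a ground state which meets its reflection in the open half circle is symmetric. At
a meeting point the polarization, being differentiable, has the slope of both branches; hence the
difference of the branches vanishes there to first order, and it solves a linear equation. -/
lemma IsGroundState.eq_reflect_of_meet {c m : ℝ} (hc : -1 < c) (hm4 : 2 * Real.pi * m ^ 4 < 1)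
    {u : Torus → ℝ} (hu : Continuous u) (h : IsGroundState 2 c m u) {t₀ : ℝ}
    (ht₀ : t₀ ∈ Set.Ioo 0 Real.pi) (hmeet : u (t₀ : Torus) = u (-(t₀ : Torus))) (t : ℝ) :
    u (t : Torus) = u (-(t : Torus)) := by
  obtain ⟨μ, b, f', hf1, hf2⟩ := h.hasDerivAt_two hc hm4 hu
  obtain ⟨-, -, p', hp, -⟩ :=
    (h.polar two_pos le_rfl hu).1.hasDerivAt_two hc hm4 (continuous_polar hu)
  have hr1 : ∀ t : ℝ, HasDerivAt (fun s : ℝ => u (-(s : Torus))) (-f' (-t)) t := fun t => by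
    have := (hf1 (-t)).scomp t (hasDerivAt_neg t)
    simpa [Function.comp_def] using this
  have hr2 : ∀ t : ℝ, HasDerivAt (fun s : ℝ => -f' (-s))
      (c * u (-(t : Torus)) + b - μ * u (-(t : Torus)) ^ 3) t := fun t => by
    have := ((hf2 (-t)).scomp t (hasDerivAt_neg t)).neg
    refine this.congr_deriv (by simp)
  have hmax : ∀ s ∈ Set.Ioo 0 Real.pi,
      FracMKdV.polar u (s : Torus) = max (u (s : Torus)) (u (-(s : Torus))) := fun s hs =>
    if_pos (by rw [sinT_one_coe]; exact (Real.sin_pos_of_mem_Ioo hs).le)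
  have hslope : ∀ {q : ℝ → ℝ} {q' : ℝ}, HasDerivAt q q' t₀ →
      (∀ s ∈ Set.Ioo 0 Real.pi, q s ≤ FracMKdV.polar u (s : Torus)) →
      q t₀ = FracMKdV.polar u (t₀ : Torus) → p' t₀ = q' := by
    intro q q' hq hle heq
    have hmin : IsLocalMin (fun s : ℝ => FracMKdV.polar u (s : Torus) - q s) t₀ := by
      filter_upwards [Ioo_mem_nhds ht₀.1 ht₀.2] with s hs
      have := hle s hs
      simp only [heq, sub_self]
      linarith
    have := hmin.hasDerivAt_eq_zero ((hp t₀).sub hq)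
    linarith
  have s1 := hslope (hf1 t₀) (fun s hs => by rw [hmax s hs]; exact le_max_left _ _)
    (by rw [hmax _ ht₀, ← hmeet, max_self])
  have s2 := hslope (hr1 t₀) (fun s hs => by rw [hmax s hs]; exact le_max_right _ _)
    (by rw [hmax _ ht₀, ← hmeet, max_self])
  obtain ⟨M, hM⟩ := isCompact_univ.exists_bound_of_continuousOn (f := fun x : Torus =>
    c - μ * (u x ^ 2 + u x * u (-x) + u (-x) ^ 2)) (by fun_prop)
  have := eq_zero_of_second_order (w := fun s : ℝ => u (s : Torus) - u (-(s : Torus)))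
    (w' := fun s => f' s - -f' (-s)) (g := fun s : ℝ => c - μ * (u (s : Torus) ^ 2 +
      u (s : Torus) * u (-(s : Torus)) + u (-(s : Torus)) ^ 2)) (K := M) (t₀ := t₀)
    (fun t => (hf1 t).sub (hr1 t)) (fun t => ?_) (fun t => hM (t : Torus) trivial)
    (by simp [hmeet]) (by rw [← s1, ← s2, sub_self]) t
  · exact sub_eq_zero.1 this
  · exact ((hf2 t).sub (hr2 t)).congr_deriv (by ring)

lemma IsGroundState.reflectionOrdered_two {c m : ℝ} (hc : -1 < c)
    (hm4 : 2 * Real.pi * m ^ 4 < 1) {v : Torus → ℝ} (hv : Continuous v)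
    (h : IsGroundState 2 c m v) : ReflectionOrdered fun t : ℝ => v (t : Torus) := by
  intro e
  simp only [add_coe_eq, sub_coe_eq]
  have hg := h.translate zero_le_two hv (e : Torus)
  have hgc : Continuous fun x => v (x + (e : Torus)) := by fun_prop
  by_contra hcon
  push Not at hcon
  obtain ⟨⟨s, hs, hs'⟩, ⟨t, ht, ht'⟩⟩ := hcon
  obtain ⟨r, hr, hr'⟩ := isPreconnected_Ioo.intermediate_value₂ hs ht
    (f := fun t : ℝ => v ((t : Torus) + (e : Torus)))
    (g := fun t : ℝ => v (-(t : Torus) + (e : Torus)))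
    (hgc.comp (AddCircle.continuous_mk' _)).continuousOn
    ((hgc.comp continuous_neg).comp (AddCircle.continuous_mk' _)).continuousOn hs'.le ht'.le
  exact hs'.ne (hg.eq_reflect_of_meet hc hm4 hgc hr hr' s)

lemma IsGroundState.reflectionRigid_two {c m : ℝ} (hc : -1 < c)
    (hm4 : 2 * Real.pi * m ^ 4 < 1) {v : Torus → ℝ} (hv : Continuous v)
    (h : IsGroundState 2 c m v) : ReflectionRigid fun t : ℝ => v (t : Torus) := by
  intro e δ hδ hloc t
  simp only [add_coe_eq, sub_coe_eq] at hloc ⊢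
  have hpos : 0 < min δ Real.pi := lt_min hδ Real.pi_pos
  have h1 := min_le_left δ Real.pi
  have h2 := min_le_right δ Real.pi
  exact (h.translate zero_le_two hv (e : Torus)).eq_reflect_of_meet hc hm4 (by fun_prop)
    (t₀ := min δ Real.pi / 2) ⟨by linarith, by linarith⟩ (hloc _ ⟨by linarith, by linarith⟩) t

/-- Ground states have a single-lobe profile for `α ≤ 2`. -/
theorem IsGroundState.singleLobe {α c m : ℝ} (hα : 1 / 2 < α) (h2 : α ≤ 2) (hc : -1 < c)
    (hm4 : 2 * Real.pi * m ^ 4 < 1) {χ : Torus → ℝ} (hχ : IsGroundState α c m χ) :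
    SingleLobe χ := by
  obtain ⟨v, hv, hχv⟩ := (hχ.regularity hα hc hm4).1
  have h := hχ.congr (by linarith) hχv
  rcases h2.lt_or_eq with h2 | rfl
  · exact singleLobe_of_reflectionOrdered hv hχv (h.reflectionOrdered (by linarith) h2 hv)
      (h.reflectionRigid hα h2 hc hm4 hv) (h.nonconstant hm4)
  · exact singleLobe_of_reflectionOrdered hv hχv (h.reflectionOrdered_two hc hm4 hv)
      (h.reflectionRigid_two hc hm4 hv) (h.nonconstant hm4)

end FracMKdV

end

theorem mainTheorem7 (α : ℝ) (hα : 1 / 2 < α) (c : ℝ) (hc : -1 < c)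
    (m : ℝ) (hm : |m| ≤ (2 * Real.pi) ^ (-(1 / 4) : ℝ)) :
    (∃ χ : FracMKdV.Torus → ℝ, FracMKdV.IsGroundState α c m χ) ∧
    (|m| < (2 * Real.pi) ^ (-(1 / 4) : ℝ) →
      ∀ χ : FracMKdV.Torus → ℝ, FracMKdV.IsGroundState α c m χ →
        (α ≤ 2 → FracMKdV.SingleLobe χ) ∧
        ∃ C : ℝ, 0 < C ∧ ∃ b : ℝ, FracMKdV.SolvesStationary α c b (fun x => C * χ x)) := by
  refine ⟨FracMKdV.exists_isGroundState hα hc (FracMKdV.two_pi_mul_pow_four_le hm),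
    fun hm' χ hχ => ?_⟩
  have hm4 := FracMKdV.two_pi_mul_pow_four_lt hm'
  exact ⟨fun h2 => hχ.singleLobe hα h2 hc hm4, (hχ.regularity hα hc hm4).2⟩
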